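/- Let $\gamma=\tfrac14 e^{-1/2}\approx 0.1516$ and fix a constant $0<\gamma'<\gamma$. There are a deterministic algorithm (one program for a random access machine with exact real arithmetic, in which each arithmetic operation $+,-,\times,/$ on real numbers, each comparison, each addition or truncated subtraction of counters and addresses, and each memory access costs one step), a constant $C$ and integers $K(m,\epsilon)\ge 0$ satisfying $K(m,\epsilon)\le C(\ln M-\ln\epsilon)$, all depending on $\gamma'$ only, such that the following holds. Here $M=\max\{m,2\}$ and $N=\max\{n,1\}$. Let $q_1,\dots,q_m:\mathbb R^n\to\mathbb R$ be quadratic forms, $q_k(x)=\tfrac12\langle Q_kx,x\rangle$ with real symmetric $n\times n$ matrices $Q_k$, and let $r\ge 1$ be an integer such that each $q_k$ depends on at most $r$ of the variables $x_1,\dots,x_n$, each $q_k$ has common variables with at most $r$ other forms, and $|q_k(x)|\le \gamma'\|x\|^2/r$ for all $x\in\mathbb R^n$ and all $k$. Let $0<\epsilon<1$ and $$p(z)=\frac1{(2\pi)^{n/2}}\int_{\mathbb R^n}(1+zq_1(x))\cdots(1+zq_m(x))\,e^{-\|x\|^2/2}\,dx .$$ Then: 1. $p(1)>0$, and the Taylor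 polynomial of $\ln p(z)$ at $z=0$ of degree $K(m,\epsilon)$ has a value $T$ at $z=1$ with $|\ln p(1)-T|\le\epsilon$. 2. For every $s\ge 0$, $$p^{(s)}(0)=s!\sum\ \prod_{(k_1,\dots,k_a)}\frac1{2a}\operatorname{trace}(Q_{k_1}\cdots Q_{k_a}),$$ where the sum is over all unordered collections of pairwise disjoint non-empty ordered tuples of distinct indices from $\{1,\dots,m\}$ with $s$ indices in total, and the product is over the tuples of the collection. 3. Given $n$, $m$, $\epsilon$ and the matrices $Q_1,\dots,Q_m$, the algorithm halts after at most $N^{C}M^{C(\ln M-\ln\epsilon)}$ steps, and outputs the number $T$ and a number $v>0$ which approximates the Gaussian average $p(1)$ of $(1+q_1)\cdots(1+q_m)$ within relative error $\epsilon$: $|\ln v-\ln p(1)|\le\epsilon$ and $|v-p(1)|\le\epsilon\,p(1)$. -/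

import Mathlib

/-! ## A real RAM with a step count

Programs are structured programs over a memory with two sorts of values: natural numbers, used for
counters and addresses, and exact real numbers.  Each sort has registers and arrays, all of which
are named by fixed numbers in the program; only the position inside an array is computed at run
time.  Natural numbers can be added and subtracted (with truncation) and compared; real numbers can
be added, subtracted, multiplied, divided and compared.  A natural number can be converted to a
real one, but there is no rounding or any other conversion back.  The only constants are natural
numbers, so that a program is a finite object.  Every operation, every access to memory and every
test is charged one step. -/

namespace RealRAM

/-- The contents of the memory. -/
structure State where
  /-- registers for natural numbers -/
  ireg : ℕ → ℕ
  /-- registers for real numbers -/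
  rreg : ℕ → ℝ
  /-- arrays of natural numbers: `imem a i` is cell `i` of array `a` -/
  imem : ℕ → ℕ → ℕ
  /-- arrays of real numbers: `rmem a i` is cell `i` of array `a` -/
  rmem : ℕ → ℕ → ℝ

/-- Expressions with natural values. -/
inductive IExpr where
  | const (c : ℕ)
  | reg (x : ℕ)
  | load (a : ℕ) (e : IExpr)
  | add (e₁ e₂ : IExpr)
  | sub (e₁ e₂ : IExpr)

namespace IExpr

def eval (σ : State) : IExpr → ℕ
  | const c => c
  | reg x => σ.ireg x
  | load a e => σ.imem a (e.eval σ)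
  | add e₁ e₂ => e₁.eval σ + e₂.eval σ
  | sub e₁ e₂ => e₁.eval σ - e₂.eval σ

/-- Number of steps for the evaluation of an expression. -/
def cost : IExpr → ℕ
  | const _ => 1
  | reg _ => 1
  | load _ e => e.cost + 1
  | add e₁ e₂ => e₁.cost + e₂.cost + 1
  | sub e₁ e₂ => e₁.cost + e₂.cost + 1

end IExpr

/-- Expressions with real values. -/
inductive RExpr where
  | const (c : ℕ)
  | reg (x : ℕ)
  | load (a : ℕ) (e : IExpr)
  | cast (e : IExpr)
  | add (e₁ e₂ : RExpr)
  | sub (e₁ e₂ : RExpr)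
  | mul (e₁ e₂ : RExpr)
  | div (e₁ e₂ : RExpr)

namespace RExpr

/-- Division by zero returns zero. -/
noncomputable def eval (σ : State) : RExpr → ℝ
  | const c => (c : ℝ)
  | reg x => σ.rreg x
  | load a e => σ.rmem a (e.eval σ)
  | cast e => (e.eval σ : ℝ)
  | add e₁ e₂ => e₁.eval σ + e₂.eval σ
  | sub e₁ e₂ => e₁.eval σ - e₂.eval σ
  | mul e₁ e₂ => e₁.eval σ * e₂.eval σ
  | div e₁ e₂ => e₁.eval σ / e₂.eval σ

/-- Number of steps for the evaluation of an expression. -/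
def cost : RExpr → ℕ
  | const _ => 1
  | reg _ => 1
  | load _ e => e.cost + 1
  | cast e => e.cost + 1
  | add e₁ e₂ => e₁.cost + e₂.cost + 1
  | sub e₁ e₂ => e₁.cost + e₂.cost + 1
  | mul e₁ e₂ => e₁.cost + e₂.cost + 1
  | div e₁ e₂ => e₁.cost + e₂.cost + 1

end RExpr

/-- Tests. -/
inductive Test where
  | ilt (e₁ e₂ : IExpr)
  | rlt (e₁ e₂ : RExpr)
  | neg (b : Test)

namespace Test

def holds (σ : State) : Test → Prop
  | ilt e₁ e₂ => e₁.eval σ < e₂.eval σ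
  | rlt e₁ e₂ => e₁.eval σ < e₂.eval σ
  | neg b => ¬ b.holds σ

/-- Number of steps for a test. -/
def cost : Test → ℕ
  | ilt e₁ e₂ => e₁.cost + e₂.cost + 1
  | rlt e₁ e₂ => e₁.cost + e₂.cost + 1
  | neg b => b.cost + 1

end Test

/-- Programs. -/
inductive Program where
  | skip
  | seq (p₁ p₂ : Program)
  | iset (x : ℕ) (e : IExpr)
  | rset (x : ℕ) (e : RExpr)
  | istore (a : ℕ) (i e : IExpr)
  | rstore (a : ℕ) (i : IExpr) (e : RExpr)
  | branch (b : Test) (p₁ p₂ : Program)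
  | loop (b : Test) (p : Program)

/-- `Run p σ τ t`: program `p`, started with memory `σ`, halts after exactly `t` steps and leaves
memory `τ`. -/
inductive Run : Program → State → State → ℕ → Prop
  | skip (σ : State) : Run .skip σ σ 1
  | seq {p₁ p₂ : Program} {σ τ υ : State} {t₁ t₂ : ℕ} :
      Run p₁ σ τ t₁ → Run p₂ τ υ t₂ → Run (.seq p₁ p₂) σ υ (t₁ + t₂)
  | iset (x : ℕ) (e : IExpr) (σ : State) :
      Run (.iset x e) σ { σ with ireg := Function.update σ.ireg x (e.eval σ) } (e.cost + 1)
  | rset (x : ℕ) (e : RExpr) (σ : State) :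
      Run (.rset x e) σ { σ with rreg := Function.update σ.rreg x (e.eval σ) } (e.cost + 1)
  | istore (a : ℕ) (i e : IExpr) (σ : State) :
      Run (.istore a i e) σ
        { σ with imem :=
            Function.update σ.imem a (Function.update (σ.imem a) (i.eval σ) (e.eval σ)) }
        (i.cost + e.cost + 1)
  | rstore (a : ℕ) (i : IExpr) (e : RExpr) (σ : State) :
      Run (.rstore a i e) σ
        { σ with rmem :=
            Function.update σ.rmem a (Function.update (σ.rmem a) (i.eval σ) (e.eval σ)) }
        (i.cost + e.cost + 1)
  | branch_true {b : Test} {p₁ p₂ : Program} {σ τ : State} {t : ℕ} :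
      b.holds σ → Run p₁ σ τ t → Run (.branch b p₁ p₂) σ τ (b.cost + t)
  | branch_false {b : Test} {p₁ p₂ : Program} {σ τ : State} {t : ℕ} :
      ¬ b.holds σ → Run p₂ σ τ t → Run (.branch b p₁ p₂) σ τ (b.cost + t)
  | loop_stop {b : Test} {p : Program} {σ : State} :
      ¬ b.holds σ → Run (.loop b p) σ σ b.cost
  | loop_next {b : Test} {p : Program} {σ τ υ : State} {t₁ t₂ : ℕ} :
      b.holds σ → Run p σ τ t₁ → Run (.loop b p) τ υ t₂ → Run (.loop b p) σ υ (b.cost + t₁ + t₂)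

/-- Programs are deterministic: the final memory and the number of steps are determined by the
program and the initial memory. -/
theorem Run.unique {p : Program} {σ τ τ' : State} {t t' : ℕ}
    (h : Run p σ τ t) (h' : Run p σ τ' t') : τ = τ' ∧ t = t' := by
  induction h generalizing τ' t' with
  | seq _ _ ih₁ ih₂ =>
    cases h' with
    | seq g₁ g₂ =>
      obtain ⟨rfl, rfl⟩ := ih₁ g₁
      obtain ⟨rfl, rfl⟩ := ih₂ g₂
      exact ⟨rfl, rfl⟩
  | branch_true hb _ ih =>
    cases h' with
    | branch_true _ g => obtain ⟨rfl, rfl⟩ := ih g; exact ⟨rfl, rfl⟩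
    | branch_false hn _ => exact absurd hb hn
  | branch_false hn _ ih =>
    cases h' with
    | branch_true hb _ => exact absurd hb hn
    | branch_false _ g => obtain ⟨rfl, rfl⟩ := ih g; exact ⟨rfl, rfl⟩
  | loop_stop hn =>
    cases h' with
    | loop_stop _ => exact ⟨rfl, rfl⟩
    | loop_next hb _ _ => exact absurd hb hn
  | loop_next hb _ _ ih₁ ih₂ =>
    cases h' with
    | loop_stop hn => exact absurd hb hn
    | loop_next _ g₁ g₂ =>
      obtain ⟨rfl, rfl⟩ := ih₁ g₁
      obtain ⟨rfl, rfl⟩ := ih₂ g₂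
      exact ⟨rfl, rfl⟩
  | _ => cases h'; exact ⟨rfl, rfl⟩

end RealRAM

/-! ## Quadratic forms and their Gaussian averages -/

namespace GaussianProduct

/-- The quadratic form `q(x) = ½ ⟨Q x, x⟩` on `ℝⁿ`. -/
noncomputable def form {n : ℕ} (Q : Matrix (Fin n) (Fin n) ℝ) (x : EuclideanSpace ℝ (Fin n)) : ℝ :=
  1 / 2 * ∑ i, ∑ j, Q i j * x j * x i

/-- The indices `i` such that the function `q` depends on the variable `x i`: the value of `q` can
be changed by changing the coordinate `x i` alone. -/
def dependsOnVars {n : ℕ} (q : EuclideanSpace ℝ (Fin n) → ℝ) : Set (Fin n) :=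
  {i | ∃ x y : EuclideanSpace ℝ (Fin n), (∀ j, j ≠ i → x j = y j) ∧ q x ≠ q y}

/-- Each of the functions depends on at most `r` variables and has common variables with at most
`r` others. -/
def IsSparse {n m : ℕ} (r : ℕ) (q : Fin m → EuclideanSpace ℝ (Fin n) → ℝ) : Prop :=
  (∀ k, (dependsOnVars (q k)).ncard ≤ r) ∧
  ∀ k, {l | l ≠ k ∧ (dependsOnVars (q k) ∩ dependsOnVars (q l)).Nonempty}.ncard ≤ r

/-- `p(z) = (2π)^(-n/2) ∫ (1 + z q₁(x)) ⋯ (1 + z qₘ(x)) exp(-‖x‖²/2) dx` for real `z`; the Gaussian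
average of `(1 + q₁) ⋯ (1 + qₘ)` is `p(1)`. -/
noncomputable def average {n m : ℕ} (Q : Fin m → Matrix (Fin n) (Fin n) ℝ) (z : ℝ) : ℝ :=
  1 / (2 * Real.pi) ^ ((n : ℝ) / 2) *
    ∫ x : EuclideanSpace ℝ (Fin n), (∏ k, (1 + z * form (Q k) x)) * Real.exp (-‖x‖ ^ 2 / 2)

/-- The value at `z = 1` of the Taylor polynomial of degree `d` of `ln p(z)` at `z = 0`. -/
noncomputable def logTaylor {n m : ℕ} (Q : Fin m → Matrix (Fin n) (Fin n) ℝ) (d : ℕ) : ℝ :=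
  ∑ s ∈ Finset.range (d + 1),
    iteratedDeriv s (fun z => Real.log (average Q z)) 0 / (s.factorial : ℝ)

/-- A set of non-empty ordered tuples of distinct indices from `{1, …, m}` which are pairwise
disjoint and contain `s` indices in total. -/
def IsCollection {m : ℕ} (s : ℕ) (S : Finset {l : List (Fin m) // l.Nodup}) : Prop :=
  (∀ l ∈ S, l.1 ≠ []) ∧
  (∀ l ∈ S, ∀ l' ∈ S, l ≠ l' → List.Disjoint l.1 l'.1) ∧
  ∑ l ∈ S, l.1.length = s

/-- The sum, over all collections of pairwise disjoint tuples with `s` indices in total, of the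
products over the tuples `(k₁, …, kₐ)` of the weights `trace (Q_{k₁} ⋯ Q_{kₐ}) / (2 a)`. -/
noncomputable def traceSum {n m : ℕ} (Q : Fin m → Matrix (Fin n) (Fin n) ℝ) (s : ℕ) : ℝ :=
  open Classical in
  ∑ S : Finset {l : List (Fin m) // l.Nodup} with IsCollection s S,
    ∏ l ∈ S, 1 / (2 * (l.1.length : ℝ)) * ((l.1.map Q).prod).trace

/-- The initial memory: registers `0`, `1` for natural numbers hold `n`, `m`, register `0` for real
numbers holds `ε`, and array `0` of real numbers lists the entries of `Q₁, …, Qₘ`, matrix by matrix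
and row by row (cell `(k n + i) n + j` holds the entry `(i, j)` of the matrix with index `k`, all
indices starting at zero).  Everything else is zero. -/
noncomputable def input {n m : ℕ} (Q : Fin m → Matrix (Fin n) (Fin n) ℝ) (ε : ℝ) :
    RealRAM.State where
  ireg x := if x = 0 then n else if x = 1 then m else 0
  rreg x := if x = 0 then ε else 0
  imem _ _ := 0
  rmem a c :=
    if a = 0 then
      ∑ k : Fin m, ∑ i : Fin n, ∑ j : Fin n,
        if c = ((k : ℕ) * n + (i : ℕ)) * n + (j : ℕ) then Q k i j else 0
    else 0

theorem input_rmem_entry {n m : ℕ} (Q : Fin m → Matrix (Fin n) (Fin n) ℝ) (ε : ℝ)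
    (k : Fin m) (i j : Fin n) :
    (input Q ε).rmem 0 (((k : ℕ) * n + (i : ℕ)) * n + (j : ℕ)) = Q k i j := by
  have key : ∀ a b c d : ℕ, c < n → d < n → a * n + c = b * n + d → a = b ∧ c = d := by
    intro a b c d hc hd h
    have hn : 0 < n := by omega
    have h1 : (a * n + c) / n = (b * n + d) / n := by rw [h]
    have h2 : (a * n + c) % n = (b * n + d) % n := by rw [h]
    rw [Nat.mul_comm a, Nat.mul_comm b, Nat.mul_add_div hn, Nat.mul_add_div hn,
      Nat.div_eq_of_lt hc, Nat.div_eq_of_lt hd] at h1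
    rw [Nat.mul_comm a, Nat.mul_comm b, Nat.mul_add_mod, Nat.mul_add_mod,
      Nat.mod_eq_of_lt hc, Nat.mod_eq_of_lt hd] at h2
    exact ⟨by simpa using h1, h2⟩
  simp only [input, if_true]
  rw [Finset.sum_eq_single k, Finset.sum_eq_single i, Finset.sum_eq_single j]
  · simp
  · intro b _ hb
    refine if_neg fun h => hb ?_
    exact Fin.ext (key _ _ _ _ j.2 b.2 h).2.symm
  · simp
  · intro b _ hb
    refine Finset.sum_eq_zero fun d _ => if_neg fun h => hb ?_
    have h' := (key _ _ _ _ j.2 d.2 h).1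
    exact Fin.ext (key _ _ _ _ i.2 b.2 h').2.symm
  · simp
  · intro b _ hb
    refine Finset.sum_eq_zero fun c _ => Finset.sum_eq_zero fun d _ => if_neg fun h => hb ?_
    have h' := (key _ _ _ _ j.2 d.2 h).1
    exact Fin.ext (key _ _ _ _ i.2 c.2 h').1.symm
  · simp

end GaussianProduct

/-! Write p_T(z) for the Gaussian average of the product of 1 + z q_k over k in T, and G_{A,T}(z)
for the average of ½⟨Ax, x⟩ times the same product, where A need not be symmetric. Integration by
parts gives G_{A,T} = ½ tr(A) p_T + z Σ_{l ∈ T} G_{A Q_l, T∖l} (`avgPolyWith_eq`). Besides, p_{T∪k}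
= p_T + z G_{Q_k,T} for k outside T, and p_T′ = Σ_{l ∈ T} G_{Q_l, T∖l}. These three identities carry
the whole treatment of p.

Zeros. In the disc of radius γ/γ′ > 1 one shows |p_{T∖k}| ≤ e^{1/2} |p_T| by induction on |T|
(`norm_avgPoly_erase_le`). Given this for smaller sets, the recursion yields |G_{A,T}| ≤ r‖A‖ |p_T|
(`norm_avgPolyWith_le`): half of the bound pays for the trace, and half for the at most r nonzero
terms of the sum. Hence z G_{Q_k,T∖k} is small against p_{T∖k}, and the induction closes. As p_∅ =
1, no p_T vanishes in the disc.

Coefficients. Unrolling the recursion expresses s times the coefficient of z^s in p_T through lower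
coefficients of p_{T∖l}, with weights ½ tr(Q_{k₁}⋯Q_{kₐ}) over tuples l in T. Sums over collections
satisfy the same recursion, by marking one tuple of the collection (`mul_traceSumIn`), so the two
agree.

Logarithm. With θ = γ′/γ, the polynomial factors as p(z) = ∏(1 − zw) with at most m factors and |w|
≤ θ. The Taylor coefficients of ln p are thus at most m θ^s in absolute value (`logCoeff_bounds`),
and a degree of order ln M − ln ε suffices.

Algorithm. Enumerating collections is avoided: the coefficient of z^s is also a sum over ordered
tuples of s distinct indices of a number computed by one matrix multiplication per index
(`tupleData`, `coeff_eq_tupleSum`). Tuples are enumerated as base m expansions of the numbers below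
m^s, and the coefficients of ln p follow from p′ = (ln p)′ p. The sum T of the latter is
exponentiated approximately as (1 + T/2^K)^{2^K}, by repeated squaring. Running times are controlled
by a small program logic (`Exec`) in which the exponent of the bound counts nested loops. -/

namespace GaussianProduct

open MeasureTheory MvPolynomial

/-! ### Gaussian averages of polynomials -/

theorem integrable_pow_mul_exp_neg_sq_div_two (a : ℕ) :
    Integrable fun x : ℝ => x ^ a * Real.exp (-x ^ 2 / 2) := by
  have h := integrable_rpow_mul_exp_neg_mul_sq (b := 1 / 2) (by norm_num) (s := a)
    (by linarith [(Nat.cast_nonneg a : (0 : ℝ) ≤ a)])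
  refine h.congr (Filter.Eventually.of_forall fun x => ?_)
  simp only [Real.rpow_natCast]
  congr 2
  ring

/-- The (not normalized) moments of the standard Gaussian measure on the line. -/
noncomputable def gaussMoment (a : ℕ) : ℝ := ∫ x : ℝ, x ^ a * Real.exp (-x ^ 2 / 2)

theorem gaussMoment_zero : gaussMoment 0 = √(2 * Real.pi) := by
  have h := integral_gaussian (1 / 2)
  rw [show Real.pi / (1 / 2) = 2 * Real.pi by ring] at h
  rw [← h, gaussMoment]
  congr 1
  ext x
  rw [pow_zero, one_mul]
  congr 1
  ring

/-- The derivative of x^a e^{−x²/2} has integral zero. For a = 0 the truncated a − 1 does no harm,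
because it comes with the factor a. -/
theorem gaussMoment_succ (a : ℕ) : gaussMoment (a + 1) = a * gaussMoment (a - 1) := by
  have hd : ∀ x : ℝ, HasDerivAt (fun x : ℝ => x ^ a * Real.exp (-x ^ 2 / 2))
      (a * (x ^ (a - 1) * Real.exp (-x ^ 2 / 2)) - x ^ (a + 1) * Real.exp (-x ^ 2 / 2)) x := by
    intro x
    have h1 : HasDerivAt (fun x : ℝ => -x ^ 2 / 2) (-x) x := by
      refine ((hasDerivAt_pow 2 x).neg.div_const 2).congr_deriv ?_
      push_cast
      ring
    refine ((hasDerivAt_pow a x).mul h1.exp).congr_deriv ?_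
    ring
  have hi := (integrable_pow_mul_exp_neg_sq_div_two (a - 1)).const_mul (a : ℝ)
  have h := integral_eq_zero_of_hasDerivAt_of_integrable hd
    (hi.sub (integrable_pow_mul_exp_neg_sq_div_two (a + 1)))
    (integrable_pow_mul_exp_neg_sq_div_two a)
  rw [integral_sub hi (integrable_pow_mul_exp_neg_sq_div_two (a + 1)),
    integral_const_mul] at h
  simp only [gaussMoment]
  linarith

variable {n : ℕ}

theorem exp_neg_norm_sq_toLp (x : Fin n → ℝ) :
    Real.exp (-‖WithLp.toLp 2 x‖ ^ 2 / 2) = ∏ i, Real.exp (-x i ^ 2 / 2) := by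
  rw [← Real.exp_sum, EuclideanSpace.norm_sq_eq, ← Finset.sum_neg_distrib, ← Finset.sum_div,
    Finset.sum_neg_distrib]
  simp [Finset.sum_neg_distrib]

theorem monomial_mul_gaussian_toLp (α : Fin n →₀ ℕ) (c : ℝ) (x : Fin n → ℝ) :
    eval x (monomial α c) * Real.exp (-‖WithLp.toLp 2 x‖ ^ 2 / 2) =
      c * ∏ i, (x i ^ α i * Real.exp (-x i ^ 2 / 2)) := by
  rw [exp_neg_norm_sq_toLp, eval_monomial, Finset.prod_mul_distrib,
    Finsupp.prod_fintype _ _ (by simp), mul_assoc]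

theorem integrable_eval_mul_gaussian (F : MvPolynomial (Fin n) ℝ) :
    Integrable fun x : EuclideanSpace ℝ (Fin n) => eval x F * Real.exp (-‖x‖ ^ 2 / 2) := by
  induction F using MvPolynomial.induction_on' with
  | monomial α c =>
    rw [← (PiLp.volume_preserving_toLp (Fin n)).integrable_comp_emb
      (MeasurableEquiv.toLp 2 _).measurableEmbedding]
    refine ((Integrable.fintype_prod fun i =>
      integrable_pow_mul_exp_neg_sq_div_two (α i)).const_mul c).congr
      (Filter.Eventually.of_forall fun x => ?_)
    exact (monomial_mul_gaussian_toLp α c x).symm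
  | add F G hF hG =>
    refine (hF.add hG).congr (Filter.Eventually.of_forall fun x => ?_)
    simp [add_mul]

/-- The average of a polynomial with respect to the standard Gaussian measure. -/
noncomputable def gaussE : MvPolynomial (Fin n) ℝ →ₗ[ℝ] ℝ where
  toFun F := 1 / (2 * Real.pi) ^ ((n : ℝ) / 2) *
    ∫ x : EuclideanSpace ℝ (Fin n), eval x F * Real.exp (-‖x‖ ^ 2 / 2)
  map_add' F G := by
    rw [← mul_add, ← integral_add (integrable_eval_mul_gaussian F) (integrable_eval_mul_gaussian G)]
    simp [add_mul]
  map_smul' c F := by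
    simp only [smul_eval, RingHom.id_apply, smul_eq_mul, mul_assoc, integral_const_mul]
    ring

theorem gaussE_apply (F : MvPolynomial (Fin n) ℝ) :
    gaussE F = 1 / (2 * Real.pi) ^ ((n : ℝ) / 2) *
      ∫ x : EuclideanSpace ℝ (Fin n), eval x F * Real.exp (-‖x‖ ^ 2 / 2) := rfl

theorem gaussE_monomial (α : Fin n →₀ ℕ) (c : ℝ) :
    gaussE (monomial α c) =
      1 / (2 * Real.pi) ^ ((n : ℝ) / 2) * (c * ∏ i, gaussMoment (α i)) := by
  rw [gaussE_apply, ← (PiLp.volume_preserving_toLp (Fin n)).integral_comp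
    (MeasurableEquiv.toLp 2 _).measurableEmbedding]
  simp only [monomial_mul_gaussian_toLp, integral_const_mul, gaussMoment]
  rw [integral_fintype_prod_volume_eq_prod (fun i (v : ℝ) => v ^ α i * Real.exp (-v ^ 2 / 2))]

theorem gaussE_one : gaussE (1 : MvPolynomial (Fin n) ℝ) = 1 := by
  rw [← C_1, ← monomial_zero', gaussE_monomial]
  simp only [Finsupp.coe_zero, Pi.zero_apply, gaussMoment_zero, Finset.prod_const,
    Finset.card_univ, Fintype.card_fin, one_mul]
  have h : (0 : ℝ) < 2 * Real.pi := by positivity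
  rw [Real.sqrt_eq_rpow, ← Real.rpow_natCast, ← Real.rpow_mul h.le]
  rw [show (1 / 2 : ℝ) * n = n / 2 by ring]
  exact one_div_mul_cancel (Real.rpow_pos_of_pos h _).ne'

/-- Gaussian integration by parts. -/
theorem gaussE_X_mul (i : Fin n) (F : MvPolynomial (Fin n) ℝ) :
    gaussE (X i * F) = gaussE (pderiv i F) := by
  induction F using MvPolynomial.induction_on' with
  | monomial α c =>
    rw [pderiv_monomial, X, monomial_mul, gaussE_monomial, gaussE_monomial]
    rw [← Finset.mul_prod_erase _ _ (Finset.mem_univ i),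
      ← Finset.mul_prod_erase _ _ (Finset.mem_univ i)]
    -- Only the factor of the variable i differs between the two sides; there the claim is the
    -- recursion for the moments.
    have h : ∀ j ∈ Finset.univ.erase i, gaussMoment ((Finsupp.single i 1 + α : Fin n →₀ ℕ) j) =
        gaussMoment ((α - Finsupp.single i 1 : Fin n →₀ ℕ) j) := by
      intro j hj
      have : i ≠ j := (Finset.ne_of_mem_erase hj).symm
      simp [this]
    rw [Finset.prod_congr rfl h]
    simp only [Finsupp.coe_add, Pi.add_apply, Finsupp.single_eq_same, Finsupp.coe_tsub,
      Pi.sub_apply]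
    rw [add_comm 1, gaussMoment_succ]
    ring
  | add F G hF hG => rw [mul_add, map_add, map_add, map_add, hF, hG]

/-! ### Averages of products of quadratic forms -/

/-- The quadratic form `½ ⟨A x, x⟩` as a polynomial. -/
noncomputable def quadPoly (A : Matrix (Fin n) (Fin n) ℝ) : MvPolynomial (Fin n) ℝ :=
  C (1 / 2) * ∑ i, ∑ j, C (A i j) * (X j * X i)

theorem eval_quadPoly (A : Matrix (Fin n) (Fin n) ℝ) (x : EuclideanSpace ℝ (Fin n)) :
    eval x (quadPoly A) = form A x := by
  simp [quadPoly, form, mul_assoc]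

theorem pderiv_quadPoly {A : Matrix (Fin n) (Fin n) ℝ} (hA : A.IsSymm) (i : Fin n) :
    pderiv i (quadPoly A) = ∑ k, C (A i k) * X k := by
  have h : ∀ a b : Fin n, A a b = A b a := fun a b => by rw [← hA.apply a b]
  simp only [quadPoly, map_sum, pderiv_mul, pderiv_X, pderiv_C, Pi.single_apply, zero_mul,
    zero_add]
  simp only [ite_mul, one_mul, zero_mul, mul_ite, mul_one, mul_zero, mul_add,
    Finset.sum_add_distrib, Finset.sum_ite_irrel, Finset.sum_const_zero,
    Finset.mem_univ, if_true, Finset.sum_ite_eq']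
  rw [Finset.sum_congr rfl fun k _ => congrArg (fun c => C c * X k) (h k i), ← two_mul,
    ← mul_assoc]
  rw [show (2 : MvPolynomial (Fin n) ℝ) = C 2 from (map_ofNat C 2).symm, ← C_mul]
  norm_num

variable {ι : Type*}

theorem pderiv_prod [DecidableEq ι] (F : ι → MvPolynomial (Fin n) ℝ) (V : Finset ι) (i : Fin n) :
    pderiv i (∏ l ∈ V, F l) = ∑ l ∈ V, pderiv i (F l) * ∏ j ∈ V.erase l, F j := by
  induction V using Finset.induction_on with
  | empty => simp
  | insert a V ha ih =>
    rw [Finset.prod_insert ha, pderiv_mul, ih, Finset.sum_insert ha, Finset.erase_insert ha,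
      Finset.mul_sum]
    congr 1
    refine Finset.sum_congr rfl fun l hl => ?_
    have : a ≠ l := fun h => ha (h ▸ hl)
    rw [Finset.erase_insert_of_ne this, Finset.prod_insert (fun h => ha (Finset.mem_of_mem_erase h))]
    ring

/-- The Gaussian average of the product of the forms with matrices `Q l` for `l ∈ V`. -/
noncomputable def prodMean (Q : ι → Matrix (Fin n) (Fin n) ℝ) (V : Finset ι) : ℝ :=
  gaussE (∏ l ∈ V, quadPoly (Q l))

/-- The Gaussian average of the product of the forms with the matrices `A` and `Q l`, `l ∈ V`. -/
noncomputable def prodMeanWith (Q : ι → Matrix (Fin n) (Fin n) ℝ) (A : Matrix (Fin n) (Fin n) ℝ)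
    (V : Finset ι) : ℝ :=
  gaussE (quadPoly A * ∏ l ∈ V, quadPoly (Q l))

theorem prodMean_empty (Q : ι → Matrix (Fin n) (Fin n) ℝ) : prodMean Q ∅ = 1 := by
  simp [prodMean, gaussE_one]

theorem prodMean_insert [DecidableEq ι] (Q : ι → Matrix (Fin n) (Fin n) ℝ) {k : ι} {V : Finset ι} (hk : k ∉ V) :
    prodMean Q (insert k V) = prodMeanWith Q (Q k) V := by
  rw [prodMean, prodMeanWith, Finset.prod_insert hk]

/-- Integrate x_j (x_i F) by parts with respect to x_j. The derivative of x_i produces the trace; in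
the other term the factor x_i is kept, to form a new quadratic form with the derivative of F. -/
theorem gaussE_quadPoly_mul (A : Matrix (Fin n) (Fin n) ℝ) (F : MvPolynomial (Fin n) ℝ) :
    gaussE (quadPoly A * F) = 1 / 2 * A.trace * gaussE F +
      1 / 2 * ∑ i, ∑ j, A i j * gaussE (X i * pderiv j F) := by
  have h : quadPoly A * F = (1 / 2 : ℝ) • ∑ i, ∑ j, A i j • (X j * (X i * F)) := by
    simp only [quadPoly, smul_eq_C_mul, mul_assoc, Finset.sum_mul]
  rw [h]
  simp only [map_smul, map_sum, gaussE_X_mul, smul_eq_mul, pderiv_mul, map_add, pderiv_X,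
    Pi.single_apply, mul_add, Finset.sum_add_distrib, ite_mul, one_mul, zero_mul]
  congr 1
  rw [mul_assoc, Matrix.trace, Finset.sum_mul]
  congr 1
  refine Finset.sum_congr rfl fun i _ => ?_
  rw [Finset.sum_eq_single i (by intro b _ hb; simp [hb.symm]) (by simp)]
  simp

/-- When the derivative hits q_l it gives (Q_l x)_j, and ½ Σ A_ij x_i (Q_l x)_j is the form of A
Q_l: the factor q_l is absorbed into A. Products of symmetric matrices are not symmetric in general,
so A has to be arbitrary. -/
theorem prodMeanWith_eq [DecidableEq ι] {Q : ι → Matrix (Fin n) (Fin n) ℝ} (hQ : ∀ k, (Q k).IsSymm)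
    (A : Matrix (Fin n) (Fin n) ℝ) (V : Finset ι) :
    prodMeanWith Q A V = 1 / 2 * A.trace * prodMean Q V +
      ∑ l ∈ V, prodMeanWith Q (A * Q l) (V.erase l) := by
  rw [prodMeanWith, gaussE_quadPoly_mul, prodMean]
  congr 1
  simp only [pderiv_prod, Finset.mul_sum, map_sum]
  rw [Finset.sum_congr rfl fun i _ => Finset.sum_comm, Finset.sum_comm]
  refine Finset.sum_congr rfl fun l _ => ?_
  have h : quadPoly (A * Q l) * ∏ j ∈ V.erase l, quadPoly (Q j) =
      ∑ i, ∑ j, (1 / 2 * A i j) •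
        (X i * (pderiv j (quadPoly (Q l)) * ∏ j ∈ V.erase l, quadPoly (Q j))) := by
    simp only [pderiv_quadPoly (hQ l), ← mul_assoc, ← smul_mul_assoc, ← Finset.sum_mul]
    congr 1
    simp only [quadPoly, Matrix.mul_apply, map_sum, Finset.mul_sum, Finset.sum_mul, map_mul,
      smul_eq_C_mul]
    refine Finset.sum_congr rfl fun i _ => ?_
    rw [Finset.sum_comm]
    refine Finset.sum_congr rfl fun j _ => Finset.sum_congr rfl fun k _ => ?_
    ring
  rw [prodMeanWith, h]
  simp only [map_sum, map_smul, smul_eq_mul, mul_assoc]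

end GaussianProduct

namespace GaussianProduct

/-! ### The averages as polynomials in `z` -/

section PartitionPoly

open Polynomial

variable {n : ℕ} {ι : Type*}

/-- Pairs (V, l) with l ∈ V correspond to pairs (l, V∖l). -/
theorem sum_powerset_sum_erase [DecidableEq ι] {M : Type*} [AddCommMonoid M] (T : Finset ι)
    (ψ : ι → Finset ι → M) :
    ∑ V ∈ T.powerset, ∑ l ∈ V, ψ l (V.erase l) = ∑ l ∈ T, ∑ V ∈ (T.erase l).powerset, ψ l V := by
  rw [Finset.sum_sigma', Finset.sum_sigma']
  refine Finset.sum_bij' (fun p _ => ⟨p.2, p.1.erase p.2⟩) (fun p _ => ⟨insert p.1 p.2, p.1⟩)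
    ?_ ?_ ?_ ?_ ?_
  · rintro ⟨V, l⟩ h
    simp only [Finset.mem_sigma, Finset.mem_powerset] at h ⊢
    exact ⟨h.1 h.2, Finset.erase_subset_erase _ h.1⟩
  · rintro ⟨l, V⟩ h
    simp only [Finset.mem_sigma, Finset.mem_powerset] at h ⊢
    exact ⟨Finset.insert_subset h.1 (h.2.trans (Finset.erase_subset _ _)),
      Finset.mem_insert_self _ _⟩
  · rintro ⟨V, l⟩ h
    simp only [Finset.mem_sigma, Finset.mem_powerset] at h
    simp [Finset.insert_erase h.2]
  · rintro ⟨l, V⟩ h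
    simp only [Finset.mem_sigma, Finset.mem_powerset] at h
    have : l ∉ V := fun hl => (Finset.mem_erase.1 (h.2 hl)).1 rfl
    simp [Finset.erase_insert this]
  · intros
    rfl

/-- The average of the product of `1 + z q_k` for `k ∈ T`, as a polynomial in `z`. -/
noncomputable def avgPoly (Q : ι → Matrix (Fin n) (Fin n) ℝ) (T : Finset ι) : ℝ[X] :=
  ∑ V ∈ T.powerset, X ^ V.card * C (prodMean Q V)

/-- The average of the product of `½ ⟨A x, x⟩` and of `1 + z q_k` for `k ∈ T`, as a polynomial
in `z`. -/
noncomputable def avgPolyWith (Q : ι → Matrix (Fin n) (Fin n) ℝ) (A : Matrix (Fin n) (Fin n) ℝ)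
    (T : Finset ι) : ℝ[X] :=
  ∑ V ∈ T.powerset, X ^ V.card * C (prodMeanWith Q A V)

theorem avgPoly_empty (Q : ι → Matrix (Fin n) (Fin n) ℝ) : avgPoly Q ∅ = 1 := by
  simp [avgPoly, prodMean_empty]

theorem avgPoly_coeff_zero (Q : ι → Matrix (Fin n) (Fin n) ℝ) (T : Finset ι) :
    (avgPoly Q T).coeff 0 = 1 := by
  simp only [avgPoly, finsetSum_coeff, coeff_mul_C, coeff_X_pow]
  rw [Finset.sum_eq_single ∅]
  · simp [prodMean_empty]
  · intro V _ hV
    rw [if_neg, zero_mul]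
    exact fun h => hV (Finset.card_eq_zero.1 h.symm)
  · simp

theorem avgPoly_natDegree_le (Q : ι → Matrix (Fin n) (Fin n) ℝ) (T : Finset ι) :
    (avgPoly Q T).natDegree ≤ T.card := by
  refine natDegree_sum_le_of_forall_le _ _ fun V hV => ?_
  refine (natDegree_mul_C_le _ _).trans ((natDegree_X_pow_le _).trans ?_)
  exact Finset.card_le_card (Finset.mem_powerset.1 hV)

variable [DecidableEq ι]

theorem avgPoly_insert (Q : ι → Matrix (Fin n) (Fin n) ℝ) {k : ι} {T : Finset ι} (hk : k ∉ T) :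
    avgPoly Q (insert k T) = avgPoly Q T + X * avgPolyWith Q (Q k) T := by
  rw [avgPoly, Finset.sum_powerset_insert hk, avgPoly, avgPolyWith, Finset.mul_sum]
  congr 1
  refine Finset.sum_congr rfl fun V hV => ?_
  have hkV : k ∉ V := fun h => hk (Finset.mem_powerset.1 hV h)
  rw [prodMean_insert Q hkV, Finset.card_insert_of_notMem hkV]
  ring

/-- This is `prodMeanWith_eq` weighted by z^|V| and summed over V ⊆ T. Absorbing q_l lowers |V| by
one, whence the factor X. -/
theorem avgPolyWith_eq {Q : ι → Matrix (Fin n) (Fin n) ℝ} (hQ : ∀ k, (Q k).IsSymm)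
    (A : Matrix (Fin n) (Fin n) ℝ) (T : Finset ι) :
    avgPolyWith Q A T = C (1 / 2 * A.trace) * avgPoly Q T +
      X * ∑ l ∈ T, avgPolyWith Q (A * Q l) (T.erase l) := by
  have h := sum_powerset_sum_erase T
    (fun l V => X * (X ^ V.card * C (prodMeanWith Q (A * Q l) V)))
  simp only [avgPolyWith, Finset.mul_sum, avgPoly]
  rw [← h, ← Finset.sum_add_distrib]
  refine Finset.sum_congr rfl fun V _ => ?_
  rw [prodMeanWith_eq hQ, C_add, mul_add, map_sum, Finset.mul_sum, C_mul]
  congr 1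
  · ring
  · refine Finset.sum_congr rfl fun l hl => ?_
    rw [← mul_assoc, ← pow_succ', Finset.card_erase_add_one hl]

/-- The factor |V| from differentiating z^|V| counts the choices of the form q_l singled out in V.
-/
theorem derivative_avgPoly (Q : ι → Matrix (Fin n) (Fin n) ℝ) (T : Finset ι) :
    derivative (avgPoly Q T) = ∑ l ∈ T, avgPolyWith Q (Q l) (T.erase l) := by
  have h := sum_powerset_sum_erase T
    (fun l V => X ^ V.card * C (prodMeanWith Q (Q l) V))
  simp only [avgPolyWith, avgPoly, derivative_sum]
  rw [← h]
  refine Finset.sum_congr rfl fun V _ => ?_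
  rw [derivative_mul, derivative_C, mul_zero, add_zero, derivative_X_pow]
  have h2 : ∀ l ∈ V, X ^ (V.erase l).card * C (prodMeanWith Q (Q l) (V.erase l)) =
      X ^ (V.card - 1) * C (prodMean Q V) := by
    intro l hl
    rw [← prodMean_insert Q (Finset.notMem_erase l V), Finset.insert_erase hl,
      Finset.card_erase_of_mem hl]
  rw [Finset.sum_congr rfl h2, Finset.sum_const, nsmul_eq_mul, C_eq_natCast, mul_assoc]

theorem coeff_avgPoly_succ (Q : ι → Matrix (Fin n) (Fin n) ℝ) (T : Finset ι) (s : ℕ) :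
    (s + 1 : ℝ) * (avgPoly Q T).coeff (s + 1) =
      ∑ l ∈ T, (avgPolyWith Q (Q l) (T.erase l)).coeff s := by
  rw [← finsetSum_coeff, ← derivative_avgPoly, coeff_derivative]
  ring

theorem coeff_zero_avgPolyWith {Q : ι → Matrix (Fin n) (Fin n) ℝ} (hQ : ∀ k, (Q k).IsSymm)
    (A : Matrix (Fin n) (Fin n) ℝ) (T : Finset ι) :
    (avgPolyWith Q A T).coeff 0 = 1 / 2 * A.trace := by
  rw [avgPolyWith_eq hQ, coeff_add, coeff_C_mul, avgPoly_coeff_zero, coeff_X_mul_zero]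
  ring

theorem coeff_succ_avgPolyWith {Q : ι → Matrix (Fin n) (Fin n) ℝ} (hQ : ∀ k, (Q k).IsSymm)
    (A : Matrix (Fin n) (Fin n) ℝ) (T : Finset ι) (s : ℕ) :
    (avgPolyWith Q A T).coeff (s + 1) = 1 / 2 * A.trace * (avgPoly Q T).coeff (s + 1) +
      ∑ l ∈ T, (avgPolyWith Q (A * Q l) (T.erase l)).coeff s := by
  conv_lhs => rw [avgPolyWith_eq hQ]
  rw [coeff_add, coeff_C_mul, coeff_X_mul, finsetSum_coeff]

end PartitionPoly

theorem eval_avgPoly {n : ℕ} {ι : Type*} (Q : ι → Matrix (Fin n) (Fin n) ℝ) (T : Finset ι)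
    (z : ℝ) :
    (avgPoly Q T).eval z = gaussE (∏ k ∈ T, (1 + MvPolynomial.C z * quadPoly (Q k))) := by
  classical
  simp only [add_comm (1 : MvPolynomial (Fin n) ℝ), Finset.prod_add_one, Finset.prod_mul_distrib,
    Finset.prod_const, map_sum, avgPoly, Polynomial.eval_finsetSum, prodMean]
  refine Finset.sum_congr rfl fun V _ => ?_
  rw [← map_pow, ← MvPolynomial.smul_eq_C_mul, map_smul, smul_eq_mul, Polynomial.eval_mul,
    Polynomial.eval_pow, Polynomial.eval_X, Polynomial.eval_C]

theorem average_eq_eval {n m : ℕ} (Q : Fin m → Matrix (Fin n) (Fin n) ℝ) (z : ℝ) :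
    average Q z = (avgPoly Q Finset.univ).eval z := by
  rw [eval_avgPoly]
  simp [average, gaussE_apply, map_prod, eval_quadPoly]

end GaussianProduct

namespace GaussianProduct

/-! ### The polynomial has no zeros in a disc -/

section ZeroFree

open scoped Matrix.Norms.L2Operator
open Polynomial

variable {n : ℕ} {ι : Type*}

theorem form_eq_dotProduct (A : Matrix (Fin n) (Fin n) ℝ) (x : EuclideanSpace ℝ (Fin n)) :
    form A x = 1 / 2 * (x.ofLp ⬝ᵥ A.mulVec x.ofLp) := by
  simp only [form, dotProduct, Matrix.mulVec, Finset.mul_sum]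
  refine Finset.sum_congr rfl fun i _ => Finset.sum_congr rfl fun j _ => ?_
  ring

theorem abs_diag_le_norm (A : Matrix (Fin n) (Fin n) ℝ) (i : Fin n) : |A i i| ≤ ‖A‖ := by
  have h := Matrix.inner_toEuclideanCLM A (EuclideanSpace.single i 1) (EuclideanSpace.single i 1)
  have h2 : A i i = inner ℝ (EuclideanSpace.single i (1 : ℝ))
      (Matrix.toEuclideanCLM (𝕜 := ℝ) A (EuclideanSpace.single i (1 : ℝ))) := by
    rw [h]
    simp
  rw [h2]
  refine (abs_real_inner_le_norm _ _).trans ?_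
  have h3 := (Matrix.toEuclideanCLM (𝕜 := ℝ) A).le_opNorm (EuclideanSpace.single i (1 : ℝ))
  rw [Matrix.l2_opNorm_toEuclideanCLM] at h3
  simpa using h3

theorem abs_trace_le {r : ℕ} {A : Matrix (Fin n) (Fin n) ℝ} {R : Finset (Fin n)}
    (hR : R.card ≤ r) (hA : ∀ i ∉ R, A i i = 0) : |A.trace| ≤ r * ‖A‖ := by
  have h : A.trace = ∑ i ∈ R, A i i := by
    rw [Matrix.trace]
    exact (Finset.sum_subset (Finset.subset_univ R) fun i _ hi => hA i hi).symm
  rw [h]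
  refine (Finset.abs_sum_le_sum_abs _ _).trans ?_
  refine (Finset.sum_le_card_nsmul _ _ _ fun i _ => abs_diag_le_norm A i).trans ?_
  rw [nsmul_eq_mul]
  gcongr

/-- The norm of a symmetric operator is the supremum of its absolute Rayleigh quotients; the 2
undoes the ½ in the form. -/
theorem norm_le_of_abs_form_le {A : Matrix (Fin n) (Fin n) ℝ} (hA : A.IsSymm) {c : ℝ} (hc : 0 ≤ c)
    (h : ∀ x, |form A x| ≤ c * ‖x‖ ^ 2) : ‖A‖ ≤ 2 * c := by
  rw [← Matrix.l2_opNorm_toEuclideanCLM]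
  have hs : (Matrix.toEuclideanCLM (𝕜 := ℝ) A).IsSymmetric := by
    refine Matrix.isSymmetric_toEuclideanLin_iff.2 ?_
    rwa [Matrix.IsHermitian, Matrix.conjTranspose_eq_transpose_of_trivial]
  rw [ContinuousLinearMap.norm_eq_iSup_rayleighQuotient _ hs]
  refine ciSup_le fun x => ?_
  have h1 := h x
  rw [form_eq_dotProduct, ← Matrix.inner_toEuclideanCLM, real_inner_comm] at h1
  rw [ContinuousLinearMap.rayleighQuotient, ContinuousLinearMap.reApplyInnerSelf_apply, abs_div,
    abs_of_nonneg (sq_nonneg ‖x‖)]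
  refine div_le_of_le_mul₀ (sq_nonneg _) (by linarith) ?_
  rw [abs_mul, abs_of_pos (by norm_num : (0 : ℝ) < 1 / 2)] at h1
  change |inner ℝ (Matrix.toEuclideanCLM (𝕜 := ℝ) A x) x| ≤ _
  linarith

/-- The value at a complex number `z` of a polynomial with real coefficients. -/
noncomputable abbrev cval (z : ℂ) (p : ℝ[X]) : ℂ := aeval z p

theorem avgPolyWith_zero (Q : ι → Matrix (Fin n) (Fin n) ℝ) (T : Finset ι) :
    avgPolyWith Q 0 T = 0 := by
  simp [avgPolyWith, prodMeanWith, quadPoly]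

variable [DecidableEq ι]

/-- Induction on |T| along the recursion for G_{A,T}. The conditions on A survive the passage to A
Q_j: its nonzero rows stay in R, and A Q_j Q_k ≠ 0 forces Q_j Q_k ≠ 0, so at most r indices k remain
relevant. The comparison of p_{U∖k} with p_U is assumed here for U ⊆ T; the next lemma supplies it
by an outer induction. -/
theorem norm_avgPolyWith_le {Q : ι → Matrix (Fin n) (Fin n) ℝ} (hQ : ∀ k, (Q k).IsSymm)
    {r : ℕ} {ρ b : ℝ} (hρ : 0 ≤ ρ) (hb : 0 ≤ b) (hQn : ∀ k, ‖Q k‖ ≤ ρ)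
    (hN : ∀ k, ∀ T : Finset ι, k ∉ T → (T.filter fun j => Q k * Q j ≠ 0).card ≤ r)
    {z : ℂ} (hz : ‖z‖ * (r * ρ) * b ≤ 1 / 2) (T : Finset ι)
    (hT : ∀ U ⊆ T, ∀ k ∈ U, ‖cval z (avgPoly Q (U.erase k))‖ ≤ b * ‖cval z (avgPoly Q U)‖)
    (A : Matrix (Fin n) (Fin n) ℝ) {R : Finset (Fin n)} (hR : R.card ≤ r)
    (hA : ∀ i ∉ R, ∀ j, A i j = 0) (hAN : (T.filter fun j => A * Q j ≠ 0).card ≤ r) :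
    ‖cval z (avgPolyWith Q A T)‖ ≤ r * ‖A‖ * ‖cval z (avgPoly Q T)‖ := by
  induction hn : T.card using Nat.strong_induction_on generalizing T A with
  | _ N ih =>
  have hstep : ∀ j ∈ T.filter (fun j => A * Q j ≠ 0),
      ‖cval z (avgPolyWith Q (A * Q j) (T.erase j))‖ ≤
        r * (‖A‖ * ρ) * (b * ‖cval z (avgPoly Q T)‖) := by
    intro j hj
    have hjT := (Finset.mem_filter.1 hj).1
    have h1 := ih (T.erase j).card (hn ▸ Finset.card_erase_lt_of_mem hjT) (T.erase j)
      (fun U hU => hT U (hU.trans (Finset.erase_subset _ _))) (A * Q j)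
      (fun i hi k => by simp [Matrix.mul_apply, hA i hi])
      ((Finset.card_le_card (fun k hk => by
        rw [Finset.mem_filter] at hk ⊢
        refine ⟨hk.1, fun h0 => hk.2 ?_⟩
        rw [mul_assoc, h0, mul_zero])).trans (hN j _ (Finset.notMem_erase j T))) rfl
    refine h1.trans ?_
    gcongr
    · exact (norm_mul_le _ _).trans (by gcongr; exact hQn j)
    · exact hT T subset_rfl j hjT
  have hsum : ‖∑ j ∈ T, cval z (avgPolyWith Q (A * Q j) (T.erase j))‖ ≤
      r * (r * (‖A‖ * ρ) * (b * ‖cval z (avgPoly Q T)‖)) := by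
    -- Terms with A Q_j = 0 vanish, which leaves at most r of them, whatever the size of T.
    rw [← Finset.sum_filter_of_ne (p := fun j => A * Q j ≠ 0)
      (fun j _ hj h0 => hj (by simp only [h0, avgPolyWith_zero, map_zero]))]
    refine (norm_sum_le_of_le _ hstep).trans ?_
    rw [Finset.sum_const, nsmul_eq_mul]
    gcongr
  have htr := abs_trace_le hR fun i hi => hA i hi i
  rw [avgPolyWith_eq hQ]
  simp only [cval, map_add, map_mul, aeval_C, aeval_X, map_sum] at hsum ⊢
  refine (norm_add_le _ _).trans ?_
  rw [norm_mul, norm_mul, norm_mul]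
  simp only [Complex.coe_algebraMap, Complex.norm_real, Real.norm_eq_abs,
    abs_of_pos (by norm_num : (0 : ℝ) < 1 / 2)]
  set p := ‖aeval z (avgPoly Q T)‖
  have hp : 0 ≤ p := norm_nonneg _
  have h1 : 1 / 2 * |A.trace| * p ≤ 1 / 2 * (r * ‖A‖) * p := by gcongr
  -- The radius is chosen so that the sum costs at most the half of r‖A‖ |p_T| which the trace term
  -- leaves over.
  have h2 : ‖z‖ * (r * (r * (‖A‖ * ρ) * (b * p))) ≤ 1 / 2 * (r * ‖A‖ * p) := by
    calc ‖z‖ * (r * (r * (‖A‖ * ρ) * (b * p))) = ‖z‖ * (r * ρ) * b * (r * ‖A‖ * p) := by ring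
      _ ≤ _ := by gcongr
  have h3 := mul_le_mul_of_nonneg_left hsum (norm_nonneg z)
  linarith

/-- Since p_T = p_{T∖k} + z G_{Q_k,T∖k} and the last term is at most ½ e^{−1/2} |p_{T∖k}| in
absolute value, it is enough that e^{1/2}(1 − ½ e^{−1/2}) = e^{1/2} − ½ is at least 1. -/
theorem norm_avgPoly_erase_le {Q : ι → Matrix (Fin n) (Fin n) ℝ} (hQ : ∀ k, (Q k).IsSymm)
    {r : ℕ} {ρ : ℝ} (hρ : 0 ≤ ρ) (hQn : ∀ k, ‖Q k‖ ≤ ρ)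
    (hrow : ∀ k, ∃ R : Finset (Fin n), R.card ≤ r ∧ ∀ i ∉ R, ∀ j, Q k i j = 0)
    (hN : ∀ k, ∀ T : Finset ι, k ∉ T → (T.filter fun j => Q k * Q j ≠ 0).card ≤ r)
    {z : ℂ} (hz : ‖z‖ * (r * ρ) * Real.exp (1 / 2) ≤ 1 / 2) (T : Finset ι) (k : ι) (hk : k ∈ T) :
    ‖cval z (avgPoly Q (T.erase k))‖ ≤ Real.exp (1 / 2) * ‖cval z (avgPoly Q T)‖ := by
  induction hn : T.card using Nat.strong_induction_on generalizing T k with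
  | _ N ih =>
  have hlt := Finset.card_erase_lt_of_mem hk
  obtain ⟨R, hR, hRQ⟩ := hrow k
  -- Only subsets of T∖k enter here; they are smaller than T, so the induction hypothesis covers
  -- them.
  have hG := norm_avgPolyWith_le hQ hρ (Real.exp_pos _).le hQn hN hz (T.erase k)
    (fun U hU l hl => ih U.card (by have := Finset.card_le_card hU; omega) U l hl rfl) (Q k) hR hRQ
    (hN k _ (Finset.notMem_erase k T))
  have hins := avgPoly_insert Q (Finset.notMem_erase k T)
  rw [Finset.insert_erase hk] at hins
  rw [hins]
  simp only [cval, map_add, map_mul, aeval_X] at hG ⊢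
  set p := aeval z (avgPoly Q (T.erase k))
  set g := aeval z (avgPolyWith Q (Q k) (T.erase k))
  have hE : (3 / 2 : ℝ) ≤ Real.exp (1 / 2) := by
    have := Real.add_one_le_exp (1 / 2 : ℝ)
    linarith
  have h1 : ‖p‖ ≤ ‖p + z * g‖ + ‖z‖ * ‖g‖ := by
    rw [← norm_mul]
    simpa using norm_sub_le (p + z * g) (z * g)
  have h2 : ‖z‖ * ‖g‖ ≤ ‖z‖ * (r * ρ) * ‖p‖ := by
    rw [mul_assoc]
    refine mul_le_mul_of_nonneg_left (hG.trans ?_) (norm_nonneg z)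
    gcongr
    exact hQn k
  have h3 : Real.exp (1 / 2) * (‖z‖ * ‖g‖) ≤ 1 / 2 * ‖p‖ := by
    calc Real.exp (1 / 2) * (‖z‖ * ‖g‖) ≤ Real.exp (1 / 2) * (‖z‖ * (r * ρ) * ‖p‖) := by gcongr
      _ = ‖z‖ * (r * ρ) * Real.exp (1 / 2) * ‖p‖ := by ring
      _ ≤ _ := by gcongr
  have h4 := mul_le_mul_of_nonneg_left h1 (Real.exp_pos (1 / 2)).le
  have h5 := mul_le_mul_of_nonneg_right hE (norm_nonneg p)
  rw [mul_add] at h4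
  linarith

theorem avgPoly_ne_zero {Q : ι → Matrix (Fin n) (Fin n) ℝ} (hQ : ∀ k, (Q k).IsSymm)
    {r : ℕ} {ρ : ℝ} (hρ : 0 ≤ ρ) (hQn : ∀ k, ‖Q k‖ ≤ ρ)
    (hrow : ∀ k, ∃ R : Finset (Fin n), R.card ≤ r ∧ ∀ i ∉ R, ∀ j, Q k i j = 0)
    (hN : ∀ k, ∀ T : Finset ι, k ∉ T → (T.filter fun j => Q k * Q j ≠ 0).card ≤ r)
    {z : ℂ} (hz : ‖z‖ * (r * ρ) * Real.exp (1 / 2) ≤ 1 / 2) (T : Finset ι) :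
    cval z (avgPoly Q T) ≠ 0 := by
  induction T using Finset.induction_on with
  | empty => simp [avgPoly_empty]
  | insert k T hk ih =>
    intro h0
    have h := norm_avgPoly_erase_le hQ hρ hQn hrow hN hz (insert k T) k (Finset.mem_insert_self _ _)
    rw [Finset.erase_insert hk, h0, norm_zero, mul_zero] at h
    exact ih (norm_le_zero_iff.1 h)

end ZeroFree

/-! ### From the sparsity hypotheses to the zero-free disc. -/

/-- Dependence is a statement on values of the form, so entries have to be recovered from values:
comparing e_i with 0 gives A_ii = 0, and comparing e_i + e_j with e_j then gives A_ij = 0 by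
symmetry. -/
theorem entry_eq_zero_of_not_dependsOn {n : ℕ} {A : Matrix (Fin n) (Fin n) ℝ} (hA : A.IsSymm)
    {i : Fin n} (hi : i ∉ dependsOnVars (form A)) (j : Fin n) : A i j = 0 := by
  have h : ∀ x y : EuclideanSpace ℝ (Fin n), (∀ j, j ≠ i → x j = y j) → form A x = form A y := by
    intro x y hxy
    by_contra hne
    exact hi ⟨x, y, hxy, hne⟩
  have hsingle : ∀ (a b : Fin n) (s t : ℝ),
      form A (EuclideanSpace.single a s + EuclideanSpace.single b t) =
        1 / 2 * (A a a * s * s + A a b * s * t + A b a * s * t + A b b * t * t) := by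
    intro a b s t
    rw [form_eq_dotProduct]
    simp only [WithLp.ofLp_add, PiLp.ofLp_single, Matrix.mulVec_add, add_dotProduct,
      dotProduct_add, Matrix.mulVec_single, single_dotProduct, Pi.smul_apply, Matrix.col_apply,
      MulOpposite.smul_eq_mul_unop, MulOpposite.unop_op]
    ring
  have hii : A i i = 0 := by
    have h1 := h (EuclideanSpace.single i 1 + EuclideanSpace.single i 0)
      (EuclideanSpace.single i 0 + EuclideanSpace.single i 0) (by intro j hj; simp [hj])
    rw [hsingle, hsingle] at h1
    linarith
  have h2 := h (EuclideanSpace.single i 1 + EuclideanSpace.single j 1)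
    (EuclideanSpace.single i 0 + EuclideanSpace.single j 1) (by intro k hk; simp [hk])
  rw [hsingle, hsingle, ← hA.apply j i, hii] at h2
  linarith

/-- Here ρ = 2γ′/r bounds the norms of the Q_k, so r cancels in |z| r ρ e^{1/2} ≤ ½ and the
condition becomes |z| ≤ ¼ e^{−1/2}/γ′. -/
theorem avgPoly_ne_zero_of_isSparse {n m r : ℕ} {Q : Fin m → Matrix (Fin n) (Fin n) ℝ} {γ' : ℝ}
    (hγ' : 0 < γ') (hr : 1 ≤ r) (hQ : ∀ k, (Q k).IsSymm)
    (hS : IsSparse r (fun k => form (Q k)))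
    (hq : ∀ (k : Fin m) (x : EuclideanSpace ℝ (Fin n)), |form (Q k) x| ≤ γ' / r * ‖x‖ ^ 2)
    {z : ℂ} (hz : ‖z‖ ≤ 1 / 4 * Real.exp (-(1 / 2)) / γ') :
    Polynomial.aeval z (avgPoly Q Finset.univ) ≠ 0 := by
  classical
  have hr0 : (0 : ℝ) < r := by exact_mod_cast hr
  refine avgPoly_ne_zero (r := r) (ρ := 2 * (γ' / r)) hQ (by positivity)
    (fun k => norm_le_of_abs_form_le (hQ k) (by positivity) (hq k)) (fun k => ?_)
    (fun k T hk => ?_) ?_ _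
  · refine ⟨(dependsOnVars (form (Q k))).toFinite.toFinset, ?_, fun i hi j => ?_⟩
    · rw [← Set.ncard_eq_toFinset_card]
      exact hS.1 k
    · exact entry_eq_zero_of_not_dependsOn (hQ k) (by simpa using hi) j
  · refine le_trans ?_ (hS.2 k)
    rw [← Set.ncard_coe_finset]
    refine Set.ncard_le_ncard ?_ (Set.toFinite _)
    intro l hl
    simp only [Finset.coe_filter, Set.mem_ofPred_eq] at hl
    refine ⟨fun h => hk (h ▸ hl.1), ?_⟩
    by_contra hne
    rw [Set.not_nonempty_iff_eq_empty, ← Set.disjoint_iff_inter_eq_empty] at hne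
    -- Forms without common variables have Q_k Q_l = 0: each index j of summation misses the
    -- variables of one of the two.
    refine hl.2 (Matrix.ext fun a b => ?_)
    rw [Matrix.mul_apply]
    refine Finset.sum_eq_zero fun j _ => ?_
    by_cases hj : j ∈ dependsOnVars (form (Q k))
    · rw [entry_eq_zero_of_not_dependsOn (hQ l) (Set.disjoint_left.1 hne hj), mul_zero]
    · rw [← (hQ k).apply, entry_eq_zero_of_not_dependsOn (hQ k) hj, zero_mul]
  · rw [le_div_iff₀ hγ'] at hz
    have h1 : ‖z‖ * (r * (2 * (γ' / r))) * Real.exp (1 / 2) = 2 * (‖z‖ * γ') * Real.exp (1 / 2) := by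
      field_simp
    rw [h1]
    have h2 : Real.exp (-(1 / 2)) * Real.exp (1 / 2) = 1 := by
      rw [← Real.exp_add]
      simp
    have h3 := mul_le_mul_of_nonneg_right hz (Real.exp_pos (1 / 2)).le
    linarith

end GaussianProduct

namespace GaussianProduct

/-! ### The Taylor coefficients as sums over collections of tuples -/

section TraceSum

variable {n m : ℕ}

/-- Tuples of at most `s` distinct indices from `T`. -/
def tuplesIn (T : Finset (Fin m)) (s : ℕ) : Finset {l : List (Fin m) // l.Nodup} :=
  {l | (∀ k ∈ l.1, k ∈ T) ∧ l.1.length ≤ s}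

theorem mem_tuplesIn {T : Finset (Fin m)} {s : ℕ} {l : {l : List (Fin m) // l.Nodup}} :
    l ∈ tuplesIn T s ↔ (∀ k ∈ l.1, k ∈ T) ∧ l.1.length ≤ s := by
  simp [tuplesIn]

theorem sum_tuplesIn_ne_nil (T : Finset (Fin m)) (s : ℕ) (g : List (Fin m) → ℝ) :
    ∑ l ∈ tuplesIn T (s + 1) with l.1 ≠ [], g l.1 =
      ∑ k ∈ T, ∑ l ∈ tuplesIn (T.erase k) s, g (k :: l.1) := by
  rw [Finset.sum_sigma']
  have hnot : ∀ p : (k : Fin m) × {l : List (Fin m) // l.Nodup},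
      p ∈ T.sigma (fun k => tuplesIn (T.erase k) s) → p.1 ∉ p.2.1 := by
    intro p hp hmem
    rw [Finset.mem_sigma, mem_tuplesIn] at hp
    exact Finset.notMem_erase _ _ (hp.2.1 _ hmem)
  symm
  refine Finset.sum_bij (fun p hp => ⟨p.1 :: p.2.1, List.nodup_cons.2 ⟨hnot p hp, p.2.2⟩⟩)
    ?_ ?_ ?_ ?_
  · rintro ⟨k, l⟩ hp
    rw [Finset.mem_sigma, mem_tuplesIn] at hp
    rw [Finset.mem_filter, mem_tuplesIn]
    refine ⟨⟨fun j hj => ?_, by simpa using hp.2.2⟩, by simp⟩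
    rcases List.mem_cons.1 hj with rfl | hj
    · exact hp.1
    · exact Finset.mem_of_mem_erase (hp.2.1 j hj)
  · rintro ⟨k, l⟩ _ ⟨k', l'⟩ _ h
    simp only [Subtype.mk.injEq, List.cons.injEq] at h
    obtain ⟨rfl, h⟩ := h
    rw [Subtype.ext h]
  · rintro ⟨l, hl⟩ h
    rw [Finset.mem_filter, mem_tuplesIn] at h
    cases l with
    | nil => exact absurd rfl h.2
    | cons k l =>
      rw [List.nodup_cons] at hl
      refine ⟨⟨k, l, hl.2⟩, ?_, rfl⟩
      rw [Finset.mem_sigma, mem_tuplesIn]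
      refine ⟨h.1.1 k (by simp), fun j hj => ?_, by simpa using h.1.2⟩
      exact Finset.mem_erase.2 ⟨fun e => hl.1 ((show j = k from e) ▸ hj), h.1.1 j (List.mem_cons_of_mem _ hj)⟩
  · intros
    rfl

theorem sum_tuplesIn_succ (T : Finset (Fin m)) (s : ℕ) (g : List (Fin m) → ℝ) :
    ∑ l ∈ tuplesIn T (s + 1), g l.1 =
      g [] + ∑ k ∈ T, ∑ l ∈ tuplesIn (T.erase k) s, g (k :: l.1) := by
  rw [← sum_tuplesIn_ne_nil, ← Finset.sum_filter_not_add_sum_filter _ (fun l => l.1 ≠ [])]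
  congr 1
  rw [Finset.sum_eq_single ⟨[], List.nodup_nil⟩]
  · intro l hl hne
    rw [Finset.mem_filter, not_not] at hl
    exact absurd (Subtype.ext hl.2) hne
  · intro h
    exact absurd (by simp [mem_tuplesIn]) h

theorem sdiff_toFinset_cons (T : Finset (Fin m)) (k : Fin m) (l : List (Fin m)) :
    T \ (k :: l).toFinset = T.erase k \ l.toFinset := by
  ext j
  simp only [Finset.mem_sdiff, List.mem_toFinset, List.mem_cons, Finset.mem_erase]
  tauto

/-- The recursion for G_{A,T} is unrolled: a tuple records which forms have been absorbed, in order,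
before a trace term ends the process. The subtraction is not truncated, as tuples in `tuplesIn T s`
have length at most s. -/
theorem coeff_avgPolyWith {Q : Fin m → Matrix (Fin n) (Fin n) ℝ} (hQ : ∀ k, (Q k).IsSymm)
    (A : Matrix (Fin n) (Fin n) ℝ) (T : Finset (Fin m)) (s : ℕ) :
    (avgPolyWith Q A T).coeff s = ∑ l ∈ tuplesIn T s, 1 / 2 * (A * (l.1.map Q).prod).trace *
      (avgPoly Q (T \ l.1.toFinset)).coeff (s - l.1.length) := by
  induction s generalizing A T with
  | zero =>
    rw [coeff_zero_avgPolyWith hQ, Finset.sum_eq_single ⟨[], List.nodup_nil⟩]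
    · simp [avgPoly_coeff_zero]
    · intro l hl hne
      have := (mem_tuplesIn.1 hl).2
      exact absurd (Subtype.ext (List.length_eq_zero_iff.1 (Nat.le_zero.1 this))) hne
    · intro h
      exact absurd (by simp [mem_tuplesIn]) h
  | succ s ih =>
    rw [coeff_succ_avgPolyWith hQ, sum_tuplesIn_succ T s fun l =>
      1 / 2 * (A * (l.map Q).prod).trace * (avgPoly Q (T \ l.toFinset)).coeff (s + 1 - l.length)]
    congr 1
    · simp
    · refine Finset.sum_congr rfl fun k _ => ?_
      rw [ih]
      refine Finset.sum_congr rfl fun l _ => ?_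
      rw [sdiff_toFinset_cons, List.length_cons, Nat.add_sub_add_right, List.map_cons,
        List.prod_cons, ← mul_assoc A]

theorem mul_coeff_avgPoly {Q : Fin m → Matrix (Fin n) (Fin n) ℝ} (hQ : ∀ k, (Q k).IsSymm)
    (T : Finset (Fin m)) (s : ℕ) :
    (s + 1 : ℝ) * (avgPoly Q T).coeff (s + 1) = ∑ l ∈ tuplesIn T (s + 1) with l.1 ≠ [],
      1 / 2 * ((l.1.map Q).prod).trace *
        (avgPoly Q (T \ l.1.toFinset)).coeff (s + 1 - l.1.length) := by
  rw [coeff_avgPoly_succ, sum_tuplesIn_ne_nil T s fun l =>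
      1 / 2 * ((l.map Q).prod).trace * (avgPoly Q (T \ l.toFinset)).coeff (s + 1 - l.length)]
  refine Finset.sum_congr rfl fun k _ => ?_
  rw [coeff_avgPolyWith hQ]
  refine Finset.sum_congr rfl fun l _ => ?_
  rw [sdiff_toFinset_cons, List.length_cons, Nat.add_sub_add_right, List.map_cons,
    List.prod_cons]

open Classical in
/-- Collections of pairwise disjoint tuples of indices from `T` with `s` indices in total. -/
noncomputable def collectionsIn (T : Finset (Fin m)) (s : ℕ) :
    Finset (Finset {l : List (Fin m) // l.Nodup}) :=
  {S | IsCollection s S ∧ ∀ l ∈ S, ∀ k ∈ l.1, k ∈ T}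

theorem mem_collectionsIn {T : Finset (Fin m)} {s : ℕ}
    {S : Finset {l : List (Fin m) // l.Nodup}} :
    S ∈ collectionsIn T s ↔ IsCollection s S ∧ ∀ l ∈ S, ∀ k ∈ l.1, k ∈ T := by
  simp [collectionsIn]

/-- The weight of a tuple. -/
noncomputable def tupleWeight (Q : Fin m → Matrix (Fin n) (Fin n) ℝ)
    (l : {l : List (Fin m) // l.Nodup}) : ℝ :=
  1 / (2 * (l.1.length : ℝ)) * ((l.1.map Q).prod).trace

/-- The sum of the weights of the collections of tuples of indices from `T`. -/
noncomputable def traceSumIn (Q : Fin m → Matrix (Fin n) (Fin n) ℝ) (T : Finset (Fin m))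
    (s : ℕ) : ℝ :=
  ∑ S ∈ collectionsIn T s, ∏ l ∈ S, tupleWeight Q l

theorem traceSumIn_univ (Q : Fin m → Matrix (Fin n) (Fin n) ℝ) (s : ℕ) :
    traceSumIn Q Finset.univ s = traceSum Q s := by
  rw [traceSumIn, traceSum]
  refine Finset.sum_congr ?_ fun _ _ => rfl
  ext S
  simp [collectionsIn]

theorem traceSumIn_zero (Q : Fin m → Matrix (Fin n) (Fin n) ℝ) (T : Finset (Fin m)) :
    traceSumIn Q T 0 = 1 := by
  rw [traceSumIn, Finset.sum_eq_single ∅]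
  · simp
  · intro S hS hne
    obtain ⟨⟨h1, -, h3⟩, -⟩ := mem_collectionsIn.1 hS
    obtain ⟨l, hl⟩ := Finset.nonempty_iff_ne_empty.2 hne
    exact absurd (List.length_eq_zero_iff.1 (Finset.sum_eq_zero_iff.1 h3 l hl)) (h1 l hl)
  · intro h
    exact absurd (by simp [mem_collectionsIn, IsCollection]) h

theorem erase_mem_collectionsIn {T : Finset (Fin m)} {s : ℕ}
    {S : Finset {l : List (Fin m) // l.Nodup}} (hS : S ∈ collectionsIn T s)
    {l : {l : List (Fin m) // l.Nodup}} (hl : l ∈ S) :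
    l.1 ≠ [] ∧ l ∈ tuplesIn T s ∧
      S.erase l ∈ collectionsIn (T \ l.1.toFinset) (s - l.1.length) := by
  obtain ⟨⟨h1, h2, h3⟩, h4⟩ := mem_collectionsIn.1 hS
  have hsum := Finset.add_sum_erase S (fun l => l.1.length) hl
  refine ⟨h1 l hl, mem_tuplesIn.2 ⟨h4 l hl, by omega⟩, mem_collectionsIn.2 ⟨⟨?_, ?_, ?_⟩, ?_⟩⟩
  · exact fun l' hl' => h1 l' (Finset.mem_of_mem_erase hl')
  · exact fun a ha b hb => h2 a (Finset.mem_of_mem_erase ha) b (Finset.mem_of_mem_erase hb)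
  · omega
  · intro l' hl' k hk
    rw [Finset.mem_erase] at hl'
    rw [Finset.mem_sdiff, List.mem_toFinset]
    exact ⟨h4 l' hl'.2 k hk, h2 l' hl'.2 l hl hl'.1 hk⟩

theorem insert_mem_collectionsIn {T : Finset (Fin m)} {s : ℕ}
    {l : {l : List (Fin m) // l.Nodup}} (hne : l.1 ≠ []) (hl : l ∈ tuplesIn T s)
    {S : Finset {l : List (Fin m) // l.Nodup}}
    (hS : S ∈ collectionsIn (T \ l.1.toFinset) (s - l.1.length)) :
    l ∉ S ∧ insert l S ∈ collectionsIn T s := by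
  obtain ⟨⟨h1, h2, h3⟩, h4⟩ := mem_collectionsIn.1 hS
  obtain ⟨h5, h6⟩ := mem_tuplesIn.1 hl
  have hdis : ∀ l' ∈ S, List.Disjoint l'.1 l.1 := by
    intro l' hl' k hk hk'
    have := h4 l' hl' k hk
    rw [Finset.mem_sdiff, List.mem_toFinset] at this
    exact this.2 hk'
  have hnot : l ∉ S := by
    intro h
    obtain ⟨k, hk⟩ := List.exists_mem_of_ne_nil _ hne
    exact hdis l h hk hk
  refine ⟨hnot, mem_collectionsIn.2 ⟨⟨?_, ?_, ?_⟩, ?_⟩⟩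
  · intro a ha
    rcases Finset.mem_insert.1 ha with rfl | ha
    · exact hne
    · exact h1 a ha
  · intro a ha b hb hab
    rcases Finset.mem_insert.1 ha with rfl | ha'
    · rcases Finset.mem_insert.1 hb with rfl | hb
      · exact absurd rfl hab
      · exact (hdis b hb).symm
    · rcases Finset.mem_insert.1 hb with rfl | hb
      · exact hdis a ha'
      · exact h2 a ha' b hb hab
  · rw [Finset.sum_insert hnot, h3]
    omega
  · intro a ha k hk
    rcases Finset.mem_insert.1 ha with rfl | ha
    · exact h5 k hk
    · exact (Finset.mem_sdiff.1 (h4 a ha k hk)).1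

/-- Write s as the total length of a collection and mark one tuple l with multiplicity its length a.
This cancels the 1/a in the weight of l, and the rest is a collection in the complement of l. -/
theorem mul_traceSumIn (Q : Fin m → Matrix (Fin n) (Fin n) ℝ) (T : Finset (Fin m)) (s : ℕ) :
    (s : ℝ) * traceSumIn Q T s = ∑ l ∈ tuplesIn T s with l.1 ≠ [],
      1 / 2 * ((l.1.map Q).prod).trace * traceSumIn Q (T \ l.1.toFinset) (s - l.1.length) := by
  have h1 : (s : ℝ) * traceSumIn Q T s = ∑ S ∈ collectionsIn T s, ∑ l ∈ S,
      1 / 2 * ((l.1.map Q).prod).trace * ∏ l' ∈ S.erase l, tupleWeight Q l' := by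
    rw [traceSumIn, Finset.mul_sum]
    refine Finset.sum_congr rfl fun S hS => ?_
    obtain ⟨⟨h1, -, h3⟩, -⟩ := mem_collectionsIn.1 hS
    rw [← h3, Nat.cast_sum, Finset.sum_mul]
    refine Finset.sum_congr rfl fun l hl => ?_
    rw [← Finset.mul_prod_erase S _ hl, tupleWeight]
    have : (l.1.length : ℝ) ≠ 0 := by
      exact_mod_cast fun h => h1 l hl (List.length_eq_zero_iff.1 h)
    field_simp
  rw [h1]
  simp only [traceSumIn, Finset.mul_sum]
  rw [Finset.sum_sigma', Finset.sum_sigma']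
  refine Finset.sum_bij' (fun p _ => ⟨p.2, p.1.erase p.2⟩) (fun p _ => ⟨insert p.1 p.2, p.1⟩)
    ?_ ?_ ?_ ?_ ?_
  · rintro ⟨S, l⟩ h
    rw [Finset.mem_sigma] at h ⊢
    obtain ⟨h1, h2, h3⟩ := erase_mem_collectionsIn h.1 h.2
    exact ⟨Finset.mem_filter.2 ⟨h2, h1⟩, h3⟩
  · rintro ⟨l, S⟩ h
    rw [Finset.mem_sigma, Finset.mem_filter] at h
    rw [Finset.mem_sigma]
    exact ⟨(insert_mem_collectionsIn h.1.2 h.1.1 h.2).2, Finset.mem_insert_self _ _⟩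
  · rintro ⟨S, l⟩ h
    rw [Finset.mem_sigma] at h
    simp [Finset.insert_erase h.2]
  · rintro ⟨l, S⟩ h
    rw [Finset.mem_sigma, Finset.mem_filter] at h
    simp [Finset.erase_insert (insert_mem_collectionsIn h.1.2 h.1.1 h.2).1]
  · intros
    rfl

/-- `mul_traceSumIn` and `mul_coeff_avgPoly` are the same recursion. It only refers to smaller
degrees because the marked tuple is not empty. -/
theorem traceSumIn_eq_coeff {Q : Fin m → Matrix (Fin n) (Fin n) ℝ} (hQ : ∀ k, (Q k).IsSymm)
    (T : Finset (Fin m)) (s : ℕ) : traceSumIn Q T s = (avgPoly Q T).coeff s := by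
  induction s using Nat.strong_induction_on generalizing T with
  | _ s ih =>
  cases s with
  | zero => rw [traceSumIn_zero, avgPoly_coeff_zero]
  | succ s =>
    have h1 := mul_traceSumIn Q T (s + 1)
    have h2 := mul_coeff_avgPoly hQ T s
    have h3 : ((s + 1 : ℕ) : ℝ) * traceSumIn Q T (s + 1) =
        ((s + 1 : ℕ) : ℝ) * (avgPoly Q T).coeff (s + 1) := by
      rw [h1]
      push_cast
      rw [h2]
      refine Finset.sum_congr rfl fun l hl => ?_
      have hpos := List.length_pos_iff.2 (Finset.mem_filter.1 hl).2
      rw [ih _ (by omega)]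
    exact mul_left_cancel₀ (by positivity) h3

end TraceSum

/-! ### Coefficients of polynomials as derivatives at zero. -/

theorem iteratedDeriv_eval (p : Polynomial ℝ) (s : ℕ) :
    iteratedDeriv s (fun z => p.eval z) = fun z => (Polynomial.derivative^[s] p).eval z := by
  induction s with
  | zero => simp
  | succ s ih =>
    rw [iteratedDeriv_succ, ih, Function.iterate_succ_apply']
    ext z
    exact Polynomial.deriv _

theorem iteratedDeriv_eval_zero (p : Polynomial ℝ) (s : ℕ) :
    iteratedDeriv s (fun z => p.eval z) 0 = (s.factorial : ℝ) * p.coeff s := by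
  rw [iteratedDeriv_eval]
  change (Polynomial.derivative^[s] p).eval 0 = _
  rw [← Polynomial.coeff_zero_eq_eval_zero,
    Polynomial.coeff_iterate_derivative, zero_add, Nat.descFactorial_self, nsmul_eq_mul]

theorem iteratedDeriv_average {n m : ℕ} {Q : Fin m → Matrix (Fin n) (Fin n) ℝ}
    (hQ : ∀ k, (Q k).IsSymm) (s : ℕ) :
    iteratedDeriv s (average Q) 0 = (s.factorial : ℝ) * traceSum Q s := by
  rw [← traceSumIn_univ, traceSumIn_eq_coeff hQ, funext (average_eq_eval Q), iteratedDeriv_eval_zero]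

end GaussianProduct

namespace GaussianProduct

/-! ### The Taylor polynomials of the logarithm of a polynomial without zeros in a disc -/

section LogTaylor

open Polynomial

/-- Real part of the series of −log(1 − xw). Working with log of the modulus avoids any choice of
branch when factors are multiplied. -/
theorem hasSum_log_norm_one_sub (w : ℂ) (x : ℝ) (h : |x| * ‖w‖ < 1) :
    HasSum (fun s : ℕ => -((w ^ s).re / s) * x ^ s) (Real.log ‖1 - x * w‖) := by
  have hz : ‖(x : ℂ) * w‖ < 1 := by rwa [norm_mul, Complex.norm_real, Real.norm_eq_abs]
  have h1 := (Complex.hasSum_re (Complex.hasSum_taylorSeries_neg_log hz)).neg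
  rw [Complex.neg_re, neg_neg, Complex.log_re] at h1
  convert! h1 using 2 with s
  rw [mul_pow, ← Complex.ofReal_pow, mul_div_assoc, Complex.re_ofReal_mul,
    Complex.div_natCast_re]
  ring

/-- The coefficients of the power series of `log ∏ (1 - z w)` for `w` in a multiset `W`. -/
noncomputable def logProdCoeff (W : Multiset ℂ) (s : ℕ) : ℝ :=
  (W.map fun w => (-((w ^ s).re / s) : ℝ)).sum

theorem hasSum_logProdCoeff {θ : ℝ} (hθ : θ < 1) (W : Multiset ℂ) (hW : ∀ w ∈ W, ‖w‖ ≤ θ)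
    (x : ℝ) (hx : |x| ≤ 1) :
    HasSum (fun s : ℕ => logProdCoeff W s * x ^ s)
      (Real.log ‖(W.map fun w => 1 - (x : ℂ) * w).prod‖) := by
  have hlt : ∀ w ∈ W, |x| * ‖w‖ < 1 := fun w hw =>
    (mul_le_of_le_one_left (norm_nonneg w) hx).trans_lt ((hW w hw).trans_lt hθ)
  clear hW
  induction W using Multiset.induction_on with
  | empty => simp [logProdCoeff]
  | cons w W ih =>
    have h1 := ih fun w hw => hlt w (Multiset.mem_cons_of_mem hw)
    have hne : ∀ w : ℂ, |x| * ‖w‖ < 1 → 1 - (x : ℂ) * w ≠ 0 := by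
      intro w hw h0
      have : ‖(x : ℂ) * w‖ = 1 := by rw [← sub_eq_zero.1 h0, norm_one]
      rw [norm_mul, Complex.norm_real, Real.norm_eq_abs] at this
      linarith
    have h2 := hasSum_log_norm_one_sub w x (hlt w (Multiset.mem_cons_self _ _))
    rw [Multiset.map_cons, Multiset.prod_cons, norm_mul, Real.log_mul]
    · convert! h2.add h1 using 2 with s
      simp [logProdCoeff, add_mul]
    · exact norm_ne_zero_iff.2 (hne w (hlt w (Multiset.mem_cons_self _ _)))
    · rw [norm_ne_zero_iff]
      refine Multiset.prod_ne_zero fun h0 => ?_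
      obtain ⟨v, hv, h0⟩ := Multiset.mem_map.1 h0
      exact hne v (hlt v (Multiset.mem_cons_of_mem hv)) h0

theorem abs_logProdCoeff_le {θ : ℝ} (W : Multiset ℂ) (hW : ∀ w ∈ W, ‖w‖ ≤ θ) (s : ℕ) :
    |logProdCoeff W s| ≤ W.card * θ ^ s := by
  induction W using Multiset.induction_on with
  | empty => simp [logProdCoeff]
  | cons w W ih =>
    have h1 := ih fun w hw => hW w (Multiset.mem_cons_of_mem hw)
    have h2 : |-((w ^ s).re / s)| ≤ θ ^ s := by
      rw [abs_neg, abs_div, Nat.abs_cast]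
      rcases Nat.eq_zero_or_pos s with rfl | hs
      · simp
      · refine (div_le_self (abs_nonneg _) (by exact_mod_cast hs)).trans ?_
        refine (Complex.abs_re_le_norm _).trans ?_
        rw [norm_pow]
        exact pow_le_pow_left₀ (norm_nonneg w) (hW w (Multiset.mem_cons_self _ _)) s
    have h3 : logProdCoeff (w ::ₘ W) s = -((w ^ s).re / s) + logProdCoeff W s := by
      simp [logProdCoeff]
    rw [h3, Multiset.card_cons]
    push_cast
    linarith [abs_add_le (-((w ^ s).re / s)) (logProdCoeff W s)]

/-- The w are the inverses of the complex roots; the normalization p(0) = 1 removes the leading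
coefficient. -/
theorem exists_prod_one_sub {p : ℝ[X]} (h0 : p.coeff 0 = 1) {θ : ℝ} (hθ : 0 < θ)
    (hz : ∀ z : ℂ, ‖z‖ ≤ θ⁻¹ → aeval z p ≠ 0) :
    ∃ W : Multiset ℂ, W.card ≤ p.natDegree ∧ (∀ w ∈ W, ‖w‖ ≤ θ) ∧
      ∀ z : ℂ, aeval z p = (W.map fun w => 1 - z * w).prod := by
  set q := p.map (algebraMap ℝ ℂ) with hq
  have hev : ∀ z : ℂ, aeval z p = q.eval z := fun z => by
    rw [hq, eval_map_algebraMap]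
  have hsp := IsAlgClosed.splits q
  have hq0 : q.eval 0 = 1 := by
    rw [← coeff_zero_eq_eval_zero, hq, coeff_map, h0, map_one]
  have hqne : q ≠ 0 := by
    rintro h
    rw [h] at hq0
    simp at hq0
  have hroot : ∀ ζ ∈ q.roots, θ⁻¹ < ‖ζ‖ := by
    intro ζ hζ
    by_contra hle
    refine hz ζ (not_lt.1 hle) ?_
    rw [hev]
    exact (mem_roots hqne).1 hζ
  have hζ0 : ∀ ζ ∈ q.roots, ζ ≠ 0 := fun ζ hζ => by
    have := hroot ζ hζ
    rw [← norm_pos_iff]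
    exact (inv_pos.2 hθ).trans this
  refine ⟨q.roots.map (·⁻¹), ?_, ?_, ?_⟩
  · rw [Multiset.card_map]
    exact (card_roots' q).trans (natDegree_map_le)
  · intro w hw
    obtain ⟨ζ, hζ, rfl⟩ := Multiset.mem_map.1 hw
    rw [norm_inv]
    exact inv_le_of_inv_le₀ hθ (hroot ζ hζ).le
  · intro z
    rw [hev, hsp.eval_eq_prod_roots, Multiset.map_map]
    have h1 : q.leadingCoeff * (q.roots.map fun ζ => -ζ).prod = 1 := by
      rw [← hq0, hsp.eval_eq_prod_roots]
      simp
    have h2 : (q.roots.map fun ζ => z - ζ) =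
        q.roots.map fun ζ => -ζ * ((fun w => 1 - z * w) ∘ (·⁻¹)) ζ := by
      refine Multiset.map_congr rfl fun ζ hζ => ?_
      have := hζ0 ζ hζ
      simp only [Function.comp]
      field_simp
      ring
    rw [h2, Multiset.prod_map_mul, ← mul_assoc, h1, one_mul]

/-- The Taylor coefficients at `0` of the logarithm of a polynomial. -/
noncomputable def logCoeff (p : ℝ[X]) (s : ℕ) : ℝ :=
  iteratedDeriv s (fun z => Real.log (p.eval z)) 0 / (s.factorial : ℝ)

theorem logCoeff_zero {p : ℝ[X]} (h0 : p.coeff 0 = 1) : logCoeff p 0 = 0 := by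
  rw [logCoeff, iteratedDeriv_zero, ← coeff_zero_eq_eval_zero, h0, Real.log_one, zero_div]

theorem analyticAt_log_eval {p : ℝ[X]} (h0 : p.coeff 0 = 1) :
    AnalyticAt ℝ (fun z => Real.log (p.eval z)) 0 := by
  refine AnalyticAt.log ?_ ?_
  · exact AnalyticOnNhd.eval_polynomial p 0 (Set.mem_univ 0)
  · rw [← coeff_zero_eq_eval_zero, h0]
    exact one_pos

/-- The logarithm of a polynomial satisfies a recursion which determines its coefficients. -/
theorem mul_coeff_eq_sum_logCoeff {p : ℝ[X]} (h0 : p.coeff 0 = 1) (s : ℕ) :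
    (s + 1 : ℝ) * p.coeff (s + 1) =
      ∑ i ∈ Finset.range (s + 1), (i + 1 : ℝ) * logCoeff p (i + 1) * p.coeff (s - i) := by
  set f : ℝ → ℝ := fun z => Real.log (p.eval z) with hf
  have hfa : AnalyticAt ℝ f 0 := analyticAt_log_eval h0
  have hpa : ContDiffAt ℝ s (fun z => p.eval z) 0 := (AnalyticOnNhd.eval_polynomial p 0 (Set.mem_univ 0)).contDiffAt
  -- Near 0 one has p′ = (log p)′ p. The Leibniz rule for derivatives of order s at 0 turns this
  -- into the recursion.
  have hev : (fun z => p.derivative.eval z) =ᶠ[nhds 0] deriv f * fun z => p.eval z := by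
    have hne : ∀ᶠ z in nhds (0 : ℝ), p.eval z ≠ 0 := by
      refine p.continuous.continuousAt.eventually_ne ?_
      rw [← coeff_zero_eq_eval_zero, h0]
      exact one_ne_zero
    filter_upwards [hne] with z hz
    have : deriv f z = p.derivative.eval z / p.eval z := ((p.hasDerivAt z).log hz).deriv
    rw [Pi.mul_apply, this, div_mul_cancel₀ _ hz]
  have h1 := hev.iteratedDeriv_eq s
  rw [iteratedDeriv_eval_zero, iteratedDeriv_mul hfa.deriv.contDiffAt hpa, coeff_derivative] at h1
  have hs : (s.factorial : ℝ) ≠ 0 := by positivity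
  refine mul_left_cancel₀ hs ?_
  rw [mul_comm (s + 1 : ℝ), h1, Finset.mul_sum]
  refine Finset.sum_congr rfl fun i hi => ?_
  have hi' : i ≤ s := Nat.lt_succ_iff.1 (Finset.mem_range.1 hi)
  rw [← iteratedDeriv_succ', iteratedDeriv_eval_zero, logCoeff, ← Nat.choose_mul_factorial_mul_factorial hi',
    Nat.factorial_succ]
  push_cast
  have : (i.factorial : ℝ) ≠ 0 := by positivity
  rw [hf]
  field_simp

/-- The polynomial starts at p(0) = 1 and has no zero on [0, 1], so it cannot change sign. -/
theorem eval_one_pos {p : ℝ[X]} (h0 : p.coeff 0 = 1) {β : ℝ} (hβ : 1 ≤ β)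
    (hz : ∀ z : ℂ, ‖z‖ ≤ β → aeval z p ≠ 0) : 0 < p.eval 1 := by
  by_contra hle
  have h1 : p.eval 0 = 1 := by rw [← coeff_zero_eq_eval_zero, h0]
  obtain ⟨x, hx, hx0⟩ := intermediate_value_Icc' (zero_le_one (α := ℝ)) p.continuous.continuousOn
    (show (0 : ℝ) ∈ Set.Icc (p.eval 1) (p.eval 0) from ⟨not_lt.1 hle, by rw [h1]; exact zero_le_one⟩)
  refine hz x ?_ ?_
  · rw [Complex.norm_real, Real.norm_eq_abs, abs_of_nonneg hx.1]
    exact hx.2.trans hβ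
  · have := aeval_algebraMap_apply ℂ x p
    rw [Complex.coe_algebraMap] at this
    rw [this, coe_aeval_eq_eval]
    simp [hx0]

/-- On the real line log p is log |∏(1 − xw)|, whose power series is explicit. Uniqueness of power
series at 0 identifies its coefficients with the derivatives in `logCoeff`. -/
theorem logCoeff_bounds {p : ℝ[X]} (h0 : p.coeff 0 = 1) {θ : ℝ} (hθ : 0 < θ) (hθ1 : θ < 1)
    (hz : ∀ z : ℂ, ‖z‖ ≤ θ⁻¹ → aeval z p ≠ 0) :
    (∀ s, |logCoeff p s| ≤ p.natDegree * θ ^ s) ∧ HasSum (logCoeff p) (Real.log (p.eval 1)) := by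
  obtain ⟨W, hWc, hW, hprod⟩ := exists_prod_one_sub h0 hθ hz
  have hlog : ∀ x : ℝ, Real.log (p.eval x) =
      Real.log ‖(W.map fun w => 1 - (x : ℂ) * w).prod‖ := by
    intro x
    rw [← hprod]
    have := aeval_algebraMap_apply ℂ x p
    rw [Complex.coe_algebraMap] at this
    rw [this, coe_aeval_eq_eval, Complex.norm_real, Real.norm_eq_abs,
      Real.log_abs]
  have hser : HasFPowerSeriesAt (fun z => Real.log (p.eval z))
      (FormalMultilinearSeries.ofScalars ℝ (logProdCoeff W)) 0 := by
    rw [hasFPowerSeriesAt_iff]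
    filter_upwards [Metric.ball_mem_nhds (0 : ℝ) one_pos] with x hx
    rw [mem_ball_zero_iff, Real.norm_eq_abs] at hx
    rw [zero_add, hlog]
    convert! hasSum_logProdCoeff hθ1 W hW x hx.le using 2 with s
    rw [FormalMultilinearSeries.coeff_ofScalars, smul_eq_mul, mul_comm]
  have heq : logCoeff p = logProdCoeff W := by
    have h := (analyticAt_log_eval h0).hasFPowerSeriesAt.eq_formalMultilinearSeries hser
    ext s
    have h2 := congrArg (fun q => FormalMultilinearSeries.coeff q s) h
    simpa only [FormalMultilinearSeries.coeff_ofScalars, logCoeff] using h2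
  rw [heq]
  constructor
  · intro s
    refine (abs_logProdCoeff_le W hW s).trans ?_
    gcongr
  · rw [hlog]
    simpa using hasSum_logProdCoeff hθ1 W hW 1 (by simp)

/-- An a priori bound for the Taylor value T, needed to choose the exponent when e^T is approximated
by a power. -/
theorem abs_sum_logCoeff_le {p : ℝ[X]} (h0 : p.coeff 0 = 1) {θ : ℝ} (hθ : 0 < θ) (hθ1 : θ < 1)
    (hz : ∀ z : ℂ, ‖z‖ ≤ θ⁻¹ → aeval z p ≠ 0) (d : ℕ) :
    |∑ s ∈ Finset.range d, logCoeff p s| ≤ p.natDegree * (1 - θ)⁻¹ := by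
  have hb := (logCoeff_bounds h0 hθ hθ1 hz).1
  refine (Finset.abs_sum_le_sum_abs _ _).trans ((Finset.sum_le_sum fun s _ => hb s).trans ?_)
  rw [← Finset.mul_sum]
  gcongr
  rw [← tsum_geometric_of_lt_one hθ.le hθ1]
  exact (summable_geometric_of_lt_one hθ.le hθ1).sum_le_tsum _ fun s _ => by positivity

theorem abs_log_sub_sum_logCoeff_le {p : ℝ[X]} (h0 : p.coeff 0 = 1) {θ : ℝ} (hθ : 0 < θ)
    (hθ1 : θ < 1) (hz : ∀ z : ℂ, ‖z‖ ≤ θ⁻¹ → aeval z p ≠ 0) (d : ℕ) :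
    |Real.log (p.eval 1) - ∑ s ∈ Finset.range d, logCoeff p s| ≤
      p.natDegree * θ ^ d * (1 - θ)⁻¹ := by
  obtain ⟨hb, hs⟩ := logCoeff_bounds h0 hθ hθ1 hz
  have h1 := (hasSum_nat_add_iff' d).2 hs
  rw [← h1.tsum_eq, ← Real.norm_eq_abs]
  refine tsum_of_norm_bounded
    ((hasSum_geometric_of_lt_one hθ.le hθ1).mul_left (p.natDegree * θ ^ d)) fun s => ?_
  rw [Real.norm_eq_abs]
  refine (hb (s + d)).trans_eq ?_
  rw [pow_add]
  ring

end LogTaylor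

theorem logTaylor_eq {n m : ℕ} (Q : Fin m → Matrix (Fin n) (Fin n) ℝ) (d : ℕ) :
    logTaylor Q d = ∑ s ∈ Finset.range (d + 1), logCoeff (avgPoly Q Finset.univ) s := by
  simp only [logTaylor, logCoeff, average_eq_eval]

end GaussianProduct

namespace GaussianProduct

/-! ### A recursion for the Taylor coefficients -/

section TupleSum

variable {n : ℕ} {ι : Type*}

/-- For a tuple `(k₁, …, kₛ)`, the matrix `∑ c(kₐ₊₁, …, kₛ) Q_{k₁} ⋯ Q_{kₐ}`, and
the coefficient `c(k₁, …, kₛ)`, which is its trace divided by `2 s`. -/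
noncomputable def tupleData (Q : ι → Matrix (Fin n) (Fin n) ℝ) :
    List ι → Matrix (Fin n) (Fin n) ℝ × ℝ
  | [] => (0, 1)
  | k :: t =>
    (Q k * ((tupleData Q t).1 + (tupleData Q t).2 • (1 : Matrix (Fin n) (Fin n) ℝ)),
      (Q k * ((tupleData Q t).1 + (tupleData Q t).2 • (1 : Matrix (Fin n) (Fin n) ℝ))).trace /
        (2 * (t.length + 1 : ℝ)))

variable [DecidableEq ι]

/-- The sum of `φ` over the tuples of `s` distinct elements of `T`. -/
noncomputable def tupleSum : ℕ → (List ι → ℝ) → Finset ι → ℝ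
  | 0, φ, _ => φ []
  | s + 1, φ, T => ∑ l ∈ T, tupleSum s (fun t => φ (l :: t)) (T.erase l)

theorem tupleSum_congr {s : ℕ} {φ ψ : List ι → ℝ} (h : ∀ t, t.length = s → φ t = ψ t)
    (T : Finset ι) : tupleSum s φ T = tupleSum s ψ T := by
  induction s generalizing φ ψ T with
  | zero => exact h [] rfl
  | succ s ih =>
    exact Finset.sum_congr rfl fun l _ => ih (fun t ht => h (l :: t) (by simp [ht])) _

theorem tupleSum_add (s : ℕ) (φ ψ : List ι → ℝ) (T : Finset ι) :
    tupleSum s (fun t => φ t + ψ t) T = tupleSum s φ T + tupleSum s ψ T := by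
  induction s generalizing φ ψ T with
  | zero => rfl
  | succ s ih => simp only [tupleSum, ih, Finset.sum_add_distrib]

theorem tupleSum_mul_left (s : ℕ) (c : ℝ) (φ : List ι → ℝ) (T : Finset ι) :
    tupleSum s (fun t => c * φ t) T = c * tupleSum s φ T := by
  induction s generalizing φ T with
  | zero => rfl
  | succ s ih => simp only [tupleSum, ih, Finset.mul_sum]

/-- Write M_t and c_t for the matrix and the number attached to a tuple t. Both claims need a joint
induction: the derivative formula reduces p to the G with Q_l in front, and the recursion for G
contributes c_t through ½ tr(A) p_T and M_t through the absorbed forms. -/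
theorem coeff_eq_tupleSum {Q : ι → Matrix (Fin n) (Fin n) ℝ} (hQ : ∀ k, (Q k).IsSymm) (s : ℕ) :
    (∀ T : Finset ι, (avgPoly Q T).coeff s = tupleSum s (fun t => (tupleData Q t).2) T) ∧
    ∀ (A : Matrix (Fin n) (Fin n) ℝ) (T : Finset ι), (avgPolyWith Q A T).coeff s =
      tupleSum s (fun t => 1 / 2 * (A * ((tupleData Q t).1 + (tupleData Q t).2 • 1)).trace) T := by
  induction s with
  | zero =>
    refine ⟨fun T => ?_, fun A T => ?_⟩
    · simp [avgPoly_coeff_zero, tupleSum, tupleData]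
    · simp [coeff_zero_avgPolyWith hQ, tupleSum, tupleData]
  | succ s ih =>
    have h1 : ∀ T : Finset ι,
        (avgPoly Q T).coeff (s + 1) = tupleSum (s + 1) (fun t => (tupleData Q t).2) T := by
      intro T
      have h := coeff_avgPoly_succ Q T s
      have hs : (s + 1 : ℝ) ≠ 0 := by positivity
      refine mul_left_cancel₀ hs (h.trans ?_)
      rw [tupleSum, Finset.mul_sum]
      refine Finset.sum_congr rfl fun l _ => ?_
      rw [ih.2, ← tupleSum_mul_left]
      refine tupleSum_congr (fun t ht => ?_) _
      simp only [tupleData, ht]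
      field_simp
    refine ⟨h1, fun A T => ?_⟩
    rw [coeff_succ_avgPolyWith hQ, h1, ← tupleSum_mul_left]
    have h2 : ∑ l ∈ T, (avgPolyWith Q (A * Q l) (T.erase l)).coeff s =
        tupleSum (s + 1) (fun t => 1 / 2 * (A * (tupleData Q t).1).trace) T := by
      refine Finset.sum_congr rfl fun l _ => ?_
      rw [ih.2]
      refine tupleSum_congr (fun t _ => ?_) _
      simp only [tupleData, ← mul_assoc]
    rw [h2, ← tupleSum_add]
    refine tupleSum_congr (fun t _ => ?_) _
    rw [mul_add A, Matrix.trace_add, mul_smul_comm, mul_one, Matrix.trace_smul, smul_eq_mul]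
    ring

/-! ### Enumeration of tuples by base m expansions. -/

/-- The digits of `x` with respect to the base `m`: the `s` lowest ones, the lowest one last. -/
def digitList (m : ℕ) : ℕ → ℕ → List ℕ
  | 0, _ => []
  | s + 1, x => (x / m ^ s % m) :: digitList m s x

theorem digitList_length (m s x : ℕ) : (digitList m s x).length = s := by
  induction s with
  | zero => rfl
  | succ s ih => simp [digitList, ih]

theorem digitList_mul_add {m : ℕ} (hm : 0 < m) {s t : ℕ} (hst : s ≤ t) (q y : ℕ) :
    digitList m s (q * m ^ t + y) = digitList m s y := by
  induction s with
  | zero => rfl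
  | succ s ih =>
    obtain ⟨d, rfl⟩ := Nat.exists_eq_add_of_le hst
    rw [digitList, digitList, ih (by omega)]
    congr 1
    rw [show q * m ^ (s + 1 + d) + y = y + m ^ s * (m * (q * m ^ d)) by ring,
      Nat.add_mul_div_left _ _ (by positivity), Nat.add_mul_mod_self_left]

theorem digitList_succ_mul_add {m s l y : ℕ} (hl : l < m) (hy : y < m ^ s) :
    digitList m (s + 1) (l * m ^ s + y) = l :: digitList m s y := by
  rw [digitList, digitList_mul_add (by omega) le_rfl, mul_comm l,
    Nat.mul_add_div (pow_pos (by omega) s), Nat.div_eq_of_lt hy, add_zero, Nat.mod_eq_of_lt hl]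

theorem sum_range_mul_eq (a b : ℕ) (g : ℕ → ℝ) :
    ∑ x ∈ Finset.range (b * a), g x =
      ∑ q ∈ Finset.range b, ∑ y ∈ Finset.range a, g (q * a + y) := by
  induction b with
  | zero => simp
  | succ b ih => rw [Nat.succ_mul, Finset.sum_range_add, ih, Finset.sum_range_succ]

/-- The numbers below m^(s+1) are l m^s + y with y < m^s; the leading digit l is the first entry of
the tuple. Words with repetitions or with letters outside T contribute zero. -/
theorem sum_digitList_eq_tupleSum (m s : ℕ) (φ : List ℕ → ℝ) (T : Finset ℕ)
    (hT : T ⊆ Finset.range m) :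
    ∑ x ∈ Finset.range (m ^ s),
      (if (digitList m s x).Nodup ∧ ∀ k ∈ digitList m s x, k ∈ T then φ (digitList m s x) else 0) =
      tupleSum s φ T := by
  induction s generalizing φ T with
  | zero => simp [digitList, tupleSum]
  | succ s ih =>
    rw [pow_succ', sum_range_mul_eq, tupleSum, ← Finset.sum_subset hT]
    · refine Finset.sum_congr rfl fun l hl => ?_
      have hlm : l < m := Finset.mem_range.1 (hT hl)
      rw [← ih _ _ ((Finset.erase_subset _ _).trans hT)]
      refine Finset.sum_congr rfl fun y hy => ?_
      have hy' := Finset.mem_range.1 hy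
      rw [digitList_succ_mul_add hlm hy']
      refine if_congr ?_ rfl rfl
      simp only [List.nodup_cons, List.mem_cons, forall_eq_or_imp, Finset.mem_erase]
      constructor
      · rintro ⟨⟨h2, h3⟩, -, h4⟩
        exact ⟨h3, fun k hk => ⟨fun e => h2 (e ▸ hk), h4 k hk⟩⟩
      · rintro ⟨h2, h3⟩
        exact ⟨⟨fun h => (h3 l h).1 rfl, h2⟩, hl, fun k hk => (h3 k hk).2⟩
    · intro l hl hlT
      refine Finset.sum_eq_zero fun y hy => if_neg ?_
      have hlm := Finset.mem_range.1 hl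
      have hy' := Finset.mem_range.1 hy
      rw [digitList_succ_mul_add hlm hy']
      exact fun h => hlT (h.2 l (by simp))

theorem digitList_lt {m : ℕ} (hm : 0 < m) (s x : ℕ) : ∀ k ∈ digitList m s x, k < m := by
  induction s with
  | zero => simp [digitList]
  | succ s ih =>
    intro k hk
    rcases List.mem_cons.1 hk with rfl | hk
    · exact Nat.mod_lt _ hm
    · exact ih k hk

end TupleSum

/-- A family of matrices extended by zero to all natural numbers. -/
noncomputable def natFamily {n m : ℕ} (Q : Fin m → Matrix (Fin n) (Fin n) ℝ) (k : ℕ) :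
    Matrix (Fin n) (Fin n) ℝ :=
  if h : k < m then Q ⟨k, h⟩ else 0

theorem natFamily_isSymm {n m : ℕ} {Q : Fin m → Matrix (Fin n) (Fin n) ℝ}
    (hQ : ∀ k, (Q k).IsSymm) (k : ℕ) : (natFamily Q k).IsSymm := by
  rw [natFamily]
  split
  · exact hQ _
  · exact Matrix.isSymm_zero

theorem avgPoly_natFamily {n m : ℕ} (Q : Fin m → Matrix (Fin n) (Fin n) ℝ) :
    avgPoly (natFamily Q) (Finset.range m) = avgPoly Q Finset.univ := by
  refine Polynomial.funext fun z => ?_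
  rw [eval_avgPoly, eval_avgPoly, Finset.prod_range]
  simp [natFamily]

theorem coeff_eq_sum_digitList {n m : ℕ} {Q : Fin m → Matrix (Fin n) (Fin n) ℝ}
    (hQ : ∀ k, (Q k).IsSymm) (s : ℕ) :
    (avgPoly Q Finset.univ).coeff s = ∑ x ∈ Finset.range (m ^ s),
      if (digitList m s x).Nodup then (tupleData (natFamily Q) (digitList m s x)).2 else 0 := by
  rw [← avgPoly_natFamily, (coeff_eq_tupleSum (natFamily_isSymm hQ) s).1,
    ← sum_digitList_eq_tupleSum m s _ _ subset_rfl]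
  refine Finset.sum_congr rfl fun x hx => if_congr ?_ rfl rfl
  rw [and_iff_left_iff_imp]
  intro _ k hk
  rw [Finset.mem_range]
  refine digitList_lt ?_ s x k hk
  -- For m = 0 there are no numbers below m^s unless s = 0, and then the tuple is empty.
  rcases Nat.eq_zero_or_pos m with rfl | hm
  · cases s with
    | zero => simp [digitList] at hk
    | succ s => simp at hx
  · exact hm

end GaussianProduct

namespace RealRAM

/-! ### Reasoning about programs -/

namespace State

/-- Assignment to a register for natural numbers. -/
def setI (σ : State) (x v : ℕ) : State := { σ with ireg := Function.update σ.ireg x v }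

/-- Assignment to a register for real numbers. -/
def setR (σ : State) (x : ℕ) (v : ℝ) : State := { σ with rreg := Function.update σ.rreg x v }

/-- Assignment to a cell of an array of natural numbers. -/
def putI (σ : State) (a i v : ℕ) : State :=
  { σ with imem := Function.update σ.imem a (Function.update (σ.imem a) i v) }

/-- Assignment to a cell of an array of real numbers. -/
def putR (σ : State) (a i : ℕ) (v : ℝ) : State :=
  { σ with rmem := Function.update σ.rmem a (Function.update (σ.rmem a) i v) }

variable (σ : State) (a b i j x y v : ℕ) (w : ℝ)

@[simp] theorem setI_ireg : (σ.setI x v).ireg y = if y = x then v else σ.ireg y :=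
  Function.update_apply _ _ _ _
@[simp] theorem setI_rreg : (σ.setI x v).rreg = σ.rreg := rfl
@[simp] theorem setR_ireg : (σ.setR x w).ireg = σ.ireg := rfl
@[simp] theorem setR_rreg : (σ.setR x w).rreg y = if y = x then w else σ.rreg y :=
  Function.update_apply _ _ _ _
@[simp] theorem setR_rmem : (σ.setR x w).rmem = σ.rmem := rfl
@[simp] theorem putI_imem : (σ.putI a i v).imem b =
    if b = a then Function.update (σ.imem a) i v else σ.imem b :=
  Function.update_apply _ _ _ _
@[simp] theorem putR_rmem : (σ.putR a i w).rmem b =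
    if b = a then Function.update (σ.rmem a) i w else σ.rmem b :=
  Function.update_apply _ _ _ _

end State

namespace Program

/-- The sum of the costs of the parts of a program. -/
def size : Program → ℕ
  | skip => 1
  | seq p q => p.size + q.size
  | iset _ e => e.cost + 1
  | rset _ e => e.cost + 1
  | istore _ i e => i.cost + e.cost + 1
  | rstore _ i e => i.cost + e.cost + 1
  | branch b p q => b.cost + p.size + q.size
  | loop b p => b.cost + p.size

/-- Whether the program contains an assignment to the register `x` for natural numbers. -/
def wi : Program → ℕ → Bool
  | seq p q, x => p.wi x || q.wi x
  | iset y _, x => x == y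
  | branch _ p q, x => p.wi x || q.wi x
  | loop _ p, x => p.wi x
  | _, _ => false

/-- Whether the program contains an assignment to the register `x` for real numbers. -/
def wr : Program → ℕ → Bool
  | seq p q, x => p.wr x || q.wr x
  | rset y _, x => x == y
  | branch _ p q, x => p.wr x || q.wr x
  | loop _ p, x => p.wr x
  | _, _ => false

/-- Whether the program contains an assignment to the array `x` of natural numbers. -/
def wim : Program → ℕ → Bool
  | seq p q, x => p.wim x || q.wim x
  | istore y _ _, x => x == y
  | branch _ p q, x => p.wim x || q.wim x
  | loop _ p, x => p.wim x
  | _, _ => false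

/-- Whether the program contains an assignment to the array `x` of real numbers. -/
def wrm : Program → ℕ → Bool
  | seq p q, x => p.wrm x || q.wrm x
  | rstore y _ _, x => x == y
  | branch _ p q, x => p.wrm x || q.wrm x
  | loop _ p, x => p.wrm x
  | _, _ => false

/-- `for i < e do p`. -/
def forLoop (i : ℕ) (e : IExpr) (p : Program) : Program :=
  .seq (.iset i (.const 0))
    (.loop (.ilt (.reg i) e) (.seq p (.iset i (.add (.reg i) (.const 1)))))

end Program

open Program

/-- The two memories agree, except where the program contains assignments. -/
structure Frame (p : Program) (σ τ : State) : Prop where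
  i : ∀ x, p.wi x = false → τ.ireg x = σ.ireg x
  r : ∀ x, p.wr x = false → τ.rreg x = σ.rreg x
  im : ∀ x, p.wim x = false → τ.imem x = σ.imem x
  rm : ∀ x, p.wrm x = false → τ.rmem x = σ.rmem x

theorem Frame.refl (p : Program) (σ : State) : Frame p σ σ :=
  ⟨fun _ _ => rfl, fun _ _ => rfl, fun _ _ => rfl, fun _ _ => rfl⟩

theorem Frame.trans {p : Program} {σ τ υ : State} (h : Frame p σ τ) (h' : Frame p τ υ) :
    Frame p σ υ :=
  ⟨fun x hx => (h'.i x hx).trans (h.i x hx), fun x hx => (h'.r x hx).trans (h.r x hx),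
    fun x hx => (h'.im x hx).trans (h.im x hx), fun x hx => (h'.rm x hx).trans (h.rm x hx)⟩

theorem Frame.mono {p q : Program} {σ τ : State} (h : Frame p σ τ)
    (hi : ∀ x, q.wi x = false → p.wi x = false) (hr : ∀ x, q.wr x = false → p.wr x = false)
    (him : ∀ x, q.wim x = false → p.wim x = false)
    (hrm : ∀ x, q.wrm x = false → p.wrm x = false) : Frame q σ τ :=
  ⟨fun x hx => h.i x (hi x hx), fun x hx => h.r x (hr x hx), fun x hx => h.im x (him x hx),
    fun x hx => h.rm x (hrm x hx)⟩

theorem Frame.seq_left {p q : Program} {σ τ : State} (h : Frame p σ τ) : Frame (.seq p q) σ τ := by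
  refine h.mono ?_ ?_ ?_ ?_ <;> intro x hx <;> simp only [wi, wr, wim, wrm, Bool.or_eq_false_iff] at hx <;>
    exact hx.1

theorem Frame.seq_right {p q : Program} {σ τ : State} (h : Frame q σ τ) : Frame (.seq p q) σ τ := by
  refine h.mono ?_ ?_ ?_ ?_ <;> intro x hx <;> simp only [wi, wr, wim, wrm, Bool.or_eq_false_iff] at hx <;>
    exact hx.2

theorem Frame.loop {b : Test} {p : Program} {σ τ : State} (h : Frame p σ τ) :
    Frame (.loop b p) σ τ :=
  h.mono (fun _ h => h) (fun _ h => h) (fun _ h => h) (fun _ h => h)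

/-- Which locations a program can change is decided from its text alone. For concrete programs and
locations the side conditions then hold by `rfl`. -/
theorem Run.frame {p : Program} {σ τ : State} {t : ℕ} (h : Run p σ τ t) : Frame p σ τ := by
  induction h with
  | skip σ => exact Frame.refl _ _
  | seq _ _ ih₁ ih₂ => exact ih₁.seq_left.trans ih₂.seq_right
  | iset x e σ =>
    refine ⟨fun y hy => ?_, fun _ _ => rfl, fun _ _ => rfl, fun _ _ => rfl⟩
    simp only [wi, beq_eq_false_iff_ne] at hy
    exact Function.update_of_ne hy _ _
  | rset x e σ =>
    refine ⟨fun _ _ => rfl, fun y hy => ?_, fun _ _ => rfl, fun _ _ => rfl⟩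
    simp only [wr, beq_eq_false_iff_ne] at hy
    exact Function.update_of_ne hy _ _
  | istore a i e σ =>
    refine ⟨fun _ _ => rfl, fun _ _ => rfl, fun y hy => ?_, fun _ _ => rfl⟩
    simp only [wim, beq_eq_false_iff_ne] at hy
    exact Function.update_of_ne hy _ _
  | rstore a i e σ =>
    refine ⟨fun _ _ => rfl, fun _ _ => rfl, fun _ _ => rfl, fun y hy => ?_⟩
    simp only [wrm, beq_eq_false_iff_ne] at hy
    exact Function.update_of_ne hy _ _
  | branch_true _ _ ih =>
    refine ih.mono ?_ ?_ ?_ ?_ <;> intro x hx <;>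
      simp only [wi, wr, wim, wrm, Bool.or_eq_false_iff] at hx <;> exact hx.1
  | branch_false _ _ ih =>
    refine ih.mono ?_ ?_ ?_ ?_ <;> intro x hx <;>
      simp only [wi, wr, wim, wrm, Bool.or_eq_false_iff] at hx <;> exact hx.2
  | loop_stop _ => exact Frame.refl _ _
  | loop_next _ _ _ ih₁ ih₂ => exact (Frame.loop ih₁).trans ih₂

/-- The program, started with memory `σ`, halts with a memory that satisfies `Q`, after at most
`size * (D + 1) ^ a` steps. -/
def Exec (D a : ℕ) (p : Program) (σ : State) (Q : State → Prop) : Prop :=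
  ∃ τ t, Run p σ τ t ∧ t ≤ p.size * (D + 1) ^ a ∧ Q τ

namespace Exec

variable {D a : ℕ} {p q : Program} {σ : State} {P Q : State → Prop}

theorem conseq (h : Exec D a p σ P) (hPQ : ∀ τ, Frame p σ τ → P τ → Q τ) : Exec D a p σ Q := by
  obtain ⟨τ, t, hr, ht, hP⟩ := h
  exact ⟨τ, t, hr, ht, hPQ τ hr.frame hP⟩

theorem mono {b : ℕ} (h : Exec D a p σ Q) (hab : a ≤ b) : Exec D b p σ Q := by
  obtain ⟨τ, t, hr, ht, hQ⟩ := h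
  exact ⟨τ, t, hr, ht.trans (Nat.mul_le_mul_left _ (Nat.pow_le_pow_right (by omega) hab)), hQ⟩

theorem le_mul_pow (n D a : ℕ) : n ≤ n * (D + 1) ^ a := Nat.le_mul_of_pos_right _ (by positivity)

theorem skip (h : Q σ) : Exec D a .skip σ Q := ⟨σ, _, .skip σ, le_mul_pow _ _ _, h⟩

theorem iset {x : ℕ} {e : IExpr} (h : Q (σ.setI x (e.eval σ))) : Exec D a (.iset x e) σ Q :=
  ⟨_, _, .iset x e σ, le_mul_pow _ _ _, h⟩

theorem rset {x : ℕ} {e : RExpr} (h : Q (σ.setR x (e.eval σ))) : Exec D a (.rset x e) σ Q :=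
  ⟨_, _, .rset x e σ, le_mul_pow _ _ _, h⟩

theorem istore {x : ℕ} {i e : IExpr} (h : Q (σ.putI x (i.eval σ) (e.eval σ))) :
    Exec D a (.istore x i e) σ Q :=
  ⟨_, _, .istore x i e σ, le_mul_pow _ _ _, h⟩

theorem rstore {x : ℕ} {i : IExpr} {e : RExpr} (h : Q (σ.putR x (i.eval σ) (e.eval σ))) :
    Exec D a (.rstore x i e) σ Q :=
  ⟨_, _, .rstore x i e σ, le_mul_pow _ _ _, h⟩

theorem seq (hp : Exec D a p σ P) (hq : ∀ τ, Frame p σ τ → P τ → Exec D a q τ Q) :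
    Exec D a (.seq p q) σ Q := by
  obtain ⟨τ, t, hr, ht, hP⟩ := hp
  obtain ⟨υ, t', hr', ht', hQ⟩ := hq τ hr.frame hP
  refine ⟨υ, _, .seq hr hr', ?_, hQ⟩
  rw [size, add_mul]
  exact Nat.add_le_add ht ht'

theorem seq' (h : Exec D a p σ fun τ => Exec D a q τ Q) : Exec D a (.seq p q) σ Q :=
  seq h fun _ _ h => h

theorem branch {b : Test} (hp : b.holds σ → Exec D a p σ Q) (hq : ¬ b.holds σ → Exec D a q σ Q) :
    Exec D a (.branch b p q) σ Q := by
  have hb := le_mul_pow b.cost D a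
  by_cases h : b.holds σ
  · obtain ⟨τ, t, hr, ht, hQ⟩ := hp h
    refine ⟨τ, _, .branch_true h hr, ?_, hQ⟩
    rw [size, add_mul, add_mul]
    omega
  · obtain ⟨τ, t, hr, ht, hQ⟩ := hq h
    refine ⟨τ, _, .branch_false h hr, ?_, hQ⟩
    rw [size, add_mul, add_mul]
    omega

/-- There are N ≤ D rounds and N + 1 tests, so a loop costs one more factor D + 1. The exponent in
`Exec` therefore measures the depth of nesting, and sequential parts only add to the size. -/
theorem loop {b : Test} {N : ℕ} (I : ℕ → State → Prop) (hN : N ≤ D) (h0 : I 0 σ)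
    (hbody : ∀ j < N, ∀ τ, Frame (.loop b p) σ τ → I j τ →
      b.holds τ ∧ Exec D a p τ (I (j + 1)))
    (hend : ∀ τ, Frame (.loop b p) σ τ → I N τ → ¬ b.holds τ ∧ Q τ) :
    Exec D (a + 1) (.loop b p) σ Q := by
  have key : ∀ d j τ, j + d = N → Frame (.loop b p) σ τ → I j τ →
      ∃ υ t, Run (.loop b p) τ υ t ∧ t ≤ d * (b.cost + p.size * (D + 1) ^ a) + b.cost ∧ Q υ := by
    intro d
    induction d with
    | zero =>
      intro j τ hj hF hI
      obtain rfl : j = N := by omega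
      obtain ⟨hb, hQ⟩ := hend τ hF hI
      exact ⟨τ, _, Run.loop_stop hb, by omega, hQ⟩
    | succ d ih =>
      intro j τ hj hF hI
      obtain ⟨hb, τ', t, hr, ht, hI'⟩ := hbody j (by omega) τ hF hI
      obtain ⟨υ, t', hr', ht', hQ⟩ := ih (j + 1) τ' (by omega) (hF.trans hr.frame.loop) hI'
      refine ⟨υ, _, .loop_next hb hr hr', ?_, hQ⟩
      rw [add_mul, one_mul]
      omega
  obtain ⟨υ, t, hr, ht, hQ⟩ := key N 0 σ (by omega) (Frame.refl _ _) h0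
  refine ⟨υ, t, hr, ht.trans ?_, hQ⟩
  have h1 := le_mul_pow b.cost D a
  have h2 : N * (b.cost + p.size * (D + 1) ^ a) + b.cost ≤
      (D + 1) * (b.cost * (D + 1) ^ a + p.size * (D + 1) ^ a) := by
    rw [add_mul D 1, one_mul]
    refine Nat.add_le_add (Nat.mul_le_mul hN (by omega)) (by omega)
  refine h2.trans_eq ?_
  rw [size, pow_succ]
  ring

/-- The bound is evaluated again at every test, so it must be constant in all memories within the
frame. The invariant must not depend on the counter register, which is increased after the body. -/
theorem forLoop {i : ℕ} {e : IExpr} {N : ℕ} (I : ℕ → State → Prop) (hN : N ≤ D)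
    (hwi : p.wi i = false) (he : ∀ τ, Frame (.forLoop i e p) σ τ → e.eval τ = N)
    (hI : ∀ j τ v, I j τ → I j (τ.setI i v)) (h0 : I 0 σ)
    (hbody : ∀ j < N, ∀ τ, Frame (.forLoop i e p) σ τ → τ.ireg i = j → I j τ →
      Exec D a p τ (I (j + 1)))
    (hQ : ∀ τ, Frame (.forLoop i e p) σ τ → I N τ → Q τ) :
    Exec D (a + 1) (.forLoop i e p) σ Q := by
  refine seq (P := fun τ => τ.ireg i = 0 ∧ I 0 τ) (iset ⟨by simp [IExpr.eval], hI _ _ _ h0⟩) ?_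
  rintro σ' hF₀ ⟨hi, h0'⟩
  have hF : ∀ τ, Frame (.loop (.ilt (.reg i) e)
      (.seq p (.iset i (.add (.reg i) (.const 1))))) σ' τ → Frame (.forLoop i e p) σ τ :=
    fun τ h => hF₀.seq_left.trans h.seq_right
  refine loop (fun j τ => τ.ireg i = j ∧ I j τ) hN ⟨hi, h0'⟩ ?_ ?_
  · rintro j hj τ hFτ ⟨hij, hIj⟩
    refine ⟨?_, ?_⟩
    · rw [Test.holds, he τ (hF τ hFτ), IExpr.eval, hij]
      exact hj
    · refine seq (hbody j hj τ (hF τ hFτ) hij hIj) fun υ hFυ hυ => iset ⟨?_, hI _ _ _ hυ⟩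
      simp [IExpr.eval, hFυ.i i hwi, hij]
  · rintro τ hFτ ⟨hij, hIj⟩
    refine ⟨?_, hQ τ (hF τ hFτ) hIj⟩
    rw [Test.holds, he τ (hF τ hFτ), IExpr.eval, hij]
    exact lt_irrefl _

end Exec

end RealRAM

namespace RealRAM

open Program

/-! ### Arithmetic of matrices stored row by row -/

section MatrixPrograms

variable {D n : ℕ} {σ : State}

/-- Register `d` is set to the product of the values of `e` and `e'`. -/
def mulProg (d : ℕ) (e e' : IExpr) : Program :=
  .seq (.iset d (.const 0)) (.forLoop 12 e' (.iset d (.add (.reg d) e)))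

/-- Natural numbers can only be added and subtracted, so a product is a repeated addition. Register
12 counts the rounds and cannot hold the result. -/
theorem exec_mulProg {d : ℕ} {e e' : IExpr} {v v' : ℕ} (hv' : v' ≤ D) (hd : d ≠ 12)
    (he : ∀ τ, Frame (mulProg d e e') σ τ → e.eval τ = v)
    (he' : ∀ τ, Frame (mulProg d e e') σ τ → e'.eval τ = v') :
    Exec D 1 (mulProg d e e') σ (fun τ => τ.ireg d = v * v') := by
  refine Exec.seq (P := fun τ => τ.ireg d = 0) (Exec.iset (by simp [IExpr.eval])) fun σ' hF h0 => ?_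
  have hF' : ∀ τ, Frame (.forLoop 12 e' (.iset d (.add (.reg d) e))) σ' τ →
      Frame (mulProg d e e') σ τ := fun τ h => hF.seq_left.trans h.seq_right
  refine Exec.forLoop (fun j τ => τ.ireg d = v * j) hv' ?_ (fun τ h => he' τ (hF' τ h)) ?_ ?_ ?_ ?_
  · simpa [wi] using hd.symm
  · intro j τ w h
    simpa [hd] using h
  · simpa using h0
  · intro j _ τ h _ hj
    refine Exec.iset ?_
    simp only [IExpr.eval, hj, he τ (hF' τ h), State.setI_ireg, if_true]
    ring
  · exact fun τ _ h => h

/-- Register `5` is set to an entry of the product of a matrix in array `0` (with the row which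
starts at the address in register `13`) and of the sum of the matrix in array `1` and of a
multiple of the identity matrix. -/
def entryProg : Program :=
  .seq (.rset 5 (.mul (.reg 2) (.load 0 (.add (.reg 13) (.reg 10)))))
    (.forLoop 11 (.reg 0) (.seq (mulProg 14 (.reg 11) (.reg 0))
      (.rset 5 (.add (.reg 5) (.mul (.load 0 (.add (.reg 13) (.reg 11)))
        (.load 1 (.add (.reg 14) (.reg 10))))))))

theorem exec_entryProg (h0 : σ.ireg 0 = n) (hn : n ≤ D) :
    Exec D 2 entryProg σ (fun τ => τ.rreg 5 =
      σ.rreg 2 * σ.rmem 0 (σ.ireg 13 + σ.ireg 10) +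
        ∑ h ∈ Finset.range n, σ.rmem 0 (σ.ireg 13 + h) * σ.rmem 1 (h * n + σ.ireg 10)) := by
  refine Exec.seq (P := fun τ => τ.rreg 5 = σ.rreg 2 * σ.rmem 0 (σ.ireg 13 + σ.ireg 10))
    (Exec.rset (by simp [RExpr.eval, IExpr.eval])) fun σ' hF h5 => ?_
  refine Exec.forLoop (fun j τ => τ.rreg 5 = σ.rreg 2 * σ.rmem 0 (σ.ireg 13 + σ.ireg 10) +
        ∑ h ∈ Finset.range j, σ.rmem 0 (σ.ireg 13 + h) * σ.rmem 1 (h * n + σ.ireg 10)) hn rfl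
    (fun τ h => ?_) (fun _ _ _ h => h) (by simpa using h5) ?_ (fun _ _ h => h)
  · rw [IExpr.eval, h.i 0 rfl, hF.i 0 rfl, h0]
  · intro j _ τ h hj hI
    have e0 : τ.ireg 0 = n := by rw [h.i 0 rfl, hF.i 0 rfl, h0]
    refine Exec.seq (exec_mulProg (v := j) (v' := n) hn (by norm_num)
      (fun υ hυ => by rw [IExpr.eval, hυ.i 11 rfl, hj])
      (fun υ hυ => by rw [IExpr.eval, hυ.i 0 rfl, e0])) fun υ hυ h14 => Exec.rset ?_
    simp only [RExpr.eval, IExpr.eval, State.setR_rreg, if_true, h14, hυ.r 5 rfl, hI,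
      hυ.i 11 rfl, hυ.i 13 rfl, hυ.i 10 rfl, hυ.rm 0 rfl, hυ.rm 1 rfl, hj, h.i 10 rfl, h.i 13 rfl,
      h.rm 0 rfl, h.rm 1 rfl, hF.i 10 rfl, hF.i 13 rfl, hF.rm 0 rfl, hF.rm 1 rfl,
      Finset.sum_range_succ]
    ring

/-- The first `a` cells of `f` hold the first entries of an `n × n` matrix, row by row. -/
def Filled (n a : ℕ) (f : ℕ → ℝ) (v : ℕ → ℕ → ℝ) : Prop :=
  ∀ i < n, ∀ l < n, i * n + l < a → f (i * n + l) = v i l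

theorem filled_zero (n : ℕ) (f : ℕ → ℝ) (v : ℕ → ℕ → ℝ) : Filled n 0 f v :=
  fun _ _ _ _ h => absurd h (Nat.not_lt_zero _)

/-- Division by n with remainder recovers the row and the column from the address, so writing one
entry does not disturb the others. -/
theorem Filled.update {i l : ℕ} {f : ℕ → ℝ} {v : ℕ → ℕ → ℝ} (h : Filled n (i * n + l) f v)
    (hl : l < n) {w : ℝ} (hw : w = v i l) :
    Filled n (i * n + (l + 1)) (Function.update f (i * n + l) w) v := by
  intro i' hi' l' hl' hlt
  rcases (show i' * n + l' < i * n + l ∨ i' * n + l' = i * n + l by omega) with h1 | h1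
  · rw [Function.update_of_ne h1.ne]
    exact h i' hi' l' hl' h1
  · have hn : 0 < n := by omega
    have h2 : (i' * n + l') / n = (i * n + l) / n := by rw [h1]
    have h3 : (i' * n + l') % n = (i * n + l) % n := by rw [h1]
    rw [mul_comm i', mul_comm i, Nat.mul_add_div hn, Nat.mul_add_div hn, Nat.div_eq_of_lt hl,
      Nat.div_eq_of_lt hl', add_zero, add_zero] at h2
    rw [mul_comm i', mul_comm i, Nat.mul_add_mod, Nat.mul_add_mod, Nat.mod_eq_of_lt hl,
      Nat.mod_eq_of_lt hl'] at h3
    subst h2 h3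
    rw [Function.update_self, hw]

theorem Filled.apply {f : ℕ → ℝ} {v : ℕ → ℕ → ℝ} (h : Filled n (n * n) f v) {i l : ℕ} (hi : i < n)
    (hl : l < n) : f (i * n + l) = v i l := by
  refine h i hi l hl ?_
  calc i * n + l < i * n + n := by omega
    _ = (i + 1) * n := by ring
    _ ≤ n * n := Nat.mul_le_mul_right _ hi

/-- The product of a matrix in array `0`, whose index is in register `17`, and of the sum of
the matrix in array `1` and of a multiple of the identity matrix is written to array `2`. -/
def productProg : Program :=
  .seq (mulProg 16 (.reg 17) (.reg 0))
    (.forLoop 9 (.reg 0) (.seq (mulProg 13 (.add (.reg 16) (.reg 9)) (.reg 0))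
      (.forLoop 10 (.reg 0) (.seq entryProg (.seq (mulProg 14 (.reg 9) (.reg 0))
        (.rstore 2 (.add (.reg 14) (.reg 10)) (.reg 5)))))))

/-- The entries computed by `productProg`. -/
noncomputable def productEntry (σ : State) (n i l : ℕ) : ℝ :=
  σ.rreg 2 * σ.rmem 0 ((σ.ireg 17 * n + i) * n + l) +
    ∑ h ∈ Finset.range n, σ.rmem 0 ((σ.ireg 17 * n + i) * n + h) * σ.rmem 1 (h * n + l)

/-- The result goes to a second array because array 1 is still being read while the product is
formed. -/
theorem exec_productProg (h0 : σ.ireg 0 = n) (hn : n ≤ D) :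
    Exec D 4 productProg σ (fun τ => Filled n (n * n) (τ.rmem 2) (productEntry σ n)) := by
  refine Exec.seq ((exec_mulProg (v := σ.ireg 17) (v' := n) hn (by norm_num)
      (fun υ hυ => by rw [IExpr.eval, hυ.i 17 rfl])
      (fun υ hυ => by rw [IExpr.eval, hυ.i 0 rfl, h0])).mono (by norm_num)) fun σ₁ F₁ h16 => ?_
  refine Exec.forLoop (fun i τ => Filled n (i * n) (τ.rmem 2) (productEntry σ n)) hn rfl
    (fun τ h => by rw [IExpr.eval, h.i 0 rfl, F₁.i 0 rfl, h0]) (fun _ _ _ h => h)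
    (by rw [zero_mul]; exact filled_zero _ _ _) ?_ (fun _ _ h => h)
  intro i hi σ₂ F₂ h9 hI
  have e0 : σ₂.ireg 0 = n := by rw [F₂.i 0 rfl, F₁.i 0 rfl, h0]
  refine Exec.seq ((exec_mulProg (v := σ.ireg 17 * n + i) (v' := n) hn (by norm_num)
      (fun υ hυ => by rw [IExpr.eval, IExpr.eval, IExpr.eval, hυ.i 16 rfl, hυ.i 9 rfl, h9,
        F₂.i 16 rfl, h16])
      (fun υ hυ => by rw [IExpr.eval, hυ.i 0 rfl, e0])).mono (by norm_num)) fun σ₃ F₃ h13 => ?_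
  refine Exec.forLoop (fun l τ => Filled n (i * n + l) (τ.rmem 2) (productEntry σ n)) hn rfl
    (fun τ h => by rw [IExpr.eval, h.i 0 rfl, F₃.i 0 rfl, e0]) (fun _ _ _ h => h)
    (by rw [F₃.rm 2 rfl]; exact hI) ?_ (fun τ _ h => by rw [add_mul, one_mul]; exact h)
  intro l hl σ₄ F₄ h10 hI₄
  have e0' : σ₄.ireg 0 = n := by rw [F₄.i 0 rfl, F₃.i 0 rfl, e0]
  refine Exec.seq (exec_entryProg e0' hn) fun σ₅ F₅ h5 => ?_
  refine Exec.seq ((exec_mulProg (v := i) (v' := n) hn (by norm_num)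
      (fun υ hυ => by rw [IExpr.eval, hυ.i 9 rfl, F₅.i 9 rfl, F₄.i 9 rfl, F₃.i 9 rfl, h9])
      (fun υ hυ => by rw [IExpr.eval, hυ.i 0 rfl, F₅.i 0 rfl, e0'])).mono (by norm_num))
      fun σ₆ F₆ h14 => Exec.rstore ?_
  simp only [IExpr.eval, RExpr.eval, State.putR_rmem, if_true, h14, F₆.i 10 rfl, F₅.i 10 rfl, h10,
    F₆.rm 2 rfl, F₅.rm 2 rfl]
  refine hI₄.update hl ?_
  rw [F₆.r 5 rfl, h5, productEntry]
  simp only [F₄.i 13 rfl, h13, h10, F₄.rm 0 rfl, F₃.rm 0 rfl, F₂.rm 0 rfl, F₁.rm 0 rfl, F₄.rm 1 rfl,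
    F₃.rm 1 rfl, F₂.rm 1 rfl, F₁.rm 1 rfl, F₄.r 2 rfl, F₃.r 2 rfl, F₂.r 2 rfl, F₁.r 2 rfl]

/-- The matrix in array `2` is copied to array `1`, and its trace is written to register `4`. -/
def copyProg : Program :=
  .seq (.rset 4 (.const 0)) (.forLoop 9 (.reg 0) (.seq (mulProg 14 (.reg 9) (.reg 0))
    (.seq (.rset 4 (.add (.reg 4) (.load 2 (.add (.reg 14) (.reg 9)))))
      (.forLoop 10 (.reg 0)
        (.rstore 1 (.add (.reg 14) (.reg 10)) (.load 2 (.add (.reg 14) (.reg 10))))))))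

theorem exec_copyProg (h0 : σ.ireg 0 = n) (hn : n ≤ D) :
    Exec D 2 copyProg σ (fun τ =>
      τ.rreg 4 = ∑ i ∈ Finset.range n, σ.rmem 2 (i * n + i) ∧
        Filled n (n * n) (τ.rmem 1) (fun i l => σ.rmem 2 (i * n + l))) := by
  refine Exec.seq (P := fun τ => τ.rreg 4 = 0) (Exec.rset (by simp [RExpr.eval])) fun σ₁ F₁ h4 => ?_
  refine Exec.forLoop (fun i τ => τ.rreg 4 = ∑ i ∈ Finset.range i, σ.rmem 2 (i * n + i) ∧
        Filled n (i * n) (τ.rmem 1) (fun i l => σ.rmem 2 (i * n + l))) hn rfl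
    (fun τ h => by rw [IExpr.eval, h.i 0 rfl, F₁.i 0 rfl, h0]) (fun _ _ _ h => h)
    ⟨by simpa using h4, by rw [zero_mul]; exact filled_zero _ _ _⟩ ?_ (fun _ _ h => h)
  rintro i hi σ₂ F₂ h9 ⟨hI, hI'⟩
  have e0 : σ₂.ireg 0 = n := by rw [F₂.i 0 rfl, F₁.i 0 rfl, h0]
  refine Exec.seq ((exec_mulProg (v := i) (v' := n) hn (by norm_num)
      (fun υ hυ => by rw [IExpr.eval, hυ.i 9 rfl, h9])
      (fun υ hυ => by rw [IExpr.eval, hυ.i 0 rfl, e0])).mono (by norm_num)) fun σ₃ F₃ h14 => ?_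
  refine Exec.seq (P := fun τ => τ.rreg 4 = ∑ i ∈ Finset.range (i + 1), σ.rmem 2 (i * n + i))
    (Exec.rset ?_) fun σ₄ F₄ hr4 => ?_
  · simp only [RExpr.eval, IExpr.eval, State.setR_rreg, if_true, h14, F₃.r 4 rfl, hI, F₃.i 9 rfl, h9,
      F₃.rm 2 rfl, F₂.rm 2 rfl, F₁.rm 2 rfl, Finset.sum_range_succ]
  refine Exec.conseq (P := fun τ => Filled n (i * n + n) (τ.rmem 1) (fun i l => σ.rmem 2 (i * n + l)))
    ?_ fun τ hF hτ => ⟨(hF.r 4 rfl).trans hr4, by rw [add_mul, one_mul]; exact hτ⟩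
  refine Exec.forLoop (fun l τ => Filled n (i * n + l) (τ.rmem 1) (fun i l => σ.rmem 2 (i * n + l)))
    hn rfl (fun τ h => by rw [IExpr.eval, h.i 0 rfl, F₄.i 0 rfl, F₃.i 0 rfl, e0])
    (fun _ _ _ h => h) (by rw [F₄.rm 1 rfl, F₃.rm 1 rfl]; exact hI') ?_ (fun τ _ h => h)
  intro l hl σ₅ F₅ h10 hI₅
  refine Exec.rstore ?_
  simp only [IExpr.eval, RExpr.eval, State.putR_rmem, if_true, h10, F₅.i 14 rfl, F₄.i 14 rfl, h14]
  refine hI₅.update hl ?_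
  rw [F₅.rm 2 rfl, F₄.rm 2 rfl, F₃.rm 2 rfl, F₂.rm 2 rfl, F₁.rm 2 rfl]

/-- The matrix in array `1` and the coefficient in register `2` are updated. -/
def stepProg : Program :=
  .seq productProg (.seq copyProg
    (.rset 2 (.div (.reg 4) (.mul (.const 2) (.cast (.add (.reg 7) (.const 1)))))))

/-- Array `1` and register `2` hold the given matrix and the given number. -/
def HoldsData (σ : State) {n : ℕ} (d : Matrix (Fin n) (Fin n) ℝ × ℝ) : Prop :=
  (∀ i l : Fin n, σ.rmem 1 (i * n + l) = d.1 i l) ∧ σ.rreg 2 = d.2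

/-- This is the recursion of `tupleData`: register 7 holds the length of the tail, and register 17
the index put in front of it. -/
theorem exec_stepProg (h0 : σ.ireg 0 = n) (hn : n ≤ D) {d : Matrix (Fin n) (Fin n) ℝ × ℝ}
    (hd : HoldsData σ d) {A : Matrix (Fin n) (Fin n) ℝ}
    (hA : ∀ i l : Fin n, σ.rmem 0 ((σ.ireg 17 * n + i) * n + l) = A i l) :
    Exec D 4 stepProg σ (fun τ => HoldsData τ (A * (d.1 + d.2 • (1 : Matrix (Fin n) (Fin n) ℝ)),
      (A * (d.1 + d.2 • (1 : Matrix (Fin n) (Fin n) ℝ))).trace / (2 * (σ.ireg 7 + 1 : ℝ)))) := by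
  have hentry : ∀ i l : Fin n, productEntry σ n i l =
      (A * (d.1 + d.2 • (1 : Matrix (Fin n) (Fin n) ℝ))) i l := by
    intro i l
    rw [productEntry, Finset.sum_range, Matrix.mul_add, mul_smul_comm, mul_one, Matrix.add_apply,
      Matrix.smul_apply, Matrix.mul_apply, smul_eq_mul, hA, hd.2, add_comm]
    congr 1
    exact Finset.sum_congr rfl fun h _ => by rw [hA, hd.1]
  refine Exec.seq (exec_productProg h0 hn) fun σ₁ F₁ h₁ => ?_
  refine Exec.seq ((exec_copyProg ((F₁.i 0 rfl).trans h0) hn).mono (by norm_num))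
    fun σ₂ F₂ h₂ => Exec.rset ?_
  refine ⟨fun i l => ?_, ?_⟩
  · rw [State.setR_rmem, h₂.2.apply i.2 l.2, h₁.apply i.2 l.2, hentry]
  · simp only [RExpr.eval, IExpr.eval, State.setR_rreg, if_true, F₂.i 7 rfl, F₁.i 7 rfl, h₂.1,
      Finset.sum_range]
    push_cast
    congr 1
    rw [Matrix.trace]
    exact Finset.sum_congr rfl fun i _ => by rw [h₁.apply i.2 i.2, hentry, Matrix.diag_apply]

end MatrixPrograms

end RealRAM

namespace RealRAM

open Program GaussianProduct

/-! ### The program for the Taylor coefficients -/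

section CoefficientPrograms

variable {D n m : ℕ} {σ : State}

/-- Register `17` is set to the lowest digit of the number in register `6`, which is removed. -/
def digitProg : Program :=
  .seq (.iset 8 (.const 0)) (.seq (.iset 17 (.reg 6))
    (.seq (.loop (.neg (.ilt (.reg 17) (.reg 1))) (.seq (.iset 17 (.sub (.reg 17) (.reg 1)))
      (.iset 8 (.add (.reg 8) (.const 1))))) (.iset 6 (.reg 8))))

/-- Division with remainder by repeated subtraction; it terminates because m is positive. -/
theorem exec_digitProg (h1 : σ.ireg 1 = m) (hm : 0 < m) (hD : σ.ireg 6 ≤ D) :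
    Exec D 1 digitProg σ (fun τ => τ.ireg 17 = σ.ireg 6 % m ∧ τ.ireg 6 = σ.ireg 6 / m) := by
  set y := σ.ireg 6 with hy
  refine Exec.seq (P := fun τ => τ.ireg 8 = 0) (Exec.iset (by simp [IExpr.eval])) fun σ₁ F₁ h8 => ?_
  refine Exec.seq (P := fun τ => τ.ireg 17 = y)
    (Exec.iset (by simp [IExpr.eval, F₁.i 6 rfl, hy])) fun σ₂ F₂ h17 => ?_
  refine Exec.seq (P := fun τ => τ.ireg 17 = y % m ∧ τ.ireg 8 = y / m) ?_ fun σ₃ F₃ h₃ =>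
    Exec.iset (by simpa [IExpr.eval] using h₃)
  have hdm := Nat.div_add_mod y m
  have hmod := Nat.mod_lt y hm
  refine Exec.loop (N := y / m) (fun j τ => τ.ireg 17 + m * j = y ∧ τ.ireg 8 = j)
    ((Nat.div_le_self _ _).trans hD) ⟨by simpa using h17, by rw [F₂.i 8 rfl, h8]⟩ ?_ ?_
  · rintro j hj τ F ⟨h, h'⟩
    have e1 : τ.ireg 1 = m := by rw [F.i 1 rfl, F₂.i 1 rfl, F₁.i 1 rfl, h1]
    have hle : m * (j + 1) ≤ m * (y / m) := Nat.mul_le_mul_left m hj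
    rw [mul_add, mul_one] at hle
    refine ⟨?_, ?_⟩
    · simp only [Test.holds, IExpr.eval, e1]
      omega
    · refine Exec.seq' (Exec.iset (Exec.iset ?_))
      simp only [IExpr.eval, State.setI_ireg, e1]
      norm_num
      refine ⟨?_, h'⟩
      rw [mul_add, mul_one]
      omega
  · rintro τ F ⟨h, h'⟩
    have e1 : τ.ireg 1 = m := by rw [F.i 1 rfl, F₂.i 1 rfl, F₁.i 1 rfl, h1]
    have h17' : τ.ireg 17 = y % m := by omega
    refine ⟨?_, h17', h'⟩
    simp only [Test.holds, IExpr.eval, e1, h17', not_not]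
    exact hmod

/-- Register `6` is set to zero if the number in register `17` occurs among the first entries
of the array of digits. -/
def checkProg : Program :=
  .forLoop 15 (.reg 7) (.branch (.ilt (.load 0 (.reg 15)) (.reg 17)) .skip
    (.branch (.ilt (.reg 17) (.load 0 (.reg 15))) .skip (.rset 6 (.const 0))))

theorem exec_checkProg (hD : σ.ireg 7 ≤ D) :
    Exec D 1 checkProg σ (fun τ => τ.rreg 6 =
      if ∀ i < σ.ireg 7, σ.imem 0 i ≠ σ.ireg 17 then σ.rreg 6 else 0) := by
  refine Exec.forLoop (fun j τ => τ.rreg 6 =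
      if ∀ i < j, σ.imem 0 i ≠ σ.ireg 17 then σ.rreg 6 else 0) hD rfl
    (fun τ h => by rw [IExpr.eval, h.i 7 rfl]) (fun _ _ _ h => h) (by simp) ?_ (fun _ _ h => h)
  intro j _ τ F hj hI
  have key : σ.imem 0 j ≠ σ.ireg 17 → τ.rreg 6 =
      if ∀ i < j + 1, σ.imem 0 i ≠ σ.ireg 17 then σ.rreg 6 else 0 := by
    intro hne
    rw [hI]
    refine if_congr ⟨fun h i hi => ?_, fun h i hi => h i (by omega)⟩ rfl rfl
    rcases Nat.lt_succ_iff_lt_or_eq.1 hi with h1 | rfl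
    · exact h i h1
    · exact hne
  -- Equality is not a test of the machine; it is what remains when both strict inequalities fail.
  refine Exec.branch (fun h => Exec.skip (key ?_)) fun h => Exec.branch
    (fun h' => Exec.skip (key ?_)) fun h' => Exec.rset ?_
  · simp only [Test.holds, IExpr.eval, hj, F.im 0 rfl, F.i 17 rfl] at h
    exact h.ne
  · simp only [Test.holds, IExpr.eval, hj, F.im 0 rfl, F.i 17 rfl] at h'
    exact h'.ne'
  · simp only [Test.holds, IExpr.eval, hj, F.im 0 rfl, F.i 17 rfl] at h h'
    rw [if_neg fun hall => hall j (Nat.lt_succ_self j) (by omega)]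
    simp [RExpr.eval]

/-- One more digit is processed. -/
def tupleProg : Program :=
  .seq digitProg (.seq checkProg (.seq (.istore 0 (.reg 7) (.reg 17)) stepProg))

theorem mem_digitList {m s x k : ℕ} : k ∈ digitList m s x ↔ ∃ i < s, x / m ^ i % m = k := by
  induction s with
  | zero => simp [digitList]
  | succ s ih =>
    rw [digitList, List.mem_cons, ih]
    constructor
    · rintro (rfl | ⟨i, hi, h⟩)
      · exact ⟨s, by omega, rfl⟩
      · exact ⟨i, by omega, h⟩
    · rintro ⟨i, hi, h⟩
      rcases Nat.lt_succ_iff_lt_or_eq.1 hi with h1 | rfl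
      · exact Or.inr ⟨i, h1, h⟩
      · exact Or.inl h.symm

/-- The memory after `j` digits of `x` have been processed. -/
structure HoldsDigits (Q : ℕ → Matrix (Fin n) (Fin n) ℝ) (m x j : ℕ) (σ : State) : Prop where
  quot : σ.ireg 6 = x / m ^ j
  digits : ∀ i < j, σ.imem 0 i = x / m ^ i % m
  flag : σ.rreg 6 = if (digitList m j x).Nodup then 1 else 0
  data : HoldsData σ (tupleData Q (digitList m j x))

theorem exec_tupleProg {Q : ℕ → Matrix (Fin n) (Fin n) ℝ} {x j : ℕ} (h0 : σ.ireg 0 = n)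
    (h1 : σ.ireg 1 = m) (h7 : σ.ireg 7 = j) (hm : 0 < m) (hn : n ≤ D) (hx : x ≤ D) (hj : j ≤ D)
    (hQ : ∀ k < m, ∀ i l : Fin n, σ.rmem 0 ((k * n + i) * n + l) = Q k i l)
    (h : HoldsDigits Q m x j σ) :
    Exec D 4 tupleProg σ (HoldsDigits Q m x (j + 1)) := by
  have h6 : σ.ireg 6 ≤ D := by
    rw [h.quot]
    exact (Nat.div_le_self _ _).trans hx
  refine Exec.seq ((exec_digitProg h1 hm h6).mono (by norm_num)) fun σ₁ F₁ h₁ => ?_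
  have e7 : σ₁.ireg 7 = j := by rw [F₁.i 7 rfl, h7]
  have e17 : σ₁.ireg 17 = x / m ^ j % m := by rw [h₁.1, h.quot]
  refine Exec.seq ((exec_checkProg (e7.trans_le hj)).mono (by norm_num)) fun σ₂ F₂ h₂ => ?_
  refine Exec.seq (P := fun τ => ∀ i < j + 1, τ.imem 0 i = x / m ^ i % m)
    (Exec.istore ?_) fun σ₃ F₃ h₃ => ?_
  · intro i hi
    simp only [IExpr.eval, State.putI_imem, if_true, F₂.i 7 rfl, F₂.i 17 rfl, e7, e17,
      Function.update_apply, F₂.im 0 rfl, F₁.im 0 rfl]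
    split_ifs with hij
    · rw [hij]
    · exact h.digits i (by omega)
  have e17' : σ₃.ireg 17 = x / m ^ j % m := by rw [F₃.i 17 rfl, F₂.i 17 rfl, e17]
  have e0 : σ₃.ireg 0 = n := by rw [F₃.i 0 rfl, F₂.i 0 rfl, F₁.i 0 rfl, h0]
  have hd : HoldsData σ₃ (tupleData Q (digitList m j x)) := by
    refine ⟨fun i l => ?_, ?_⟩
    · rw [F₃.rm 1 rfl, F₂.rm 1 rfl, F₁.rm 1 rfl, h.data.1]
    · rw [F₃.r 2 rfl, F₂.r 2 rfl, F₁.r 2 rfl, h.data.2]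
  refine Exec.conseq (exec_stepProg e0 hn hd (A := Q (x / m ^ j % m)) fun i l => ?_)
    fun τ F hτ => ⟨?_, ?_, ?_, ?_⟩
  · rw [F₃.rm 0 rfl, F₂.rm 0 rfl, F₁.rm 0 rfl, e17']
    exact hQ _ (Nat.mod_lt _ hm) i l
  · rw [F.i 6 rfl, F₃.i 6 rfl, F₂.i 6 rfl, h₁.2, h.quot, Nat.div_div_eq_div_mul, pow_succ]
  · rw [F.im 0 rfl]
    exact h₃
  · have hiff : (digitList m (j + 1) x).Nodup ↔
        (∀ i < σ₁.ireg 7, σ₁.imem 0 i ≠ σ₁.ireg 17) ∧ (digitList m j x).Nodup := by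
      rw [digitList, List.nodup_cons, mem_digitList, e7, e17, F₁.im 0 rfl]
      refine and_congr ?_ Iff.rfl
      push Not
      exact forall₂_congr fun i hi => by rw [h.digits i hi]
    rw [F.r 6 rfl, F₃.r 6 rfl, h₂, F₁.r 6 rfl, h.flag, if_congr hiff rfl rfl, ite_and]
  · rw [digitList, tupleData, digitList_length]
    rwa [F₃.i 7 rfl, F₂.i 7 rfl, e7] at hτ

/-- The contribution of the tuple whose number is in register `5` is added to register `3`. -/
def termProg : Program :=
  .seq (.iset 6 (.reg 5)) (.seq (.rset 2 (.const 1)) (.seq (.rset 6 (.const 1))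
    (.seq (mulProg 18 (.reg 0) (.reg 0)) (.seq (.forLoop 9 (.reg 18) (.rstore 1 (.reg 9) (.const 0)))
      (.seq (.forLoop 7 (.reg 3) tupleProg)
        (.rset 3 (.add (.reg 3) (.mul (.reg 6) (.reg 2)))))))))

/-- The flag in register 6 is 0 or 1, so multiplying by it discards tuples with repetitions. Array 1
is cleared first, since it may hold a matrix from another tuple. With m = 0 the extraction of a
digit would not halt, but then s = 0 and no digit is extracted. -/
theorem exec_termProg {Q : ℕ → Matrix (Fin n) (Fin n) ℝ} {x s : ℕ} (h0 : σ.ireg 0 = n)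
    (h1 : σ.ireg 1 = m) (h5 : σ.ireg 5 = x) (h3 : σ.ireg 3 = s) (hm : s = 0 ∨ 0 < m) (hn : n * n ≤ D)
    (hx : x ≤ D) (hs : s ≤ D)
    (hQ : ∀ k < m, ∀ i l : Fin n, σ.rmem 0 ((k * n + i) * n + l) = Q k i l) :
    Exec D 5 termProg σ (fun τ => τ.rreg 3 = σ.rreg 3 +
      if (digitList m s x).Nodup then (tupleData Q (digitList m s x)).2 else 0) := by
  have hn' : n ≤ D := (Nat.le_mul_self n).trans hn
  refine Exec.seq (P := fun τ => τ.ireg 6 = x) (Exec.iset (by simp [IExpr.eval, h5]))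
    fun σ₁ F₁ h₁ => ?_
  refine Exec.seq (P := fun τ => τ.rreg 2 = 1) (Exec.rset (by simp [RExpr.eval]))
    fun σ₂ F₂ h₂ => ?_
  refine Exec.seq (P := fun τ => τ.rreg 6 = 1) (Exec.rset (by simp [RExpr.eval]))
    fun σ₃ F₃ h₃ => ?_
  have e0 : σ₃.ireg 0 = n := by rw [F₃.i 0 rfl, F₂.i 0 rfl, F₁.i 0 rfl, h0]
  refine Exec.seq ((exec_mulProg (v := n) (v' := n) hn' (by norm_num)
      (fun υ hυ => by rw [IExpr.eval, hυ.i 0 rfl, e0])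
      (fun υ hυ => by rw [IExpr.eval, hυ.i 0 rfl, e0])).mono (by norm_num)) fun σ₄ F₄ h₄ => ?_
  refine Exec.seq (P := fun τ => ∀ a < n * n, τ.rmem 1 a = 0) (Exec.mono (a := 1) ?_ (by norm_num))
    fun σ₅ F₅ h₅ => ?_
  · refine Exec.forLoop (fun j τ => ∀ a < j, τ.rmem 1 a = 0) hn rfl
      (fun τ h => by rw [IExpr.eval, h.i 18 rfl, h₄]) (fun _ _ _ h => h)
      (fun a ha => absurd ha (Nat.not_lt_zero a)) ?_ (fun _ _ h => h)
    intro j _ τ F hj hI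
    refine Exec.rstore fun a ha => ?_
    simp only [IExpr.eval, RExpr.eval, State.putR_rmem, if_true, hj, Function.update_apply,
      Nat.cast_zero]
    split_ifs with haj
    · rfl
    · exact hI a (by omega)
  have hstart : HoldsDigits Q m x 0 σ₅ := by
    refine ⟨?_, fun i hi => absurd hi (Nat.not_lt_zero i), ?_, ?_, ?_⟩
    · rw [F₅.i 6 rfl, F₄.i 6 rfl, F₃.i 6 rfl, F₂.i 6 rfl, h₁, pow_zero, Nat.div_one]
    · rw [F₅.r 6 rfl, F₄.r 6 rfl, h₃]
      simp [digitList]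
    · intro i l
      have : Filled n (n * n) (σ₅.rmem 1) (fun _ _ => 0) := fun _ _ _ _ h => h₅ _ h
      rw [this.apply i.2 l.2]
      rfl
    · rw [F₅.r 2 rfl, F₄.r 2 rfl, F₃.r 2 rfl, h₂]
      rfl
  refine Exec.seq (P := HoldsDigits Q m x s) ?_ fun σ₆ F₆ h₆ => Exec.rset ?_
  · refine Exec.forLoop (fun j τ => HoldsDigits Q m x j τ) hs rfl
      (fun τ h => by rw [IExpr.eval, h.i 3 rfl, F₅.i 3 rfl, F₄.i 3 rfl, F₃.i 3 rfl, F₂.i 3 rfl,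
        F₁.i 3 rfl, h3])
      (fun j τ v h => ⟨h.quot, h.digits, h.flag, h.data⟩) hstart ?_ (fun _ _ h => h)
    intro j hj τ F h7 hI
    refine exec_tupleProg ?_ ?_ h7 (hm.resolve_left (by omega)) hn' hx (by omega) ?_ hI
    · rw [F.i 0 rfl, F₅.i 0 rfl, F₄.i 0 rfl, e0]
    · rw [F.i 1 rfl, F₅.i 1 rfl, F₄.i 1 rfl, F₃.i 1 rfl, F₂.i 1 rfl, F₁.i 1 rfl, h1]
    · rw [F.rm 0 rfl, F₅.rm 0 rfl, F₄.rm 0 rfl, F₃.rm 0 rfl, F₂.rm 0 rfl, F₁.rm 0 rfl]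
      exact hQ
  · simp only [RExpr.eval, State.setR_rreg, if_true, h₆.flag, h₆.data.2, F₆.r 3 rfl, F₅.r 3 rfl,
      F₄.r 3 rfl, F₃.r 3 rfl, F₂.r 3 rfl, F₁.r 3 rfl]
    split_ifs <;> simp

/-- The coefficient of degree `s` of the average is written to array `3`, the product of `s` and
of the Taylor coefficient of degree `s` of its logarithm is written to array `4`, and the latter
coefficient is added to register `1`; register `4` holds `m ^ s`. -/
def coeffProg : Program :=
  .seq (.rset 3 (.const 0)) (.seq (.forLoop 5 (.reg 4) termProg)
    (.seq (.rstore 3 (.reg 3) (.reg 3))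
      (.seq (.rset 4 (.mul (.cast (.reg 3)) (.reg 3)))
        (.seq (.forLoop 15 (.reg 3) (.rset 4 (.sub (.reg 4)
            (.mul (.load 4 (.reg 15)) (.load 3 (.sub (.reg 3) (.reg 15)))))))
          (.seq (.rstore 4 (.reg 3) (.reg 4))
            (.seq (.rset 1 (.add (.reg 1) (.div (.reg 4) (.cast (.reg 3)))))
              (.seq (mulProg 14 (.reg 4) (.reg 1)) (.iset 4 (.reg 14)))))))))

/-- The memory after the coefficients of degree less than `s` of the polynomial `p` and of its
logarithm have been computed. -/
structure HoldsCoeffs (p : Polynomial ℝ) (m s : ℕ) (σ : State) : Prop where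
  power : σ.ireg 4 = m ^ s
  coeff : ∀ i < s, σ.rmem 3 i = p.coeff i
  logCoeff : ∀ i < s, σ.rmem 4 i = i * logCoeff p i
  sum : σ.rreg 1 = ∑ i ∈ Finset.range s, GaussianProduct.logCoeff p i

/-- The recursion solved for its top term, using p(0) = 1. The term i = 0 vanishes, so the program
may start its sum there. -/
theorem mul_logCoeff_eq {p : Polynomial ℝ} (hp : p.coeff 0 = 1) (s : ℕ) :
    (s : ℝ) * logCoeff p s = s * p.coeff s -
      ∑ i ∈ Finset.range s, i * logCoeff p i * p.coeff (s - i) := by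
  cases s with
  | zero => simp
  | succ s =>
    have h := mul_coeff_eq_sum_logCoeff hp s
    rw [Finset.sum_range_succ, Nat.sub_self, hp, mul_one] at h
    rw [Finset.sum_range_succ']
    push_cast
    rw [h]
    simp only [zero_mul, add_zero]
    ring

theorem exec_coeffProg {Q : Fin m → Matrix (Fin n) (Fin n) ℝ} (hQs : ∀ k, (Q k).IsSymm) {s : ℕ}
    (h0 : σ.ireg 0 = n) (h1 : σ.ireg 1 = m) (h3 : σ.ireg 3 = s) (hn : n * n ≤ D) (hm : m ≤ D)
    (hms : m ^ s ≤ D) (hs : s ≤ D)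
    (hQ : ∀ k < m, ∀ i l : Fin n, σ.rmem 0 ((k * n + i) * n + l) = natFamily Q k i l)
    (h : HoldsCoeffs (avgPoly Q Finset.univ) m s σ) :
    Exec D 6 coeffProg σ (HoldsCoeffs (avgPoly Q Finset.univ) m (s + 1)) := by
  set p := avgPoly Q Finset.univ with hp
  have hp0 : p.coeff 0 = 1 := avgPoly_coeff_zero _ _
  refine Exec.seq (P := fun τ => τ.rreg 3 = 0) (Exec.rset (by simp [RExpr.eval]))
    fun σ₁ F₁ h₁ => ?_
  refine Exec.seq (P := fun τ => τ.rreg 3 = p.coeff s) ?_ fun σ₂ F₂ h₂ => ?_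
  · rw [hp, coeff_eq_sum_digitList hQs]
    refine Exec.forLoop (N := m ^ s) (fun N τ => τ.rreg 3 = ∑ x ∈ Finset.range N,
      if (digitList m s x).Nodup then (tupleData (natFamily Q) (digitList m s x)).2 else 0) hms rfl
      (fun τ h' => by rw [IExpr.eval, h'.i 4 rfl, F₁.i 4 rfl, h.power]) (fun _ _ _ h => h)
      (by simpa using h₁) ?_ (fun _ _ h => h)
    intro x hx τ F h5 hI
    refine Exec.conseq (exec_termProg (Q := natFamily Q) (n := n) (m := m) (s := s) ?_ ?_ h5 ?_ ?_ hn
      (hx.le.trans hms) hs ?_) fun υ _ hυ => ?_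
    · rw [F.i 0 rfl, F₁.i 0 rfl, h0]
    · rw [F.i 1 rfl, F₁.i 1 rfl, h1]
    · rw [F.i 3 rfl, F₁.i 3 rfl, h3]
    · rcases Nat.eq_zero_or_pos m with rfl | hm0
      · rcases Nat.eq_zero_or_pos s with rfl | hs0
        · exact Or.inl rfl
        · rw [zero_pow hs0.ne'] at hx
          exact absurd hx (Nat.not_lt_zero x)
      · exact Or.inr hm0
    · rw [F.rm 0 rfl, F₁.rm 0 rfl]
      exact hQ
    · rw [hυ, hI, Finset.sum_range_succ]
  have e3 : σ₂.ireg 3 = s := by rw [F₂.i 3 rfl, F₁.i 3 rfl, h3]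
  refine Exec.seq (P := fun τ => ∀ i < s + 1, τ.rmem 3 i = p.coeff i) (Exec.rstore ?_)
    fun σ₃ F₃ h₃ => ?_
  · intro i hi
    simp only [IExpr.eval, RExpr.eval, State.putR_rmem, if_true, e3, h₂, Function.update_apply,
      F₂.rm 3 rfl, F₁.rm 3 rfl]
    split_ifs with his
    · rw [his]
    · exact h.coeff i (by omega)
  have e3' : σ₃.ireg 3 = s := by rw [F₃.i 3 rfl, e3]
  refine Exec.seq (P := fun τ => τ.rreg 4 = s * p.coeff s)
    (Exec.rset (by simp [RExpr.eval, IExpr.eval, e3', F₃.r 3 rfl, h₂])) fun σ₄ F₄ h₄ => ?_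
  refine Exec.seq (P := fun τ => τ.rreg 4 = s * logCoeff p s) (Exec.mono (a := 1) ?_ (by norm_num))
    fun σ₅ F₅ h₅ => ?_
  · rw [mul_logCoeff_eq hp0]
    refine Exec.forLoop (fun j τ => τ.rreg 4 = s * p.coeff s -
      ∑ i ∈ Finset.range j, i * logCoeff p i * p.coeff (s - i)) hs rfl
      (fun τ h' => by rw [IExpr.eval, h'.i 3 rfl, F₄.i 3 rfl, e3']) (fun _ _ _ h => h)
      (by simpa using h₄) ?_ (fun _ _ h => h)
    intro j hj τ F h15 hI
    refine Exec.rset ?_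
    have hE : τ.rmem 3 (s - j) = p.coeff (s - j) := by
      rw [F.rm 3 rfl, F₄.rm 3 rfl, h₃ _ (by omega)]
    have hL : τ.rmem 4 j = j * logCoeff p j := by
      rw [F.rm 4 rfl, F₄.rm 4 rfl, F₃.rm 4 rfl, F₂.rm 4 rfl, F₁.rm 4 rfl, h.logCoeff j hj]
    simp only [RExpr.eval, IExpr.eval, State.setR_rreg, if_true, h15, F.i 3 rfl, F₄.i 3 rfl, e3',
      hE, hL, hI, Finset.sum_range_succ]
    ring
  have e3₅ : σ₅.ireg 3 = s := by rw [F₅.i 3 rfl, F₄.i 3 rfl, e3']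
  refine Exec.seq (P := fun τ => ∀ i < s + 1, τ.rmem 4 i = i * logCoeff p i) (Exec.rstore ?_)
    fun σ₆ F₆ h₆ => ?_
  · intro i hi
    simp only [IExpr.eval, RExpr.eval, State.putR_rmem, if_true, e3₅, h₅, Function.update_apply,
      F₅.rm 4 rfl, F₄.rm 4 rfl, F₃.rm 4 rfl, F₂.rm 4 rfl, F₁.rm 4 rfl]
    split_ifs with his
    · rw [his]
    · exact h.logCoeff i (by omega)
  refine Exec.seq (P := fun τ => τ.rreg 1 = ∑ i ∈ Finset.range (s + 1), logCoeff p i)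
    (Exec.rset ?_) fun σ₇ F₇ h₇ => ?_
  · simp only [RExpr.eval, IExpr.eval, State.setR_rreg, if_true, F₆.i 3 rfl, e3₅, F₆.r 4 rfl, h₅,
      F₆.r 1 rfl, F₅.r 1 rfl, F₄.r 1 rfl, F₃.r 1 rfl, F₂.r 1 rfl, F₁.r 1 rfl, h.sum,
      Finset.sum_range_succ]
    congr 1
    -- For s = 0 the program divides 0 by 0. The machine returns 0, which is the right coefficient
    -- because log p(0) = 0.
    rcases Nat.eq_zero_or_pos s with rfl | hs0
    · rw [logCoeff_zero hp0, mul_zero, zero_div]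
    · have : (s : ℝ) ≠ 0 := by positivity
      field_simp
  refine Exec.seq ((exec_mulProg (v := m ^ s) (v' := m) hm (by norm_num)
    (fun υ hυ => by rw [IExpr.eval, hυ.i 4 rfl, F₇.i 4 rfl, F₆.i 4 rfl, F₅.i 4 rfl, F₄.i 4 rfl,
      F₃.i 4 rfl, F₂.i 4 rfl, F₁.i 4 rfl, h.power])
    (fun υ hυ => by rw [IExpr.eval, hυ.i 1 rfl, F₇.i 1 rfl, F₆.i 1 rfl, F₅.i 1 rfl, F₄.i 1 rfl,
      F₃.i 1 rfl, F₂.i 1 rfl, F₁.i 1 rfl, h1])).mono (by norm_num)) fun σ₈ F₈ h₈ => ?_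
  refine Exec.conseq (P := fun τ => τ.ireg 4 = m ^ (s + 1))
    (Exec.iset (by simp [IExpr.eval, h₈, pow_succ])) fun τ F hτ => ⟨hτ, ?_, ?_, ?_⟩
  · rw [F.rm 3 rfl, F₈.rm 3 rfl, F₇.rm 3 rfl, F₆.rm 3 rfl, F₅.rm 3 rfl, F₄.rm 3 rfl]
    exact h₃
  · rw [F.rm 4 rfl, F₈.rm 4 rfl, F₇.rm 4 rfl]
    exact h₆
  · rw [F.r 1 rfl, F₈.r 1 rfl, h₇]

end CoefficientPrograms

end RealRAM

namespace RealRAM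

open Program GaussianProduct

/-! ### The main program -/

section MainProgram

variable {D n m : ℕ} {σ : State}

/-- Register `0` is set to `(1 + T / 2 ^ K) ^ (2 ^ K)` where `T` is the number in register `1` and
`K` is the number in register `2`. -/
def expProg : Program :=
  .seq (.rset 7 (.const 1)) (.seq (.forLoop 9 (.reg 2) (.rset 7 (.add (.reg 7) (.reg 7))))
    (.seq (.rset 0 (.add (.const 1) (.div (.reg 1) (.reg 7))))
      (.forLoop 9 (.reg 2) (.rset 0 (.mul (.reg 0) (.reg 0))))))

theorem exec_expProg {K : ℕ} (h2 : σ.ireg 2 = K) (hK : K ≤ D) :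
    Exec D 1 expProg σ (fun τ => τ.rreg 0 = (1 + σ.rreg 1 / 2 ^ K) ^ 2 ^ K) := by
  refine Exec.seq (P := fun τ => τ.rreg 7 = 1) (Exec.rset (by simp [RExpr.eval])) fun σ₁ F₁ h₁ => ?_
  refine Exec.seq (P := fun τ => τ.rreg 7 = 2 ^ K) ?_ fun σ₂ F₂ h₂ => ?_
  · refine Exec.forLoop (fun j τ => τ.rreg 7 = 2 ^ j) hK rfl
      (fun τ h => by rw [IExpr.eval, h.i 2 rfl, F₁.i 2 rfl, h2]) (fun _ _ _ h => h)
      (by simpa using h₁) ?_ (fun _ _ h => h)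
    intro j _ τ _ _ hI
    refine Exec.rset ?_
    simp only [RExpr.eval, State.setR_rreg, if_true, hI, pow_succ]
    ring
  refine Exec.seq (P := fun τ => τ.rreg 0 = 1 + σ.rreg 1 / 2 ^ K)
    (Exec.rset (by simp [RExpr.eval, h₂, F₂.r 1 rfl, F₁.r 1 rfl])) fun σ₃ F₃ h₃ => ?_
  refine Exec.forLoop (fun j τ => τ.rreg 0 = (1 + σ.rreg 1 / 2 ^ K) ^ 2 ^ j) hK rfl
    (fun τ h => by rw [IExpr.eval, h.i 2 rfl, F₃.i 2 rfl, F₂.i 2 rfl, F₁.i 2 rfl, h2])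
    (fun _ _ _ h => h) (by simpa using h₃) ?_ (fun _ _ h => h)
  intro j _ τ _ _ hI
  refine Exec.rset ?_
  simp only [RExpr.eval, State.setR_rreg, if_true, hI]
  rw [← pow_add, pow_succ, mul_two]

/-- Register `2` is increased by `c` for every doubling of `ε` which is needed to reach
`max m 2`. -/
def degreeProg (c : ℕ) : Program :=
  .seq (.rset 7 (.reg 0))
    (.loop (.rlt (.reg 7) (.cast (.add (.reg 1) (.sub (.const 2) (.reg 1)))))
      (.seq (.rset 7 (.add (.reg 7) (.reg 7))) (.iset 2 (.add (.reg 2) (.const c)))))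

/-- The number of doublings of `ε` which are needed to reach `max m 2`. -/
noncomputable def doublings (m : ℕ) (ε : ℝ) : ℕ := ⌈Real.logb 2 (((max m 2 : ℕ) : ℝ) / ε)⌉₊

/-- The program cannot take logarithms; it doubles ε and compares, and this is the test it performs.
-/
theorem lt_doublings_iff {ε : ℝ} (hε : 0 < ε) (j : ℕ) :
    j < doublings m ε ↔ 2 ^ j * ε < ((max m 2 : ℕ) : ℝ) := by
  have hM : (0 : ℝ) < ((max m 2 : ℕ) : ℝ) := by positivity
  rw [doublings, Nat.lt_ceil, Real.lt_logb_iff_rpow_lt one_lt_two (by positivity),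
    Real.rpow_natCast, lt_div_iff₀ hε]

theorem exec_degreeProg {c : ℕ} {ε : ℝ} (hε : 0 < ε) (h1 : σ.ireg 1 = m) (h2 : σ.ireg 2 = 0)
    (h0 : σ.rreg 0 = ε) (hD : doublings m ε ≤ D) :
    Exec D 1 (degreeProg c) σ (fun τ => τ.ireg 2 = c * doublings m ε) := by
  refine Exec.seq (P := fun τ => τ.rreg 7 = ε) (Exec.rset (by simp [RExpr.eval, h0]))
    fun σ₁ F₁ h₁ => ?_
  refine Exec.loop (N := doublings m ε) (fun j τ => τ.rreg 7 = 2 ^ j * ε ∧ τ.ireg 2 = c * j) hD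
    ⟨by simpa using h₁, by rw [F₁.i 2 rfl, h2, mul_zero]⟩ ?_ ?_
  · rintro j hj τ F ⟨h, h'⟩
    have e1 : τ.ireg 1 = m := by rw [F.i 1 rfl, F₁.i 1 rfl, h1]
    refine ⟨?_, Exec.seq' (Exec.rset (Exec.iset ⟨?_, ?_⟩))⟩
    · simp only [Test.holds, RExpr.eval, IExpr.eval, h, e1]
      rw [show m + (2 - m) = max m 2 by omega]
      exact (lt_doublings_iff hε j).1 hj
    · simp only [RExpr.eval, State.setI_rreg, State.setR_rreg, if_true, h]
      ring
    · simp only [IExpr.eval, State.setI_ireg, State.setR_ireg, if_true, h']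
      ring
  · rintro τ F ⟨h, h'⟩
    have e1 : τ.ireg 1 = m := by rw [F.i 1 rfl, F₁.i 1 rfl, h1]
    refine ⟨?_, h'⟩
    simp only [Test.holds, RExpr.eval, IExpr.eval, h, e1]
    rw [show m + (2 - m) = max m 2 by omega]
    exact fun hlt => lt_irrefl _ ((lt_doublings_iff hε _).2 hlt)

/-- The program which approximates the average. -/
def mainProg (c : ℕ) : Program :=
  .seq (degreeProg c) (.seq (.iset 4 (.const 1))
    (.seq (.forLoop 3 (.add (.reg 2) (.const 1)) coeffProg) expProg))

/-- The exponent 7 is the nesting depth: degrees, tuples, digits, rows, columns, the sum for one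
matrix entry, and the multiplication for an address. -/
theorem exec_mainProg {c : ℕ} {Q : Fin m → Matrix (Fin n) (Fin n) ℝ} (hQ : ∀ k, (Q k).IsSymm)
    {ε : ℝ} (hε : 0 < ε) (hn : n * n ≤ D) (hm : m ≤ D) (hJ : doublings m ε ≤ D)
    (hK : c * doublings m ε + 1 ≤ D) (hmK : ∀ s ≤ c * doublings m ε, m ^ s ≤ D) :
    Exec D 7 (mainProg c) (input Q ε) (fun τ =>
      τ.rreg 1 = logTaylor Q (c * doublings m ε) ∧
      τ.rreg 0 = (1 + logTaylor Q (c * doublings m ε) / 2 ^ (c * doublings m ε)) ^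
        2 ^ (c * doublings m ε)) := by
  set K := c * doublings m ε
  refine Exec.seq ((exec_degreeProg (c := c) hε (σ := input Q ε) (m := m) rfl rfl rfl hJ).mono
    (by norm_num)) fun σ₁ F₁ h₁ => ?_
  refine Exec.seq (P := fun τ => τ.ireg 4 = 1) (Exec.iset (by simp [IExpr.eval]))
    fun σ₂ F₂ h₂ => ?_
  have e0 : σ₂.ireg 0 = n := by rw [F₂.i 0 rfl, F₁.i 0 rfl]; rfl
  have e1 : σ₂.ireg 1 = m := by rw [F₂.i 1 rfl, F₁.i 1 rfl]; rfl
  have e2 : σ₂.ireg 2 = K := by rw [F₂.i 2 rfl, h₁]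
  have er : σ₂.rmem 0 = (input Q ε).rmem 0 := by rw [F₂.rm 0 rfl, F₁.rm 0 rfl]
  refine Exec.seq (P := fun τ => τ.rreg 1 = logTaylor Q K) ?_ fun σ₃ F₃ h₃ => ?_
  · rw [logTaylor_eq]
    refine Exec.forLoop (fun s τ => HoldsCoeffs (avgPoly Q Finset.univ) m s τ) hK rfl
      (fun τ h => by rw [IExpr.eval, IExpr.eval, IExpr.eval, h.i 2 rfl, e2])
      (fun j τ v h => ⟨h.power, h.coeff, h.logCoeff, h.sum⟩) ⟨?_, ?_, ?_, ?_⟩ ?_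
      (fun τ _ h => h.sum)
    · rw [h₂, pow_zero]
    · exact fun i hi => absurd hi (Nat.not_lt_zero i)
    · exact fun i hi => absurd hi (Nat.not_lt_zero i)
    · rw [F₂.r 1 rfl, F₁.r 1 rfl, Finset.sum_range_zero]
      rfl
    · intro s hs τ F h3 hI
      refine exec_coeffProg hQ (by rw [F.i 0 rfl, e0]) (by rw [F.i 1 rfl, e1]) h3 hn hm
        (hmK s (by omega)) (by omega) ?_ hI
      intro k hk i l
      rw [F.rm 0 rfl, er, natFamily, dif_pos hk]
      exact input_rmem_entry Q ε ⟨k, hk⟩ i l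
  · refine Exec.conseq ((exec_expProg (K := K) (by rw [F₃.i 2 rfl, e2]) (by omega)).mono
      (by norm_num)) fun τ F hτ => ⟨by rw [F.r 1 rfl, h₃], by rw [hτ, h₃]⟩

/-! ### Bounds for the degree and for the number of steps. -/

theorem one_le_doublings {ε : ℝ} (hε : 0 < ε) (hε1 : ε < 1) : 1 ≤ doublings m ε := by
  refine (lt_doublings_iff hε 0).2 ?_
  have : (2 : ℝ) ≤ ((max m 2 : ℕ) : ℝ) := by exact_mod_cast le_max_right m 2
  linarith

theorem le_two_pow_doublings_mul {ε : ℝ} (hε : 0 < ε) :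
    ((max m 2 : ℕ) : ℝ) ≤ 2 ^ doublings m ε * ε :=
  not_lt.1 fun h => lt_irrefl _ ((lt_doublings_iff hε _).2 h)

/-- Put x = ln M − ln ε. As x ≥ ln 2, the 1 lost in rounding up is at most x/ln 2, and 2/ln 2 < 4.
-/
theorem doublings_le {ε : ℝ} (hε : 0 < ε) (hε1 : ε < 1) :
    (doublings m ε : ℝ) ≤ 4 * (Real.log ((max m 2 : ℕ) : ℝ) - Real.log ε) := by
  have hM : (2 : ℝ) ≤ ((max m 2 : ℕ) : ℝ) := by exact_mod_cast le_max_right m 2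
  have hlog := Real.log_le_log two_pos hM
  have hε' := Real.log_neg hε hε1
  have h2 := Real.log_two_gt_d9
  have hnn : 0 ≤ Real.logb 2 (((max m 2 : ℕ) : ℝ) / ε) := by
    refine Real.logb_nonneg one_lt_two ?_
    rw [le_div_iff₀ hε]
    linarith
  have h := (Nat.ceil_lt_add_one hnn).le
  refine h.trans ?_
  rw [Real.logb, Real.log_div (by positivity) hε.ne']
  set x := Real.log ((max m 2 : ℕ) : ℝ) - Real.log ε with hx
  have hx2 : Real.log 2 ≤ x := by linarith
  rw [← le_sub_iff_add_le, div_le_iff₀ (by linarith)]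
  nlinarith

/-- All constants go into the exponent of M ≥ 2: the size S is at most M^(SK) as K ≥ 1, and the
added 1 is absorbed by doubling the exponent of M. -/
theorem steps_le {S c t : ℕ} {ε : ℝ} (hε : 0 < ε) (hε1 : ε < 1) (hc : 1 ≤ c)
    (ht : t ≤ S * ((max n 1) ^ 2 * (max m 2) ^ (c * doublings m ε) + 1) ^ 7) :
    (t : ℝ) ≤ ((max n 1 : ℕ) : ℝ) ^ ((14 + S) * (4 * c)) * ((max m 2 : ℕ) : ℝ) ^
      ((((14 + S) * (4 * c) : ℕ) : ℝ) * (Real.log ((max m 2 : ℕ) : ℝ) - Real.log ε)) := by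
  set N := max n 1
  set M := max m 2
  set K := c * doublings m ε with hK
  have hN : 1 ≤ N := le_max_right _ _
  have hM : 2 ≤ M := le_max_right _ _
  have hK1 : 1 ≤ K := Nat.mul_pos hc (one_le_doublings hε hε1)
  have h1 : N ^ 2 * M ^ K + 1 ≤ N ^ 2 * M ^ (2 * K) := by
    have hp : 1 ≤ N ^ 2 * M ^ K := Nat.mul_pos (by positivity) (by positivity)
    calc N ^ 2 * M ^ K + 1 ≤ N ^ 2 * M ^ K * 2 := by omega
      _ ≤ N ^ 2 * M ^ K * M ^ K := Nat.mul_le_mul_left _ (hM.trans (Nat.le_self_pow (by omega) _))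
      _ = N ^ 2 * M ^ (2 * K) := by ring
  have h2 : t ≤ N ^ 14 * M ^ ((14 + S) * K) := by
    calc t ≤ S * (N ^ 2 * M ^ (2 * K)) ^ 7 := ht.trans (by gcongr)
      _ ≤ M ^ (S * K) * (N ^ 2 * M ^ (2 * K)) ^ 7 := by
        refine Nat.mul_le_mul_right _ ?_
        calc S ≤ 2 ^ S := Nat.lt_two_pow_self.le
          _ ≤ M ^ S := Nat.pow_le_pow_left hM _
          _ ≤ M ^ (S * K) := Nat.pow_le_pow_right (by omega) (Nat.le_mul_of_pos_right _ hK1)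
      _ = N ^ 14 * M ^ ((14 + S) * K) := by ring
  have h3 : (t : ℝ) ≤ (N : ℝ) ^ 14 * (M : ℝ) ^ (((14 + S) * K : ℕ) : ℝ) := by
    rw [Real.rpow_natCast]
    exact_mod_cast h2
  refine h3.trans ?_
  have hN' : (1 : ℝ) ≤ N := by exact_mod_cast hN
  have hM' : (1 : ℝ) ≤ M := by exact_mod_cast (by omega : 1 ≤ M)
  gcongr
  · nlinarith
  · have hd := doublings_le (m := m) hε hε1
    rw [hK]
    push_cast
    calc ((14 : ℝ) + S) * (c * doublings m ε)
        ≤ (14 + S) * (c * (4 * (Real.log (M : ℝ) - Real.log ε))) := by gcongr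
      _ = _ := by ring

end MainProgram

end RealRAM

namespace GaussianProduct

/-! ### The main theorem -/

theorem abs_log_one_add_sub_le {u : ℝ} (hu : |u| ≤ 1 / 2) :
    |Real.log (1 + u) - u| ≤ 2 * u ^ 2 := by
  have h := Real.abs_log_sub_add_sum_range_le (x := -u) (by rw [abs_neg]; linarith) 1
  simp only [Finset.sum_range_one, zero_add, pow_one, Nat.cast_zero, div_one, sub_neg_eq_add,
    abs_neg] at h
  rw [show Real.log (1 + u) - u = -u + Real.log (1 + u) by ring]
  refine h.trans ?_
  rw [div_le_iff₀ (by linarith), ← sq_abs u]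
  norm_num
  nlinarith [sq_nonneg |u|]

/-- The first condition on c controls the truncation of the Taylor series, the second one the
approximation of the exponential. -/
theorem exists_degree_factor {θ : ℝ} (hθ : 0 ≤ θ) (hθ1 : θ < 1) :
    ∃ c : ℕ, 2 ≤ c ∧ θ ^ c ≤ (1 - θ) / 8 ∧ 8 ≤ (1 - θ) ^ 2 * 2 ^ (c - 2) := by
  have hκ : 0 < 1 - θ := by linarith
  obtain ⟨a, ha⟩ := exists_pow_lt_of_lt_one (show 0 < (1 - θ) / 8 by positivity) hθ1
  obtain ⟨b, hb⟩ := pow_unbounded_of_one_lt (8 / (1 - θ) ^ 2) one_lt_two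
  refine ⟨a + b + 2, by omega, ?_, ?_⟩
  · exact (pow_le_pow_of_le_one hθ hθ1.le (by omega)).trans ha.le
  · rw [div_lt_iff₀' (by positivity)] at hb
    refine hb.le.trans ?_
    gcongr
    · exact one_le_two
    · omega

/-- θ^(cJ) ≤ ((1 − θ)/8)^J. A factor 2^(−J) of this turns M into at most ε, and what remains is at
most (1 − θ)/4, since J ≥ 1. -/
theorem truncation_le {θ M ε : ℝ} {c J : ℕ} (hθ : 0 ≤ θ) (hθ1 : θ < 1) (hε : 0 < ε)
    (hJ : 1 ≤ J) (hMJ : M ≤ 2 ^ J * ε) (hc : θ ^ c ≤ (1 - θ) / 8) :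
    M * θ ^ (c * J + 1) * (1 - θ)⁻¹ ≤ ε / 4 := by
  have hκ : 0 < 1 - θ := by linarith
  have h1 : θ ^ (c * J + 1) ≤ (1 / 2) ^ J * ((1 - θ) / 4) := by
    calc θ ^ (c * J + 1) ≤ θ ^ (c * J) := pow_le_pow_of_le_one hθ hθ1.le (by omega)
      _ = (θ ^ c) ^ J := pow_mul _ _ _
      _ ≤ ((1 - θ) / 8) ^ J := by gcongr
      _ = (1 / 2) ^ J * ((1 - θ) / 4) ^ J := by rw [← mul_pow]; ring
      _ ≤ (1 / 2) ^ J * ((1 - θ) / 4) := by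
        gcongr
        exact pow_le_of_le_one (by positivity) (by linarith) (by omega)
  calc M * θ ^ (c * J + 1) * (1 - θ)⁻¹ ≤
      2 ^ J * ε * ((1 / 2) ^ J * ((1 - θ) / 4)) * (1 - θ)⁻¹ := by gcongr
    _ = (2 * (1 / 2)) ^ J * (ε / 4) * ((1 - θ) * (1 - θ)⁻¹) := by rw [mul_pow]; ring
    _ = ε / 4 := by rw [mul_inv_cancel₀ hκ.ne']; norm_num

/-- From M ≤ 2^J ε and ε < 1 one gets M² ≤ 4^J ε. Two of the c factors 2^J pay for 4^J, which
explains the c − 2. -/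
theorem le_mul_two_pow {θ M ε : ℝ} {c J : ℕ} (hθ1 : θ < 1) (hM : 0 < M)
    (hε : 0 < ε) (hε1 : ε < 1) (hJ : 1 ≤ J) (hMJ : M ≤ 2 ^ J * ε) (hc2 : 2 ≤ c)
    (hc : 8 ≤ (1 - θ) ^ 2 * 2 ^ (c - 2)) :
    8 * (M * (1 - θ)⁻¹) ^ 2 ≤ ε * 2 ^ (c * J) := by
  have hκ : 0 < 1 - θ := by linarith
  have h1 : (2 : ℝ) ^ (c - 2) * (2 ^ J) ^ 2 ≤ 2 ^ (c * J) := by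
    rw [← pow_mul, ← pow_add]
    refine pow_le_pow_right₀ one_le_two ?_
    obtain ⟨d, rfl⟩ := Nat.exists_eq_add_of_le hc2
    have : d ≤ d * J := Nat.le_mul_of_pos_right _ hJ
    rw [add_mul]
    omega
  have h2 : M ^ 2 ≤ (2 ^ J) ^ 2 * ε := by
    calc M ^ 2 ≤ (2 ^ J * ε) ^ 2 := by gcongr
      _ = (2 ^ J) ^ 2 * (ε * ε) := by ring
      _ ≤ (2 ^ J) ^ 2 * ε := by
        gcongr
        exact mul_le_of_le_one_left hε.le hε1.le
  calc 8 * (M * (1 - θ)⁻¹) ^ 2 = 8 * M ^ 2 * ((1 - θ)⁻¹) ^ 2 := by ring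
    _ ≤ ((1 - θ) ^ 2 * 2 ^ (c - 2)) * ((2 ^ J) ^ 2 * ε) * ((1 - θ)⁻¹) ^ 2 := by gcongr
    _ = ((1 - θ) * (1 - θ)⁻¹) ^ 2 * ε * (2 ^ (c - 2) * (2 ^ J) ^ 2) := by ring
    _ ≤ ε * 2 ^ (c * J) := by
      rw [mul_inv_cancel₀ hκ.ne', one_pow, one_mul]
      gcongr

/-- With u = T/L the error is L (log(1 + u) − u), at most 2T²/L in absolute value. As B ≥ 1, the
condition on L also ensures |u| ≤ ½. -/
theorem pow_approximates_exp {T B ε : ℝ} {L : ℕ} (hT : |T| ≤ B) (hB : 1 ≤ B) (hε1 : ε < 1)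
    (hL : 8 * B ^ 2 ≤ ε * L) :
    0 < (1 + T / L) ^ L ∧ |Real.log ((1 + T / L) ^ L) - T| ≤ ε / 4 := by
  have hLpos : (0 : ℝ) < L := by
    refine (Nat.cast_nonneg L).lt_of_ne fun h => ?_
    rw [← h, mul_zero] at hL
    nlinarith
  have hu : |T / L| ≤ 1 / 2 := by
    rw [abs_div, Nat.abs_cast, div_le_iff₀ hLpos]
    nlinarith
  have hpos : 0 < 1 + T / L := by linarith [(abs_le.1 hu).1]
  refine ⟨pow_pos hpos _, ?_⟩
  have h := abs_log_one_add_sub_le hu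
  have h1 : Real.log ((1 + T / L) ^ L) - T = L * (Real.log (1 + T / L) - T / L) := by
    rw [Real.log_pow]
    field_simp
  rw [h1, abs_mul, Nat.abs_cast]
  have h2 : T ^ 2 ≤ B ^ 2 := sq_le_sq' (by linarith [(abs_le.1 hT).1]) (abs_le.1 hT).2
  calc (L : ℝ) * |Real.log (1 + T / L) - T / L| ≤ L * (2 * (T / L) ^ 2) := by gcongr
    _ = 2 * T ^ 2 / L := by field_simp
    _ ≤ ε / 4 := by
      rw [div_le_iff₀ hLpos]
      linarith

theorem abs_sub_le_of_abs_log_sub_le {v p ε : ℝ} (hv : 0 < v) (hp : 0 < p) (hε1 : ε < 1)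
    (h : |Real.log v - Real.log p| ≤ ε / 2) : |v - p| ≤ ε * p := by
  have h1 : v - p = p * (Real.exp (Real.log v - Real.log p) - 1) := by
    rw [Real.exp_sub, Real.exp_log hv, Real.exp_log hp]
    field_simp
  have h2 := Real.abs_exp_sub_one_le (x := Real.log v - Real.log p) (by linarith)
  rw [h1, abs_mul, abs_of_pos hp, mul_comm]
  exact mul_le_mul_of_nonneg_right (by linarith) hp.le

end GaussianProduct

theorem mainTheorem4 (γ' : ℝ) (hγ'_pos : 0 < γ') (hγ'_lt : γ' < 1 / 4 * Real.exp (-(1 / 2))) :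
    ∃ (A : RealRAM.Program) (C : ℕ) (K : ℕ → ℝ → ℕ),
      (∀ (m : ℕ) (ε : ℝ), 0 < ε → ε < 1 →
        (K m ε : ℝ) ≤ C * (Real.log ((max m 2 : ℕ) : ℝ) - Real.log ε)) ∧
      ∀ (n m r : ℕ) (Q : Fin m → Matrix (Fin n) (Fin n) ℝ) (ε : ℝ),
        0 < ε → ε < 1 → 1 ≤ r →
        (∀ k, (Q k).IsSymm) →
        GaussianProduct.IsSparse r (fun k => GaussianProduct.form (Q k)) →
        (∀ (k : Fin m) (x : EuclideanSpace ℝ (Fin n)),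
          |GaussianProduct.form (Q k) x| ≤ γ' / r * ‖x‖ ^ 2) →
        0 < GaussianProduct.average Q 1 ∧
        |Real.log (GaussianProduct.average Q 1) - GaussianProduct.logTaylor Q (K m ε)| ≤ ε ∧
        (∀ s : ℕ, iteratedDeriv s (GaussianProduct.average Q) 0 =
          (s.factorial : ℝ) * GaussianProduct.traceSum Q s) ∧
        ∃ (τ : RealRAM.State) (t : ℕ),
          RealRAM.Run A (GaussianProduct.input Q ε) τ t ∧
          (t : ℝ) ≤ ((max n 1 : ℕ) : ℝ) ^ C *
            ((max m 2 : ℕ) : ℝ) ^ ((C : ℝ) * (Real.log ((max m 2 : ℕ) : ℝ) - Real.log ε)) ∧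
          τ.rreg 1 = GaussianProduct.logTaylor Q (K m ε) ∧
          0 < τ.rreg 0 ∧
          |Real.log (τ.rreg 0) - Real.log (GaussianProduct.average Q 1)| ≤ ε ∧
          |τ.rreg 0 - GaussianProduct.average Q 1| ≤ ε * GaussianProduct.average Q 1 := by
  -- The inverse of the radius of the zero-free disc.
  set θ := γ' / (1 / 4 * Real.exp (-(1 / 2))) with hθ
  have hγ : (0 : ℝ) < 1 / 4 * Real.exp (-(1 / 2)) := by positivity
  have hθ0 : 0 < θ := by positivity
  have hθ1 : θ < 1 := (div_lt_one hγ).2 hγ'_lt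
  obtain ⟨c, hc2, hcθ, hc⟩ := GaussianProduct.exists_degree_factor hθ0.le hθ1
  refine ⟨RealRAM.mainProg c, (14 + (RealRAM.mainProg c).size) * (4 * c),
    fun m ε => c * RealRAM.doublings m ε, ?_, ?_⟩
  · intro m ε hε hε1
    have hd := RealRAM.doublings_le (m := m) hε hε1
    have hnn : (0 : ℝ) ≤ RealRAM.doublings m ε := Nat.cast_nonneg _
    set x := Real.log ((max m 2 : ℕ) : ℝ) - Real.log ε
    have hx : 0 ≤ x := by linarith
    push_cast
    calc (c : ℝ) * RealRAM.doublings m ε ≤ 1 * (c * (4 * x)) := by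
          rw [one_mul]
          gcongr
      _ ≤ (14 + (RealRAM.mainProg c).size) * (c * (4 * x)) := by
          gcongr
          linarith [(Nat.cast_nonneg (RealRAM.mainProg c).size : (0 : ℝ) ≤ _)]
      _ = _ := by ring
  · intro n m r Q ε hε hε1 hr hQ hS hq
    set J := RealRAM.doublings m ε with hJ
    have hJ1 : 1 ≤ J := RealRAM.one_le_doublings hε hε1
    have hMJ : ((max m 2 : ℕ) : ℝ) ≤ 2 ^ J * ε := RealRAM.le_two_pow_doublings_mul hε
    have hM2 : 2 ≤ max m 2 := le_max_right m 2
    have hM : (2 : ℝ) ≤ ((max m 2 : ℕ) : ℝ) := by exact_mod_cast hM2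
    set p := GaussianProduct.avgPoly Q Finset.univ with hp
    have hp0 : p.coeff 0 = 1 := GaussianProduct.avgPoly_coeff_zero _ _
    have hpz : ∀ z : ℂ, ‖z‖ ≤ θ⁻¹ → Polynomial.aeval z p ≠ 0 := fun z hz =>
      GaussianProduct.avgPoly_ne_zero_of_isSparse hγ'_pos hr hQ hS hq (by rwa [hθ, inv_div] at hz)
    have hdeg : (p.natDegree : ℝ) ≤ ((max m 2 : ℕ) : ℝ) := by
      have := GaussianProduct.avgPoly_natDegree_le Q Finset.univ
      rw [Finset.card_univ, Fintype.card_fin] at this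
      exact_mod_cast this.trans (le_max_left m 2)
    have hκ : 0 < 1 - θ := by linarith
    have hpos : 0 < GaussianProduct.average Q 1 := by
      rw [GaussianProduct.average_eq_eval]
      exact GaussianProduct.eval_one_pos hp0 (one_le_inv₀ hθ0 |>.2 hθ1.le) hpz
    have hT : |Real.log (GaussianProduct.average Q 1) - GaussianProduct.logTaylor Q (c * J)| ≤
        ε / 4 := by
      rw [GaussianProduct.average_eq_eval, GaussianProduct.logTaylor_eq]
      refine (GaussianProduct.abs_log_sub_sum_logCoeff_le hp0 hθ0 hθ1 hpz _).trans ?_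
      refine le_trans ?_ (GaussianProduct.truncation_le hθ0.le hθ1 hε hJ1 hMJ hcθ)
      gcongr
    have hTB : |GaussianProduct.logTaylor Q (c * J)| ≤ ((max m 2 : ℕ) : ℝ) * (1 - θ)⁻¹ := by
      rw [GaussianProduct.logTaylor_eq]
      refine (GaussianProduct.abs_sum_logCoeff_le hp0 hθ0 hθ1 hpz _).trans ?_
      gcongr
    have hB1 : 1 ≤ ((max m 2 : ℕ) : ℝ) * (1 - θ)⁻¹ := by
      have : 1 ≤ (1 - θ)⁻¹ := (one_le_inv₀ hκ).2 (by linarith)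
      nlinarith
    have hL := GaussianProduct.le_mul_two_pow hθ1 (by linarith) hε hε1 hJ1 hMJ hc2 hc
    obtain ⟨hv, hlogv⟩ := GaussianProduct.pow_approximates_exp (L := 2 ^ (c * J)) hTB hB1 hε1
      (by rw [Nat.cast_pow, Nat.cast_ofNat]; exact hL)
    rw [Nat.cast_pow, Nat.cast_ofNat] at hv hlogv
    set N := max n 1 with hN
    have hN1 : 1 ≤ N := le_max_right n 1
    have hcJ : 1 ≤ c * J := Nat.mul_pos (by omega) hJ1
    have hle : ∀ a, a ≤ (max m 2) ^ (c * J) → a ≤ N ^ 2 * (max m 2) ^ (c * J) := fun a ha =>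
      ha.trans (Nat.le_mul_of_pos_left _ (by positivity))
    have hmM : m ≤ max m 2 := le_max_left m 2
    have hcJM : c * J < (max m 2) ^ (c * J) :=
      Nat.lt_two_pow_self.trans_le (Nat.pow_le_pow_left hM2 _)
    -- D has to bound all loop lengths: n² matrix cells, m, the number K + 1 of degrees, and m^s
    -- tuples for s ≤ K.
    obtain ⟨τ, t, hrun, ht, h1, h0⟩ := RealRAM.exec_mainProg
      (D := N ^ 2 * (max m 2) ^ (c * J)) (c := c) hQ hε
      (by
        rw [← pow_two]
        exact (Nat.pow_le_pow_left (le_max_left n 1) 2).trans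
          (Nat.le_mul_of_pos_right _ (by positivity)))
      (hle _ (hmM.trans (Nat.le_self_pow (by omega) _)))
      (hle _ ((Nat.le_mul_of_pos_left _ (by omega)).trans hcJM.le))
      (hle _ hcJM)
      (fun s hs => hle _ ((Nat.pow_le_pow_left hmM s).trans
        (Nat.pow_le_pow_right (by omega) hs)))
    -- Truncation and exponentiation cost ε/4 each. The spare factor 2 is used to pass from
    -- logarithms to the relative error, by |e^u − 1| ≤ 2|u|.
    have hlog : |Real.log (τ.rreg 0) - Real.log (GaussianProduct.average Q 1)| ≤ ε / 2 := by
      rw [h0]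
      rw [abs_sub_comm] at hT
      linarith [abs_sub_le (Real.log ((1 + GaussianProduct.logTaylor Q (c * J) / 2 ^ (c * J)) ^
        2 ^ (c * J))) (GaussianProduct.logTaylor Q (c * J)) (Real.log (GaussianProduct.average Q 1))]
    refine ⟨hpos, hT.trans (by linarith), GaussianProduct.iteratedDeriv_average hQ, τ, t, hrun,
      RealRAM.steps_le hε hε1 (by omega) ht, h1, by rw [h0]; exact hv, hlog.trans (by linarith), ?_⟩
    exact GaussianProduct.abs_sub_le_of_abs_log_sub_le (by rw [h0]; exact hv) hpos hε1 hlog
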